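/- **Notation.** For $\tau\in\mathbb H$ write $\tau=x+iy$, $q^r=e^{2\pi i r\tau}$. For $u,v\in\mathbb C\setminus(\mathbb Z\tau+\mathbb Z)$ let $$\vartheta(z;\tau)=\sum_{\nu\in\mathbb Z+\frac12}e^{\pi i\nu^2\tau+2\pi i\nu(z+\frac12)},\qquad \mu(u,v;\tau)=\frac{e^{\pi i u}}{\vartheta(v;\tau)}\sum_{n\in\mathbb Z}\frac{(-1)^n e^{2\pi i n v}q^{n(n+1)/2}}{1-e^{2\pi i u}q^n},$$ $$R(u;\tau)=\sum_{\nu\in\mathbb Z+\frac12}\Big(\operatorname{sgn}(\nu)-2\int_0^{(\nu+\frac{\operatorname{Im}u}{\operatorname{Im}\tau})\sqrt{2\operatorname{Im}\tau}}e^{-\pi t^2}dt\Big)(-1)^{\nu-\frac12}e^{-\pi i\nu^2\tau-2\pi i\nu u},\qquad \widehat\mu(u,v;\tau)=\mu(u,v;\tau)+\tfrac i2R(u-v;\tau).$$ Let $\Gamma^0(N)$ be the set of $\begin{pmatrix}a&b\\c&d\end{pmatrix}\in SL_2(\mathbb Z)$ with $N\mid b$, let $\Gamma^1(N)$ be the set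 of those with moreover $a\equiv d\equiv1\pmod N$, and let $\Gamma_0(2)$ be given by $2\mid c$. A *harmonic Maass form* of weight $k\in\frac12\mathbb Z$ for a finite index subgroup $\Gamma\subseteq SL_2(\mathbb Z)$ with multiplier $\psi:\Gamma\to\mathbb C$, $|\psi|=1$, is a smooth $F:\mathbb H\to\mathbb C$ such that (1) $F(\gamma\tau)=\psi(\gamma)(c\tau+d)^kF(\tau)$ for all $\gamma=\begin{pmatrix}a&b\\c&d\end{pmatrix}\in\Gamma$ (principal branch); (2) $\Delta_kF=0$, where $\Delta_k=-y^2(\partial_x^2+\partial_y^2)+iky(\partial_x+i\partial_y)$; (3) for every $\gamma=\begin{pmatrix}a&b\\c&d\end{pmatrix}\in SL_2(\mathbb Z)$ there are $N\ge1$, a polynomial $p_\gamma\in\mathbb C[q^{-1/N}]$ and $\epsilon>0$ with $(c\tau+d)^{-k}F(\gamma\tau)-p_\gamma(\tau)=O(e^{-\epsilon y})$ as $y\to\infty$, uniformly in $x$. If $F=f^++f^-$ with, for some $N\ge1$, $$f^+=\sum_{n\gg-\infty}c^+(n)q^{n/N},\qquad f^-=\sum_{n<0}c^-(n)\,\Gamma(1-k,4\pi|n|y/N)\,q^{n/N},\qquad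 \Gamma(s,t)=\int_t^\infty w^{s-1}e^{-w}\,dw,$$ then $f^+$ and $f^-$ are the holomorphic and non-holomorphic parts of $F$. A *mock modular form* of weight $k$ for $\Gamma$ is the holomorphic part of a harmonic Maass form of weight $k$ for $\Gamma$ (with some multiplier) whose non-holomorphic part is not zero. **Theorem.** Let $A\in\mathbb Z$, $C\in\mathbb N$ with $\gcd(A,C)=1$ and $0<\frac AC<1$, let $a\in\{0,1,2,3\}$, and assume $\frac AC\ne\frac12$ when $a$ is odd. Put $\alpha=\frac{A}{2C}\tau+\frac a4$, $$V_\alpha(\tau)=i^{a+1}q^{-\frac{(2A-C)^2}{8C^2}}\mu\big(2\alpha,\tfrac\tau2;\tau\big),\qquad \widehat V_\alpha(\tau)=i^{a+1}q^{-\frac{(2A-C)^2}{8C^2}}\widehat\mu\big(2\alpha,\tfrac\tau2;\tau\big),$$ $$A_\alpha=\begin{cases}\Gamma^1(\operatorname{lcm}(2,C)) & a\in\{0,2\},\\ \Gamma^1(\operatorname{lcm}(2,C))\cap\Gamma_0(2) & a\in\{1,3\},\ 4\nmid C,\\ \big(\Gamma^1(C)\cap\Gamma_0(2)\big)\cup\Big(\big(\Gamma^1(\tfrac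 C2)\cap\Gamma^0(C)\big)\setminus\big(\Gamma_0(2)\cup\Gamma^1(C)\big)\Big) & a\in\{1,3\},\ 4\mid C.\end{cases}$$ Then $A_\alpha$ is a congruence subgroup of $SL_2(\mathbb Z)$ and $V_\alpha$ is a mock modular form of weight $\frac12$ for $A_\alpha$. More precisely, $\widehat V_\alpha$ is a harmonic Maass form of weight $\frac12$ for $A_\alpha$ with a multiplier whose values are roots of unity, its holomorphic part is $V_\alpha$, and its non-holomorphic part is not zero. -/

import Mathlib

open UpperHalfPlane CongruenceSubgroup
open scoped MatrixGroups ContDiff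

noncomputable section

namespace MockV

/-! ### Zwegers' functions -/

/-- `q ^ r = exp (2 π i r τ)` for a rational exponent `r`, where `q = exp (2 π i τ)`. -/
def qpow (r : ℚ) (τ : ℍ) : ℂ :=
  Complex.exp (2 * Real.pi * Complex.I * (r : ℂ) * (τ : ℂ))

/-- The Jacobi theta function `∑ exp (π i ν² τ + 2 π i ν (z + 1/2))`, summed over the
half-integers `ν = n + 1/2`. -/
def vartheta (z : ℂ) (τ : ℍ) : ℂ :=
  ∑' n : ℤ, Complex.exp (Real.pi * Complex.I * ((n : ℂ) + 1 / 2) ^ 2 * (τ : ℂ)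
    + 2 * Real.pi * Complex.I * ((n : ℂ) + 1 / 2) * (z + 1 / 2))

/-- The Appell–Lerch sum `μ(u, v; τ)`, for `u, v ∉ ℤ τ + ℤ`. -/
def mu (u v : ℂ) (τ : ℍ) : ℂ :=
  Complex.exp (Real.pi * Complex.I * u) / vartheta v τ *
    ∑' n : ℤ, (-1 : ℂ) ^ n * Complex.exp (2 * Real.pi * Complex.I * (n : ℂ) * v)
      * qpow ((n : ℚ) * (n + 1) / 2) τ
      / (1 - Complex.exp (2 * Real.pi * Complex.I * u) * qpow (n : ℚ) τ)

/-- Zwegers' non-holomorphic function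
`R(u; τ) = ∑ (sgn ν - 2 ∫₀^{(ν + Im u / Im τ) √(2 Im τ)} exp (-π t²) dt)
  (-1)^(ν - 1/2) exp (-π i ν² τ - 2 π i ν u)`, summed over the half-integers `ν = n + 1/2`. -/
def zwegersR (u : ℂ) (τ : ℍ) : ℂ :=
  ∑' n : ℤ,
    ((Real.sign ((n : ℝ) + 1 / 2)
        - 2 * ∫ t in (0 : ℝ)..(((n : ℝ) + 1 / 2 + u.im / τ.im) * Real.sqrt (2 * τ.im)),
            Real.exp (-Real.pi * t ^ 2) : ℝ) : ℂ)
      * (-1 : ℂ) ^ n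
      * Complex.exp (-Real.pi * Complex.I * ((n : ℂ) + 1 / 2) ^ 2 * (τ : ℂ)
          - 2 * Real.pi * Complex.I * ((n : ℂ) + 1 / 2) * u)

/-- Zwegers' completion `μ̂(u, v; τ) = μ(u, v; τ) + (i / 2) R(u - v; τ)`. -/
def muHat (u v : ℂ) (τ : ℍ) : ℂ :=
  mu u v τ + Complex.I / 2 * zwegersR (u - v) τ

/-! ### The functions `V_α` and their completions -/

/-- `α = (A / 2C) τ + a / 4`. -/
def alpha (A : ℤ) (C a : ℕ) (τ : ℍ) : ℂ :=
  (A : ℂ) / (2 * (C : ℂ)) * (τ : ℂ) + (a : ℂ) / 4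

/-- `V_α(τ) = i^(a+1) q^(-(2A-C)²/(8C²)) μ(2α, τ/2; τ)`. -/
def V (A : ℤ) (C a : ℕ) (τ : ℍ) : ℂ :=
  Complex.I ^ (a + 1) * qpow (-((2 * (A : ℚ) - C) ^ 2 / (8 * (C : ℚ) ^ 2))) τ
    * mu (2 * alpha A C a τ) ((τ : ℂ) / 2) τ

/-- `V̂_α(τ) = i^(a+1) q^(-(2A-C)²/(8C²)) μ̂(2α, τ/2; τ)`. -/
def VHat (A : ℤ) (C a : ℕ) (τ : ℍ) : ℂ :=
  Complex.I ^ (a + 1) * qpow (-((2 * (A : ℚ) - C) ^ 2 / (8 * (C : ℚ) ^ 2))) τ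
    * muHat (2 * alpha A C a τ) ((τ : ℂ) / 2) τ

/-! ### The groups `A_α` -/

/-- `Γ⁰(N)`: the matrices in `SL₂(ℤ)` with upper right entry divisible by `N`. -/
def GammaUpper0 (N : ℕ) : Set SL(2, ℤ) :=
  {γ | γ 0 1 ≡ 0 [ZMOD N]}

/-- `Γ¹(N)`: the matrices in `SL₂(ℤ)` that are lower unitriangular modulo `N`. -/
def GammaUpper1 (N : ℕ) : Set SL(2, ℤ) :=
  {γ | γ 0 0 ≡ 1 [ZMOD N] ∧ γ 1 1 ≡ 1 [ZMOD N] ∧ γ 0 1 ≡ 0 [ZMOD N]}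

/-- The underlying set of `A_α`; that it is a group is part of the theorem. -/
def ASet (C a : ℕ) : Set SL(2, ℤ) :=
  if Even a then GammaUpper1 (Nat.lcm 2 C)
  else if ¬ 4 ∣ C then GammaUpper1 (Nat.lcm 2 C) ∩ (Gamma0 2 : Set SL(2, ℤ))
  else (GammaUpper1 C ∩ (Gamma0 2 : Set SL(2, ℤ))) ∪
    ((GammaUpper1 (C / 2) ∩ GammaUpper0 C) \ ((Gamma0 2 : Set SL(2, ℤ)) ∪ GammaUpper1 C))

/-! ### Harmonic Maass forms and mock modular forms -/

/-- A function on `ℍ` in the real coordinates `τ = x + i y` (only `y > 0` is meaningful). -/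
def coord (f : ℍ → ℂ) (x y : ℝ) : ℂ :=
  f (ofComplex ((x : ℂ) + (y : ℂ) * Complex.I))

/-- The weight `k` hyperbolic Laplacian
`Δ_k = -y² (∂²/∂x² + ∂²/∂y²) + i k y (∂/∂x + i ∂/∂y)`. -/
def laplacian (k : ℝ) (f : ℍ → ℂ) (τ : ℍ) : ℂ :=
  -(τ.im : ℂ) ^ 2 *
      (deriv (fun x => deriv (fun x' => coord f x' τ.im) x) τ.re
        + deriv (fun y => deriv (fun y' => coord f τ.re y') y) τ.im)
    + Complex.I * (k : ℂ) * (τ.im : ℂ) *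
      (deriv (fun x => coord f x τ.im) τ.re
        + Complex.I * deriv (fun y => coord f τ.re y) τ.im)

/-- The automorphy factor `(c τ + d)^k`, principal branch. -/
def autFactor (k : ℝ) (γ : SL(2, ℤ)) (τ : ℍ) : ℂ :=
  (((γ 1 0 : ℤ) : ℂ) * (τ : ℂ) + ((γ 1 1 : ℤ) : ℂ)) ^ (k : ℂ)

/-- Harmonic Maass forms of weight `k ∈ ½ℤ` for a finite index subgroup `Γ` of `SL₂(ℤ)`, with
multiplier `ψ : Γ → ℂ`, `|ψ| = 1`. -/
structure IsHarmonicMaassForm (k : ℝ) (Γ : Subgroup SL(2, ℤ)) (ψ : Γ → ℂ) (F : ℍ → ℂ) :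
    Prop where
  half_integral : ∃ m : ℤ, k = (m : ℝ) / 2
  finiteIndex : Γ.FiniteIndex
  norm_multiplier : ∀ γ : Γ, ‖ψ γ‖ = 1
  smooth : ContDiffOn ℝ ∞ (fun z : ℂ => F (ofComplex z)) {z : ℂ | 0 < z.im}
  transform : ∀ (γ : Γ) (τ : ℍ),
    F ((γ : SL(2, ℤ)) • τ) = ψ γ * autFactor k (γ : SL(2, ℤ)) τ * F τ
  harmonic : ∀ τ : ℍ, laplacian k F τ = 0
  growth : ∀ γ : SL(2, ℤ), ∃ (N : ℕ) (P : Polynomial ℂ) (ε : ℝ), 0 < N ∧ 0 < ε ∧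
    (fun τ : ℍ => (autFactor k γ τ)⁻¹ * F (γ • τ) - P.eval (qpow (-1 / (N : ℚ)) τ))
      =O[atImInfty] (fun τ : ℍ => Real.exp (-ε * τ.im))

/-- The upper incomplete Gamma function `Γ(s, x) = ∫_x^∞ t^(s-1) e^(-t) dt`, for `x > 0`. -/
def upperGamma (s x : ℝ) : ℝ :=
  ∫ t in Set.Ioi x, t ^ (s - 1) * Real.exp (-t)

/-- `f` is the holomorphic part and `g` the non-holomorphic part of the weight `k` harmonic Maass
form `F`: one has `F = f + g` with Fourier expansions
`f = ∑_{n ≫ -∞} c⁺(n) q^(n/N)` and `g = ∑_{n < 0} c⁻(n) Γ(1 - k, 4 π |n| y / N) q^(n/N)`. -/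
def HasParts (k : ℝ) (F f g : ℍ → ℂ) : Prop :=
  (∀ τ, F τ = f τ + g τ) ∧
  ∃ (N : ℕ) (cp cm : ℤ → ℂ), 0 < N ∧
    (∃ n₀ : ℤ, ∀ n < n₀, cp n = 0) ∧ (∀ n : ℤ, 0 ≤ n → cm n = 0) ∧
    (∀ τ : ℍ, HasSum (fun n : ℤ => cp n * qpow ((n : ℚ) / N) τ) (f τ)) ∧
    (∀ τ : ℍ, HasSum (fun n : ℤ =>
      cm n * (upperGamma (1 - k) (4 * Real.pi * |(n : ℝ)| * τ.im / N) : ℂ)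
        * qpow ((n : ℚ) / N) τ) (g τ))

/-- `F` is a harmonic Maass form with holomorphic part `f` and nonzero non-holomorphic part. -/
def IsMockCompletion (k : ℝ) (Γ : Subgroup SL(2, ℤ)) (ψ : Γ → ℂ) (f F : ℍ → ℂ) : Prop :=
  IsHarmonicMaassForm k Γ ψ F ∧ ∃ g : ℍ → ℂ, HasParts k F f g ∧ g ≠ 0

/-- A mock modular form is the holomorphic part of a harmonic Maass form whose non-holomorphic
part is not zero. -/
def IsMockModularForm (k : ℝ) (Γ : Subgroup SL(2, ℤ)) (f : ℍ → ℂ) : Prop :=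
  ∃ (ψ : Γ → ℂ) (F : ℍ → ℂ), IsMockCompletion k Γ ψ f F

end MockV

end

noncomputable section

namespace MockV

open Filter Asymptotics Set
open scoped Real Topology ComplexConjugate

local notation "cexp" => Complex.exp
local notation "𝕚" => Complex.I

/-! ### Fourier series -/

/-! Zwegers' completed function at torsion points u = p₁τ + p₂, v = r₁τ + r₂, multiplied by
exp(-πi(p₁ - r₁)²τ), is `torsionMu p r`. For p = (A/C, a/2) and r = (1/2, 0) it is V̂_α up to the
constant i^(a+1) (`VHat_eq`), so everything reduces to `torsionMu`.

Modularity. The heart is `muC_inversion`, the behaviour of μ̂ under t ↦ -1/t. Let f(u) be μ̂(u, v;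
t) plus its suitably normalized inversion. The error terms of the Appell sum and of R under u ↦ u +
t cancel (`muC_add_modulus`), so f has pure multipliers along both periods. The antiholomorphic
derivatives of R cancel by the inversion of theta (`rConj_inversion`), so f is holomorphic off the
lattice with at most simple poles on it. Then f(u)θ(u) extends to an entire function with constant
multipliers 1 and exp(-2πiv), and such a function is zero when v is off the lattice
(`eq_zero_of_quasiperiodic`). No Mordell integral is evaluated. The same uniqueness shows that θ
vanishes only on the lattice (`theta_ne_zero`). With T and S as generators, `transformsUnder` gives
for every γ the law torsionMu p r (γτ) = ζ (cτ+d)^(1/2) torsionMu (pγ) (rγ) τ with ζ a root of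
unity. Up to roots of unity only p and r modulo ℤ² matter (`torsionMu_add_int`), so the elements
fixing both classes act by a multiplier. That stabilizer is A_α (`stab_iff_mem_ASet`).

Growth. The transformation law moves every cusp to infinity at the cost of changing the torsion
points. There the holomorphic summand has an expansion in q^(1/N), by periodicity and at most
exponential growth. The remaining series has terms sgn(ν) - E(λ√(2y)) with λ = ν + p₁ - r₁.
Replacing sgn(ν) by sgn(λ) changes finitely many terms, which are powers of q⁻¹ or constants; what
is left decays (`torsionMu_polyGrowth`).

Harmonicity and the two parts. For 0 < A/C < 1 the signs of ν and λ always agree, so V̂_α is V_α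
plus a multiple of `nonHol`. The antiholomorphic derivative of `nonHol` is y^(-1/2) times the
conjugate of a theta series, which gives Δ = 0 (`laplacian_eq_zero`). The identity Γ(1/2, πx²) =
√π(1 - E(x)) gives the required Fourier expansion. The coefficient belonging to λ = A/C is nonzero:
only for C = 2 does a second frequency share its exponent, and there the two contributions add for
even a. For odd a they would cancel, which is why A/C = 1/2 is excluded. -/

/-- An absolutely convergent Fourier series that vanishes identically has zero coefficients. -/
theorem fourier_coeff_eq_zero {b : ℤ → ℂ} (hb : Summable fun n => ‖b n‖)
    (h : ∀ x : ℝ, ∑' n : ℤ, b n * cexp (2 * π * 𝕚 * n * x) = 0) (m : ℤ) : b m = 0 := by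
  have hF : Summable fun n : ℤ => b n • (fourier n : C(AddCircle (1 : ℝ), ℂ)) := by
    refine Summable.of_norm ?_
    simpa [norm_smul, fourier_norm] using hb
  have hsum := hF.hasSum
  have h0 : ∑' n : ℤ, b n • (fourier n : C(AddCircle (1 : ℝ), ℂ)) = 0 := by
    ext x
    induction x using QuotientAddGroup.induction_on with
    | H x =>
      rw [← ContinuousMap.tsum_apply hF]
      simpa [fourier_coe_apply] using h x
  rw [h0] at hsum
  -- In L² of the circle the exponentials are orthonormal, so pairing the vanishing sum with the
  -- `m`-th one leaves `b m`.
  have h2 := (ContinuousMap.toLp (E := ℂ) 2 (AddCircle.haarAddCircle (T := (1 : ℝ))) ℂ).hasSum hsum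
  have h3 := (innerSL ℂ (fourierLp (T := (1 : ℝ)) 2 m)).hasSum h2
  simp only [map_smul, map_zero] at h3
  have h4 : HasSum (fun n : ℤ => if n = m then b m else 0) (0 : ℂ) := by
    refine h3.congr_fun fun n => ?_
    have := (orthonormal_iff_ite.mp (orthonormal_fourier (T := (1 : ℝ)))) m n
    simp only [innerSL_apply_apply]
    change _ = b n • inner ℂ (fourierLp 2 m) (fourierLp 2 n)
    rw [this]
    by_cases hnm : n = m
    · subst hnm; simp
    · simp [hnm, Ne.symm hnm]
  exact ((hasSum_ite_eq m (b m)).unique h4)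

/-- The integral of an entire 1-periodic function over a horizontal period does not depend
on the height. -/
theorem integral_horizontal_period {G : ℂ → ℂ} (hG : Differentiable ℂ G)
    (h1 : ∀ z, G (z + 1) = G z) (w : ℂ) :
    ∫ x in (0 : ℝ)..1, G (x + w) = ∫ x in (0 : ℝ)..1, G x := by
  have hrect := Complex.integral_boundary_rect_eq_zero_of_differentiableOn G (w.re : ℂ)
    (w.re + 1 + w.im * 𝕚) hG.differentiableOn
  simp only [Complex.ofReal_re, Complex.ofReal_im, Complex.add_re, Complex.one_re, Complex.mul_re,
    Complex.I_re, Complex.I_im, Complex.add_im, Complex.one_im, Complex.mul_im, mul_zero, mul_one,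
    zero_mul, add_zero, zero_add, Complex.ofReal_zero, sub_self, Complex.ofReal_add,
    Complex.ofReal_one] at hrect
  -- Periodicity makes the two vertical sides of the rectangle cancel.
  have hv : ∀ y : ℝ, G (w.re + 1 + y * 𝕚) = G (w.re + y * 𝕚) := fun y => by
    rw [← h1 (w.re + y * 𝕚)]; ring_nf
  simp only [hv, add_sub_cancel_right] at hrect
  have e1 : ∫ x in (w.re : ℝ)..(w.re + 1), G x = ∫ x in (0 : ℝ)..1, G x := by
    have hper : Function.Periodic (fun x : ℝ => G x) 1 := fun x => by
      simpa using h1 x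
    simpa using hper.intervalIntegral_add_eq w.re 0
  have e2 : ∫ x in (w.re : ℝ)..(w.re + 1), G (x + w.im * 𝕚) = ∫ x in (0 : ℝ)..1, G (x + w) := by
    have := intervalIntegral.integral_comp_add_right (a := 0) (b := 1)
      (fun x : ℝ => G (x + w.im * 𝕚)) w.re
    rw [zero_add, add_comm 1] at this
    rw [← this]
    refine intervalIntegral.integral_congr fun x _ => ?_
    simp only [Complex.ofReal_add, add_assoc, Complex.re_add_im]
  rw [← e1, ← e2]
  exact (sub_eq_zero.mp hrect).symm

/-- An entire function with multipliers `1` and `c` along the periods `1` and `t` vanishes,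
unless `c` is one of the multipliers of the exponentials `exp (2 π i n z)`. -/
theorem entire_eq_zero_of_multiplier {g : ℂ → ℂ} (hg : Differentiable ℂ g) {t c : ℂ}
    (h1 : ∀ z, g (z + 1) = g z) (h2 : ∀ z, g (z + t) = c * g z)
    (hc : ∀ n : ℤ, c ≠ cexp (2 * π * 𝕚 * n * t)) (z : ℂ) : g z = 0 := by
  -- The value at 0 is enough, since every translate of `g` satisfies the same hypotheses.
  have key : ∀ f : ℂ → ℂ, Differentiable ℂ f → (∀ z, f (z + 1) = f z) →
      (∀ z, f (z + t) = c * f z) → f 0 = 0 := by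
    intro f hf f1 f2
    -- Moving the contour by `t` leaves this Fourier integral unchanged but multiplies it by
    -- c·exp(-2πint), which is not 1; hence it vanishes.
    have hInt : ∀ n : ℤ, ∫ x in (0 : ℝ)..1, f x * cexp (2 * π * 𝕚 * (-n : ℂ) * x) = 0 := by
      intro n
      have hG : Differentiable ℂ fun z => f z * cexp (2 * π * 𝕚 * (-n : ℂ) * z) := by fun_prop
      have hG1 : ∀ z, (fun z => f z * cexp (2 * π * 𝕚 * (-n : ℂ) * z)) (z + 1)
          = (fun z => f z * cexp (2 * π * 𝕚 * (-n : ℂ) * z)) z := fun z => by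
        simp only [f1]
        rw [mul_add, mul_one, Complex.exp_add,
          show 2 * π * 𝕚 * (-n : ℂ) = ((-n : ℤ) : ℂ) * (2 * π * 𝕚) by push_cast; ring,
          Complex.exp_int_mul_two_pi_mul_I, mul_one]
      have h := integral_horizontal_period hG hG1 t
      have h' : ∫ x in (0 : ℝ)..1, f (x + t) * cexp (2 * π * 𝕚 * (-n : ℂ) * (x + t))
          = c * cexp (2 * π * 𝕚 * (-n : ℂ) * t) *
            ∫ x in (0 : ℝ)..1, f x * cexp (2 * π * 𝕚 * (-n : ℂ) * x) := by
        rw [← intervalIntegral.integral_const_mul]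
        refine intervalIntegral.integral_congr fun x _ => ?_
        simp only [f2, mul_add, Complex.exp_add]
        ring
      rw [h'] at h
      by_contra hne
      have h3 : c * cexp (2 * π * 𝕚 * (-n : ℂ) * t) = 1 := by
        simpa using mul_right_cancel₀ hne (h.trans (one_mul _).symm)
      apply hc n
      calc c = c * (cexp (2 * π * 𝕚 * (-n : ℂ) * t) * cexp (2 * π * 𝕚 * n * t)) := by
            rw [← Complex.exp_add]; ring_nf; simp
        _ = _ := by rw [← mul_assoc, h3, one_mul]
    have hper : Function.Periodic (fun x : ℝ => f x) 1 := fun x => by simpa using f1 x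
    have hcont : Continuous fun x : ℝ => f x := hf.continuous.comp Complex.continuous_ofReal
    let φ : C(AddCircle (1 : ℝ), ℂ) := ⟨hper.lift, continuous_coinduced_dom.mpr hcont⟩
    have hφ : ∀ x : ℝ, φ (x : AddCircle (1 : ℝ)) = f x := fun x => hper.lift_coe x
    have hzero : fourierCoeff φ = 0 := by
      ext n
      rw [fourierCoeff_eq_intervalIntegral _ _ 0]
      simp only [zero_add, one_smul, fourier_coe_apply, hφ, smul_eq_mul,
        Complex.ofReal_one, div_one, Pi.zero_apply]
      rw [← hInt n]
      refine intervalIntegral.integral_congr fun x _ => ?_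
      simp only [Int.cast_neg]
      ring
    have hs : Summable (fourierCoeff φ) := by rw [hzero]; exact summable_zero
    have := has_pointwise_sum_fourier_series_of_summable hs (0 : ℝ)
    simp only [hzero, Pi.zero_apply, zero_smul] at this
    rw [hφ] at this
    simpa using this.unique hasSum_zero
  have := key (fun x => g (x + z)) (by fun_prop) (fun x => by rw [← h1 (x + z)]; ring_nf)
    (fun x => by rw [← h2 (x + z)]; ring_nf)
  simpa using this

/-! ### The odd Jacobi theta function -/

/-- The odd Jacobi theta function with a complex modulus. -/
def theta (z t : ℂ) : ℂ :=
  cexp (π * 𝕚 * t / 4 + π * 𝕚 * (z + 1 / 2)) * jacobiTheta₂ (z + 1 / 2 + t / 2) t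

theorem theta_eq_tsum (z t : ℂ) : theta z t = ∑' n : ℤ,
    cexp (π * 𝕚 * ((n : ℂ) + 1 / 2) ^ 2 * t + 2 * π * 𝕚 * ((n : ℂ) + 1 / 2) * (z + 1 / 2)) := by
  rw [theta, jacobiTheta₂, ← tsum_mul_left]
  refine tsum_congr fun n => ?_
  rw [jacobiTheta₂_term, ← Complex.exp_add]
  ring_nf

theorem vartheta_eq_theta (z : ℂ) (τ : ℍ) : vartheta z τ = theta z τ :=
  (theta_eq_tsum z τ).symm

theorem summable_theta_term (z : ℂ) {t : ℂ} (ht : 0 < t.im) : Summable fun n : ℤ =>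
    cexp (π * 𝕚 * ((n : ℂ) + 1 / 2) ^ 2 * t + 2 * π * 𝕚 * ((n : ℂ) + 1 / 2) * (z + 1 / 2)) := by
  refine (((summable_jacobiTheta₂_term_iff (z + 1 / 2 + t / 2) t).mpr ht).mul_left
    (cexp (π * 𝕚 * t / 4 + π * 𝕚 * (z + 1 / 2)))).congr fun n => ?_
  rw [jacobiTheta₂_term, ← Complex.exp_add]
  ring_nf

theorem neg_exp (w : ℂ) : -cexp w = cexp (w + π * 𝕚) := by
  rw [Complex.exp_add, Complex.exp_pi_mul_I]; ring

theorem theta_add_one (z t : ℂ) : theta (z + 1) t = -theta z t := by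
  rw [theta, theta, show z + 1 + 1 / 2 + t / 2 = (z + 1 / 2 + t / 2) + 1 by ring,
    jacobiTheta₂_add_left, show π * 𝕚 * t / 4 + π * 𝕚 * (z + 1 + 1 / 2)
      = (π * 𝕚 * t / 4 + π * 𝕚 * (z + 1 / 2)) + π * 𝕚 by ring, Complex.exp_add, Complex.exp_pi_mul_I]
  ring

theorem theta_add_modulus (z t : ℂ) :
    theta (z + t) t = -cexp (-π * 𝕚 * t - 2 * π * 𝕚 * z) * theta z t := by
  rw [theta, theta, show z + t + 1 / 2 + t / 2 = (z + 1 / 2 + t / 2) + t by ring,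
    jacobiTheta₂_add_left', neg_exp, ← mul_assoc, ← mul_assoc, ← Complex.exp_add,
    ← Complex.exp_add]
  congr 1
  rw [Complex.exp_eq_exp_iff_exists_int]
  exact ⟨-1, by push_cast; ring⟩

theorem jacobiTheta₂_sub_modulus (w t : ℂ) :
    jacobiTheta₂ (w - t) t = cexp (π * 𝕚 * (2 * w - t)) * jacobiTheta₂ w t := by
  have h := jacobiTheta₂_add_left' (w - t) t
  rw [sub_add_cancel] at h
  rw [h, ← mul_assoc, ← Complex.exp_add]
  ring_nf
  simp

theorem theta_neg (z t : ℂ) : theta (-z) t = -theta z t := by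
  rw [theta, theta, ← jacobiTheta₂_neg_left (-z + 1 / 2 + t / 2),
    show -(-z + 1 / 2 + t / 2) = (z - 1 / 2 + t / 2) - t by ring, jacobiTheta₂_sub_modulus,
    ← jacobiTheta₂_add_left (z - 1 / 2 + t / 2),
    show z - 1 / 2 + t / 2 + 1 = z + 1 / 2 + t / 2 by ring, ← mul_assoc, ← Complex.exp_add,
    ← neg_mul, neg_exp]
  congr 1
  rw [Complex.exp_eq_exp_iff_exists_int]
  exact ⟨-1, by push_cast; ring⟩

theorem theta_zero (t : ℂ) : theta 0 t = 0 := by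
  have h := theta_neg 0 t
  rw [neg_zero] at h
  linear_combination h / 2

/-- The functional equation of `jacobiTheta₂`, after the half-period shift in `theta` is realigned
by one modulus; the principal root of -it is inherited from it. -/
theorem theta_inversion (z : ℂ) {t : ℂ} (ht : t ≠ 0) :
    theta (z / t) (-1 / t) =
      -𝕚 * (-𝕚 * t) ^ (1 / 2 : ℂ) * cexp (π * 𝕚 * z ^ 2 / t) * theta z t := by
  have hs : (-𝕚 * t) ^ (1 / 2 : ℂ) ≠ 0 := by
    rw [Ne, Complex.cpow_eq_zero_iff]
    simp [ht]
  rw [theta, theta, jacobiTheta₂_functional_equation (z + 1 / 2 + t / 2) t,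
    show (z + 1 / 2 + t / 2) / t = (z / t + 1 / 2 + -1 / t / 2) - (-1 / t) by field_simp; ring,
    jacobiTheta₂_sub_modulus]
  have e : cexp (π * 𝕚 * (-1 / t) / 4 + π * 𝕚 * (z / t + 1 / 2))
      = -𝕚 * (cexp (π * 𝕚 * z ^ 2 / t) * cexp (π * 𝕚 * t / 4 + π * 𝕚 * (z + 1 / 2))
        * cexp (-π * 𝕚 * (z + 1 / 2 + t / 2) ^ 2 / t)
        * cexp (π * 𝕚 * (2 * (z / t + 1 / 2 + -1 / t / 2) - -1 / t))) := by
    rw [← Complex.exp_add, ← Complex.exp_add, ← Complex.exp_add]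
    rw [show -𝕚 = cexp (-π / 2 * 𝕚) by rw [Complex.exp_neg_pi_div_two_mul_I], ← Complex.exp_add]
    congr 1
    field_simp
    ring
  rw [e]
  field_simp

theorem exp_int_mul_succ (n : ℤ) : cexp (π * 𝕚 * ((n : ℂ) * (n + 1))) = 1 := by
  obtain ⟨k, hk⟩ := Int.even_mul_succ_self n
  have : (n : ℂ) * (n + 1) = 2 * (k : ℂ) := by
    have : ((n * (n + 1) : ℤ) : ℂ) = ((k + k : ℤ) : ℂ) := by rw [hk]
    push_cast at this
    rw [this]; ring
  rw [this, show π * 𝕚 * (2 * (k : ℂ)) = k * (2 * π * 𝕚) by ring, Complex.exp_int_mul_two_pi_mul_I]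

/-- (n + 1/2)² = n(n + 1) + 1/4 with n(n + 1) even, so all terms acquire the same eighth root of
unity. -/
theorem theta_translation (z t : ℂ) : theta z (t + 1) = cexp (π * 𝕚 / 4) * theta z t := by
  rw [theta_eq_tsum, theta_eq_tsum, ← tsum_mul_left]
  refine tsum_congr fun n => ?_
  rw [← Complex.exp_add, show π * 𝕚 * ((n : ℂ) + 1 / 2) ^ 2 * (t + 1)
    + 2 * π * 𝕚 * ((n : ℂ) + 1 / 2) * (z + 1 / 2) = π * 𝕚 * ((n : ℂ) * (n + 1)) + (π * 𝕚 / 4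
    + (π * 𝕚 * ((n : ℂ) + 1 / 2) ^ 2 * t + 2 * π * 𝕚 * ((n : ℂ) + 1 / 2) * (z + 1 / 2))) by ring,
    Complex.exp_add, exp_int_mul_succ, one_mul]

theorem theta_differentiableAt {f g : ℂ → ℂ} {s : ℂ} (hf : DifferentiableAt ℂ f s)
    (hg : DifferentiableAt ℂ g s) (h : 0 < (g s).im) :
    DifferentiableAt ℂ (fun s => theta (f s) (g s)) s := by
  unfold theta
  refine DifferentiableAt.mul (by fun_prop) ?_
  have h2 := (hasFDerivAt_jacobiTheta₂ (f s + 1 / 2 + g s / 2) h).differentiableAt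
  exact DifferentiableAt.comp s (f := fun s => (f s + 1 / 2 + g s / 2, g s))
    (g := fun p : ℂ × ℂ => jacobiTheta₂ p.1 p.2) h2 (by fun_prop)

theorem theta_differentiable {t : ℂ} (ht : 0 < t.im) : Differentiable ℂ fun z => theta z t :=
  fun _ => theta_differentiableAt differentiableAt_id (differentiableAt_const _) ht

/-- Otherwise θ vanishes identically by the identity theorem, and uniqueness of Fourier coefficients
makes some exp(πin²t) zero. -/
theorem theta_eventually_ne_zero {t : ℂ} (ht : 0 < t.im) (z₀ : ℂ) :
    ∀ᶠ z in 𝓝[≠] z₀, theta z t ≠ 0 := by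
  have hd := theta_differentiable ht
  rcases (hd.analyticAt z₀).eventually_eq_zero_or_eventually_ne_zero with h | h
  swap
  · exact h
  exfalso
  have h0 : (fun z => theta z t) = 0 :=
    AnalyticOnNhd.eq_of_eventuallyEq (fun z _ => hd.analyticAt z)
      (fun z _ => analyticAt_const) (z₀ := z₀) h
  have hj : ∀ x : ℝ, ∑' n : ℤ, cexp (π * 𝕚 * n ^ 2 * t) * cexp (2 * π * 𝕚 * n * x) = 0 := by
    intro x
    have h1 : theta (x - 1 / 2 - t / 2) t = 0 := congrFun h0 _
    rw [theta, show (x : ℂ) - 1 / 2 - t / 2 + 1 / 2 + t / 2 = x by ring] at h1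
    rcases mul_eq_zero.mp h1 with h1 | h1
    · exact absurd h1 (Complex.exp_ne_zero _)
    · rw [← h1, jacobiTheta₂]
      refine tsum_congr fun n => ?_
      rw [jacobiTheta₂_term, ← Complex.exp_add, add_comm]
  have hsum : Summable fun n : ℤ => ‖cexp (π * 𝕚 * n ^ 2 * t)‖ := by
    refine ((summable_jacobiTheta₂_term_iff 0 t).mpr ht).norm.congr fun n => ?_
    simp [jacobiTheta₂_term]
  exact Complex.exp_ne_zero _ (fourier_coeff_eq_zero hsum hj 0)

/-! ### The Appell–Lerch series -/

/-- Membership in the lattice `ℤ t + ℤ`. -/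
def InLattice (t u : ℂ) : Prop := ∃ m n : ℤ, u = m * t + n

/-- The numerators of the Appell–Lerch series. -/
def appellCoeff (n : ℤ) (v t : ℂ) : ℂ :=
  cexp (2 * π * 𝕚 * n * (v + 1 / 2) + π * 𝕚 * (n * (n + 1)) * t)

/-- The terms of the Appell–Lerch series. -/
def appellTerm (n : ℤ) (u v t : ℂ) : ℂ :=
  appellCoeff n v t / (1 - cexp (2 * π * 𝕚 * (u + n * t)))

/-- The Appell–Lerch series with a complex modulus. -/
def appell (u v t : ℂ) : ℂ := ∑' n : ℤ, appellTerm n u v t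

theorem neg_one_zpow_eq_exp (n : ℤ) : (-1 : ℂ) ^ n = cexp (π * 𝕚 * n) := by
  rw [← Complex.exp_pi_mul_I, ← Complex.exp_int_mul, mul_comm]

theorem mu_eq_appell (u v : ℂ) (τ : ℍ) :
    mu u v τ = cexp (π * 𝕚 * u) / theta v τ * appell u v τ := by
  rw [mu, vartheta_eq_theta, appell]
  congr 1
  refine tsum_congr fun n => ?_
  rw [appellTerm, appellCoeff, qpow, qpow, neg_one_zpow_eq_exp, ← Complex.exp_add,
    ← Complex.exp_add, ← Complex.exp_add]
  push_cast
  ring_nf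

theorem one_sub_exp_ne_zero {t u : ℂ} (hu : ¬ InLattice t u) (n : ℤ) :
    1 - cexp (2 * π * 𝕚 * (u + n * t)) ≠ 0 := by
  intro h
  obtain ⟨k, hk⟩ := Complex.exp_eq_one_iff.mp (sub_eq_zero.mp h).symm
  refine hu ⟨-n, k, ?_⟩
  have : u + n * t = k := by
    have h2 : (2 * π * 𝕚 : ℂ) ≠ 0 := Complex.two_pi_I_ne_zero
    exact mul_left_cancel₀ h2 (by rw [hk]; ring)
  push_cast
  linear_combination this

theorem norm_appellCoeff (n : ℤ) (v t : ℂ) :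
    ‖appellCoeff n v t‖ = Real.exp (-2 * π * n * v.im - π * (n * (n + 1)) * t.im) := by
  rw [appellCoeff, Complex.norm_exp]
  congr 1
  have : 2 * π * 𝕚 * n * (v + 1 / 2) + π * 𝕚 * (n * (n + 1)) * t
      = ((2 * π * n : ℝ) : ℂ) * (𝕚 * (v + 1 / 2)) + ((π * (n * (n + 1)) : ℝ) : ℂ) * (𝕚 * t) := by
    push_cast; ring
  rw [this, Complex.add_re, Complex.re_ofReal_mul, Complex.re_ofReal_mul, Complex.I_mul_re,
    Complex.I_mul_re]
  simp
  ring

/-- Since n(n + 1) ≥ 0 for integers, `t.im` may be lowered to δ. The majorant is uniform on a strip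
and has the shape of the known summable bound for `jacobiTheta₂`. -/
theorem norm_appellCoeff_le {B δ : ℝ} {v t : ℂ} (hv : |v.im| ≤ B) (hδ : 0 < δ) (ht : δ ≤ t.im)
    (n : ℤ) : ‖appellCoeff n v t‖ ≤ Real.exp (-π * (δ * n ^ 2 - 2 * (B + δ / 2) * |n|)) := by
  rw [norm_appellCoeff, Real.exp_le_exp]
  have h0 : (0 : ℝ) ≤ n * (n + 1) := by
    have : (0 : ℤ) ≤ n * (n + 1) := by
      rcases le_or_gt 0 n with h | h
      · positivity
      · exact mul_nonneg_of_nonpos_of_nonpos (by omega) (by omega)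
    exact_mod_cast this
  have h1 : (-n : ℝ) * v.im ≤ |(n : ℝ)| * B := by
    calc (-n : ℝ) * v.im ≤ |(-n : ℝ) * v.im| := le_abs_self _
      _ = |(n : ℝ)| * |v.im| := by rw [abs_mul, abs_neg]
      _ ≤ _ := by gcongr
  have h2 : (n * (n + 1) : ℝ) * δ ≤ n * (n + 1) * t.im := by gcongr
  have h3 : -(n : ℝ) ≤ |(n : ℝ)| := neg_le_abs _
  have h4 : -2 * n * v.im - n * (n + 1) * t.im ≤ -(δ * n ^ 2 - 2 * (B + δ / 2) * |(n : ℝ)|) := by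
    nlinarith
  have := mul_le_mul_of_nonneg_left h4 Real.pi_pos.le
  push_cast
  linarith

theorem summable_appellBound (B : ℝ) {δ : ℝ} (hδ : 0 < δ) : Summable fun n : ℤ =>
    Real.exp (-π * (δ * n ^ 2 - 2 * (B + δ / 2) * |n|)) := by
  simpa using summable_pow_mul_jacobiTheta₂_term_bound (B + δ / 2) hδ 0

theorem norm_exp_lattice (u t : ℂ) (n : ℤ) :
    ‖cexp (2 * π * 𝕚 * (u + n * t))‖ = Real.exp (-2 * π * (u.im + n * t.im)) := by
  rw [Complex.norm_exp]
  congr 1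
  have : 2 * π * 𝕚 * (u + n * t) = ((2 * π : ℝ) : ℂ) * (𝕚 * (u + n * t)) := by push_cast; ring
  rw [this, Complex.re_ofReal_mul, Complex.I_mul_re]
  simp only [Complex.add_im, Complex.mul_im, Complex.intCast_re, Complex.intCast_im]
  ring

theorem one_sub_le_norm_of_im_ge {u t : ℂ} {n : ℤ} {ε : ℝ} (h : ε ≤ |u.im + n * t.im|) :
    1 - Real.exp (-2 * π * ε) ≤ ‖1 - cexp (2 * π * 𝕚 * (u + n * t))‖ := by
  rcases le_abs'.mp h with h | h
  · have h1 : Real.exp (2 * π * ε) ≤ ‖cexp (2 * π * 𝕚 * (u + n * t))‖ := by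
      rw [norm_exp_lattice, Real.exp_le_exp]
      nlinarith [Real.pi_pos]
    have h2 := norm_sub_norm_le (cexp (2 * π * 𝕚 * (u + n * t))) 1
    rw [norm_one, norm_sub_rev] at h2
    -- exp(x) - 1 ≥ x ≥ 1 - exp(-x) brings the case of a large exponential to the same lower bound.
    have h3 := Real.add_one_le_exp (2 * π * ε)
    have h4 := Real.add_one_le_exp (-2 * π * ε)
    linarith
  · have h1 : ‖cexp (2 * π * 𝕚 * (u + n * t))‖ ≤ Real.exp (-2 * π * ε) := by
      rw [norm_exp_lattice, Real.exp_le_exp]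
      nlinarith [Real.pi_pos]
    have h2 := norm_sub_norm_le 1 (cexp (2 * π * 𝕚 * (u + n * t)))
    rw [norm_one] at h2
    linarith

/-- Outside a finite set of `n` the imaginary part of u + nt is at least 1 in absolute value, and 1
- exp(-2π) ≥ 1/2. The set depends only on `B` and `δ`, as locally uniform convergence requires. -/
theorem exists_finset_half_le_norm (B : ℝ) {δ : ℝ} (hδ : 0 < δ) : ∃ s : Finset ℤ, ∀ n ∉ s,
    ∀ u t : ℂ, |u.im| ≤ B → δ ≤ t.im → 1 / 2 ≤ ‖1 - cexp (2 * π * 𝕚 * (u + n * t))‖ := by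
  obtain ⟨N, hN⟩ := exists_nat_ge ((B + 1) / δ)
  refine ⟨Finset.Icc (-N) N, fun n hn u t hu ht => ?_⟩
  have hB : B + 1 ≤ N * δ := (div_le_iff₀ hδ).mp hN
  have hexp : Real.exp (-2 * π * 1) ≤ 1 / 2 := by
    have h3 := Real.add_one_le_exp (2 * π * 1)
    have h4 := Real.pi_gt_three
    rw [show -2 * π * 1 = -(2 * π * 1) by ring, Real.exp_neg, one_div]
    exact inv_anti₀ (by norm_num) (by linarith)
  refine le_trans (by linarith) (one_sub_le_norm_of_im_ge (ε := 1) ?_)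
  have hu' := abs_le.mp hu
  rw [Finset.mem_Icc, not_and_or, not_le, not_le] at hn
  rcases hn with hn | hn
  · have hn' : (n : ℝ) ≤ -N := by exact_mod_cast hn.le
    have hn0 : (n : ℝ) ≤ 0 := hn'.trans (by simp)
    have : n * t.im ≤ n * δ := mul_le_mul_of_nonpos_left ht hn0
    have : n * δ ≤ -N * δ := by gcongr
    exact le_abs'.mpr (Or.inl (by linarith))
  · have hn' : (N : ℝ) ≤ n := by exact_mod_cast hn.le
    have hn0 : (0 : ℝ) ≤ n := le_trans (by simp) hn'
    have : n * δ ≤ n * t.im := mul_le_mul_of_nonneg_left ht hn0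
    have : N * δ ≤ n * δ := by gcongr
    exact le_abs'.mpr (Or.inr (by linarith))

theorem norm_appellTerm_le {B δ : ℝ} (hδ : 0 < δ) {n : ℤ} {u v t : ℂ} (hv : |v.im| ≤ B)
    (ht : δ ≤ t.im) (hn : 1 / 2 ≤ ‖1 - cexp (2 * π * 𝕚 * (u + n * t))‖) :
    ‖appellTerm n u v t‖ ≤ 2 * Real.exp (-π * (δ * n ^ 2 - 2 * (B + δ / 2) * |n|)) := by
  rw [appellTerm, norm_div, div_le_iff₀ (by linarith)]
  have := norm_appellCoeff_le hv hδ ht n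
  have h0 := Real.exp_pos (-π * (δ * n ^ 2 - 2 * (B + δ / 2) * |n|))
  nlinarith

/-- No condition on `u` is needed: at a lattice point the singular quotient has the default value 0,
and finitely many terms do not affect summability. -/
theorem summable_appellTerm (u v : ℂ) {t : ℂ} (ht : 0 < t.im) :
    Summable fun n => appellTerm n u v t := by
  obtain ⟨s, hs⟩ := exists_finset_half_le_norm |u.im| ht
  refine (s.summable_compl_iff).mp ?_
  refine Summable.of_norm_bounded (((summable_appellBound |v.im| ht).mul_left 2).subtype _) ?_
  intro n
  exact norm_appellTerm_le ht le_rfl le_rfl (hs n n.2 u t le_rfl le_rfl)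

theorem appellTerm_differentiableAt {u v t : ℂ → ℂ} {z : ℂ} (hu : DifferentiableAt ℂ u z)
    (hv : DifferentiableAt ℂ v z) (ht : DifferentiableAt ℂ t z) {n : ℤ}
    (hn : 1 - cexp (2 * π * 𝕚 * (u z + n * t z)) ≠ 0) :
    DifferentiableAt ℂ (fun z => appellTerm n (u z) (v z) (t z)) z := by
  unfold appellTerm appellCoeff
  exact DifferentiableAt.div (by fun_prop) (by fun_prop) hn

/-- Locally, all but finitely many terms of the Appell–Lerch series have a holomorphic sum. -/
theorem exists_appell_tail {u v t : ℂ → ℂ} (hu : Differentiable ℂ u) (hv : Differentiable ℂ v)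
    (ht : Differentiable ℂ t) {z₀ : ℂ} (h0 : 0 < (t z₀).im) :
    ∃ (s : Finset ℤ) (T : ℂ → ℂ), 0 ∈ s ∧ DifferentiableAt ℂ T z₀ ∧
      ∀ᶠ z in 𝓝 z₀, appell (u z) (v z) (t z) = (∑ n ∈ s, appellTerm n (u z) (v z) (t z)) + T z := by
  set B := max (|(u z₀).im| + 1) (|(v z₀).im| + 1)
  set δ := (t z₀).im / 2
  have hδ : 0 < δ := by positivity
  set U : Set ℂ := {z | |(u z).im| < B ∧ |(v z).im| < B ∧ δ < (t z).im}
  have hcu := Complex.continuous_im.comp hu.continuous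
  have hcv := Complex.continuous_im.comp hv.continuous
  have hct := Complex.continuous_im.comp ht.continuous
  have hU : IsOpen U := (isOpen_lt hcu.abs continuous_const).inter
    ((isOpen_lt hcv.abs continuous_const).inter (isOpen_lt continuous_const hct))
  have hzU : z₀ ∈ U :=
    ⟨lt_of_lt_of_le (lt_add_one _) (le_max_left _ _),
      lt_of_lt_of_le (lt_add_one _) (le_max_right _ _), half_lt_self h0⟩
  obtain ⟨s', hs'⟩ := exists_finset_half_le_norm B hδ
  -- The index 0 is forced into the finite set so that the term with the pole at u = 0 is visible.
  set s := insert 0 s'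
  have hs := fun n (hn : n ∉ s) => hs' n fun h => hn (Finset.mem_insert_of_mem h)
  refine ⟨s, fun z => ∑' n : {n // n ∉ s}, appellTerm n (u z) (v z) (t z),
    Finset.mem_insert_self 0 s', ?_, ?_⟩
  · refine DifferentiableOn.differentiableAt (s := U) ?_ (hU.mem_nhds hzU)
    refine Complex.differentiableOn_tsum_of_summable_norm
      (((summable_appellBound B hδ).mul_left 2).subtype {n | n ∉ s}) ?_ hU ?_
    · intro n z hz
      refine (appellTerm_differentiableAt (hu z) (hv z) (ht z) ?_).differentiableWithinAt
      have := hs n n.2 (u z) (t z) hz.1.le hz.2.2.le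
      exact norm_pos_iff.mp (by linarith)
    · intro n z hz
      exact norm_appellTerm_le hδ hz.2.1.le hz.2.2.le (hs n n.2 (u z) (t z) hz.1.le hz.2.2.le)
  · filter_upwards [hU.mem_nhds hzU] with z hz
    exact ((summable_appellTerm (u z) (v z) (hδ.trans hz.2.2)).sum_add_tsum_subtype_compl s).symm

theorem appell_differentiableAt {u v t : ℂ → ℂ} (hu : Differentiable ℂ u) (hv : Differentiable ℂ v)
    (ht : Differentiable ℂ t) {z₀ : ℂ} (h0 : 0 < (t z₀).im) (hl : ¬ InLattice (t z₀) (u z₀)) :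
    DifferentiableAt ℂ (fun z => appell (u z) (v z) (t z)) z₀ := by
  obtain ⟨s, T, -, hT, h⟩ := exists_appell_tail hu hv ht h0
  refine DifferentiableAt.congr_of_eventuallyEq ?_ h
  refine DifferentiableAt.add (DifferentiableAt.fun_sum fun n _ => ?_) hT
  exact appellTerm_differentiableAt (hu z₀) (hv z₀) (ht z₀) (one_sub_exp_ne_zero hl n)

/-! ### The pole of the Appell–Lerch series at the origin. -/

theorem one_sub_exp_inv_isBigO :
    (fun u : ℂ => (1 - cexp (2 * π * 𝕚 * u))⁻¹) =O[𝓝[≠] 0] fun u => u⁻¹ := by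
  have hd : HasDerivAt (fun u : ℂ => 1 - cexp (2 * π * 𝕚 * u)) (-(2 * π * 𝕚)) 0 := by
    have h1 : HasDerivAt (fun u : ℂ => 2 * π * 𝕚 * u) (2 * π * 𝕚) 0 := by
      simpa using (hasDerivAt_id (0 : ℂ)).const_mul (2 * π * 𝕚)
    simpa using (h1.cexp).const_sub 1
  have h1 := (hd.isTheta_sub (by simp)).2.comp_tendsto
    (((tendsto_id (x := 𝓝 (0 : ℂ))).mono_left (nhdsWithin_le_nhds (s := {0}ᶜ))).prodMk
      (tendsto_pure.mpr (Eventually.of_forall fun _ => rfl)))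
  simp only [Function.comp_def, id_eq, mul_zero, Complex.exp_zero, sub_self, sub_zero] at h1
  refine h1.inv_rev ?_
  filter_upwards [self_mem_nhdsWithin] with u hu h
  exact absurd h hu

theorem int_eq_zero_of_mul_eq_intCast {t : ℂ} (ht : 0 < t.im) {n k : ℤ} (h : (n : ℂ) * t = k) : n = 0 := by
  have := congrArg Complex.im h
  simp only [Complex.mul_im, Complex.intCast_re, Complex.intCast_im, zero_mul, add_zero,
    mul_eq_zero] at this
  rcases this with h | h
  · exact_mod_cast h
  · exact absurd h ht.ne'

theorem isBigO_inv_of_continuousAt {f : ℂ → ℂ} (hf : ContinuousAt f 0) :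
    f =O[𝓝[≠] (0 : ℂ)] fun u => u⁻¹ := by
  have h1 : f =O[𝓝[≠] (0 : ℂ)] fun _ => (1 : ℂ) :=
    (hf.tendsto.mono_left nhdsWithin_le_nhds).isBigO_one ℂ
  refine h1.trans (IsBigO.of_bound 1 ?_)
  have : ∀ᶠ u : ℂ in 𝓝 0, ‖u‖ ≤ 1 := by
    filter_upwards [Metric.closedBall_mem_nhds (0 : ℂ) one_pos] with u hu
    simpa using hu
  filter_upwards [this.filter_mono nhdsWithin_le_nhds, self_mem_nhdsWithin] with u hu hu0
  rw [norm_one, one_mul, norm_inv]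
  exact (one_le_inv₀ (norm_pos_iff.mpr hu0)).mpr hu

/-- The Appell–Lerch series has at most a simple pole at the origin. -/
theorem appell_isBigO_inv (v : ℂ) {t : ℂ} (ht : 0 < t.im) :
    (fun u => appell u v t) =O[𝓝[≠] 0] fun u => u⁻¹ := by
  obtain ⟨s, T, -, hT, h⟩ := exists_appell_tail (u := id) (v := fun _ => v) (t := fun _ => t) (z₀ := 0)
    differentiable_id (differentiable_const _) (differentiable_const _) ht
  refine IsBigO.congr' (f₁ := fun z => (∑ n ∈ s, appellTerm n z v t) + T z) ?_
    (EventuallyEq.symm (h.filter_mono nhdsWithin_le_nhds)) EventuallyEq.rfl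
  refine IsBigO.add (IsBigO.fun_sum fun n _ => ?_) (isBigO_inv_of_continuousAt hT.continuousAt)
  by_cases hn : n = 0
  · subst hn
    simp only [appellTerm, Int.cast_zero, zero_mul, add_zero, div_eq_mul_inv]
    exact one_sub_exp_inv_isBigO.const_mul_left _
  · refine isBigO_inv_of_continuousAt (DifferentiableAt.continuousAt (𝕜 := ℂ) ?_)
    refine appellTerm_differentiableAt (u := id) (v := fun _ => v) (t := fun _ => t)
      differentiableAt_id (differentiableAt_const _) (differentiableAt_const _) ?_
    intro h0
    obtain ⟨k, hk⟩ := Complex.exp_eq_one_iff.mp (sub_eq_zero.mp h0).symm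
    refine hn (int_eq_zero_of_mul_eq_intCast ht (k := k) ?_)
    have h2 : (2 * π * 𝕚 : ℂ) ≠ 0 := Complex.two_pi_I_ne_zero
    simp only [id_eq, zero_add] at hk
    exact mul_left_cancel₀ h2 (by rw [hk]; ring)

/-! ### Periods and quasi-periods of the Appell–Lerch series. -/

theorem appell_add_one (u v t : ℂ) : appell (u + 1) v t = appell u v t := by
  refine tsum_congr fun n => ?_
  rw [appellTerm, appellTerm, show 2 * π * 𝕚 * (u + 1 + n * t) = 2 * π * 𝕚 * (u + n * t) + 2 * π * 𝕚
    by ring, Complex.exp_add, Complex.exp_two_pi_mul_I, mul_one]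

theorem appell_add_one_right (u v t : ℂ) : appell u (v + 1) t = appell u v t := by
  refine tsum_congr fun n => ?_
  rw [appellTerm, appellTerm, appellCoeff, appellCoeff, show 2 * π * 𝕚 * n * (v + 1 + 1 / 2)
    + π * 𝕚 * (n * (n + 1)) * t = (2 * π * 𝕚 * n * (v + 1 / 2) + π * 𝕚 * (n * (n + 1)) * t)
    + n * (2 * π * 𝕚) by ring, Complex.exp_add _ (n * (2 * π * 𝕚)),
    Complex.exp_int_mul_two_pi_mul_I, mul_one]

theorem appell_translation (u v t : ℂ) : appell u v (t + 1) = appell u v t := by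
  refine tsum_congr fun n => ?_
  rw [appellTerm, appellTerm, appellCoeff, appellCoeff, show 2 * π * 𝕚 * n * (v + 1 / 2)
    + π * 𝕚 * (n * (n + 1)) * (t + 1) = (2 * π * 𝕚 * n * (v + 1 / 2) + π * 𝕚 * (n * (n + 1)) * t)
    + π * 𝕚 * (n * (n + 1)) by ring, Complex.exp_add _ (π * 𝕚 * (n * (n + 1))),
    exp_int_mul_succ, mul_one, show 2 * π * 𝕚 * (u + n * (t + 1)) = 2 * π * 𝕚 * (u + n * t)
    + n * (2 * π * 𝕚) by ring, Complex.exp_add _ (n * (2 * π * 𝕚)),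
    Complex.exp_int_mul_two_pi_mul_I, mul_one]

/-- This is the theta series left over in `appell_add_modulus` when the denominators cancel. -/
theorem hasSum_appellCoeff (v : ℂ) {t : ℂ} (ht : 0 < t.im) :
    HasSum (fun n : ℤ => appellCoeff n v t * cexp (-(2 * π * 𝕚 * n * t)))
      (cexp (-π * 𝕚 * t / 4 + π * 𝕚 * (v + 1 / 2)) * theta v t) := by
  have h := ((summable_theta_term v ht).hasSum.mul_left
    (cexp (-π * 𝕚 * t / 4 + π * 𝕚 * (v + 1 / 2))))
  rw [← theta_eq_tsum, ← (Equiv.subRight (1 : ℤ)).hasSum_iff] at h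
  refine h.congr_fun fun n => ?_
  simp only [Function.comp_apply, Equiv.subRight_apply, appellCoeff, ← Complex.exp_add]
  push_cast
  ring_nf

/-- With X = exp(2πi(u + nt)), shifting the index restores the denominator 1 - X and leaves the
extra factor exp(-2πint) = exp(-2πint)(1 - X) + exp(2πiu). The first summand cancels the denominator
and sums to θ; the second returns the Appell series. -/
theorem appell_add_modulus {u v t : ℂ} (ht : 0 < t.im) (hu : ¬ InLattice t u) :
    appell (u + t) v t = -cexp (-(2 * π * 𝕚 * v)) *
      (cexp (-π * 𝕚 * t / 4 + π * 𝕚 * (v + 1 / 2)) * theta v t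
        + cexp (2 * π * 𝕚 * u) * appell u v t) := by
  have h := (((hasSum_appellCoeff v ht).add ((summable_appellTerm u v ht).hasSum.mul_left
    (cexp (2 * π * 𝕚 * u)))).mul_left (-cexp (-(2 * π * 𝕚 * v)))).tsum_eq
  rw [appell, appell, ← h, ← (Equiv.subRight (1 : ℤ)).tsum_eq]
  refine tsum_congr fun n => ?_
  have hne := one_sub_exp_ne_zero hu n
  have e0 : u + t + ((n - 1 : ℤ) : ℂ) * t = u + n * t := by push_cast; ring
  rw [Equiv.subRight_apply, appellTerm, appellTerm, e0]
  have e1 : appellCoeff (n - 1) v t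
      = -cexp (-(2 * π * 𝕚 * v)) * (appellCoeff n v t * cexp (-(2 * π * 𝕚 * n * t))) := by
    rw [appellCoeff, appellCoeff, neg_exp, ← Complex.exp_add, ← Complex.exp_add,
      Complex.exp_eq_exp_iff_exists_int]
    exact ⟨-1, by push_cast; ring⟩
  have e2 : cexp (2 * π * 𝕚 * u) = cexp (2 * π * 𝕚 * (u + n * t)) * cexp (-(2 * π * 𝕚 * n * t)) := by
    rw [← Complex.exp_add]; ring_nf
  rw [e1, e2, div_eq_iff hne]
  field_simp
  ring

theorem appell_add_modulus_both (u v t : ℂ) :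
    appell (u + t) (v + t) t = -cexp (-(2 * π * 𝕚 * v) - 2 * π * 𝕚 * t) * appell u v t := by
  rw [appell, appell, ← (Equiv.subRight (1 : ℤ)).tsum_eq, ← tsum_mul_left]
  refine tsum_congr fun n => ?_
  have e0 : u + t + ((n - 1 : ℤ) : ℂ) * t = u + n * t := by push_cast; ring
  rw [Equiv.subRight_apply, appellTerm, appellTerm, e0, ← mul_div_assoc]
  congr 1
  rw [appellCoeff, appellCoeff, neg_exp, ← Complex.exp_add, Complex.exp_eq_exp_iff_exists_int]
  exact ⟨-1, by push_cast; ring⟩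

/-! ### Uniqueness of elliptic functions of the second kind with one simple pole -/

theorem inLattice_add_int_iff {t u : ℂ} (n : ℤ) : InLattice t (u + n) ↔ InLattice t u := by
  constructor
  · rintro ⟨k, l, h⟩
    exact ⟨k, l - n, by push_cast; linear_combination h⟩
  · rintro ⟨k, l, rfl⟩
    exact ⟨k, l + n, by push_cast; ring⟩

theorem inLattice_add_one_iff {t u : ℂ} : InLattice t (u + 1) ↔ InLattice t u := by
  simpa using inLattice_add_int_iff (t := t) (u := u) 1

theorem inLattice_add_modulus_iff {t u : ℂ} : InLattice t (u + t) ↔ InLattice t u := by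
  constructor
  · rintro ⟨k, l, h⟩
    exact ⟨k - 1, l, by push_cast; linear_combination h⟩
  · rintro ⟨k, l, rfl⟩
    exact ⟨k + 1, l, by push_cast; ring⟩

/-- A property that is invariant under the two periods and holds at `0` holds on the lattice. -/
theorem InLattice.induction {t : ℂ} {P : ℂ → Prop} (h0 : P 0) (h1 : ∀ u, P (u + 1) ↔ P u)
    (h2 : ∀ u, P (u + t) ↔ P u) {u : ℂ} (hu : InLattice t u) : P u := by
  obtain ⟨m, n, rfl⟩ := hu
  have hn : ∀ n : ℤ, P n := by
    intro n
    induction n using Int.induction_on with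
    | zero => simpa using h0
    | succ k ih => push_cast at ih ⊢; exact (h1 _).mpr ih
    | pred k ih => rw [← h1]; push_cast at ih ⊢; simpa using ih
  induction m using Int.induction_on with
  | zero => simpa using hn n
  | succ k ih =>
    rw [show ((k + 1 : ℤ) : ℂ) * t + n = ((k : ℤ) : ℂ) * t + n + t by push_cast; ring]
    exact (h2 _).mpr ih
  | pred k ih =>
    rw [← h2, show ((-k - 1 : ℤ) : ℂ) * t + n + t = ((-k : ℤ) : ℂ) * t + n by push_cast; ring]
    exact ih

theorem theta_eq_zero_of_inLattice {t u : ℂ} (hu : InLattice t u) : theta u t = 0 := by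
  refine hu.induction (P := fun u => theta u t = 0) (theta_zero t) (fun u => ?_) (fun u => ?_)
  · rw [theta_add_one, neg_eq_zero]
  · rw [theta_add_modulus, mul_eq_zero, neg_eq_zero]
    simp [Complex.exp_ne_zero]

/-- The lattice lies in the zero set of θ, whose points are isolated. -/
theorem eventually_not_inLattice {t : ℂ} (ht : 0 < t.im) (w : ℂ) :
    ∀ᶠ u in 𝓝[≠] w, ¬ InLattice t u :=
  (theta_eventually_ne_zero ht w).mono fun _ hu h => hu (theta_eq_zero_of_inLattice h)

theorem tendsto_translate {g : ℂ → ℂ} {w s k L : ℂ} (h : Tendsto g (𝓝[≠] w) (𝓝 L))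
    (hg : ∀ᶠ u in 𝓝[≠] w, g (u + s) = k * g u) : Tendsto g (𝓝[≠] (w + s)) (𝓝 (k * L)) := by
  have hT : Tendsto (fun u => u - s) (𝓝[≠] (w + s)) (𝓝[≠] w) := by
    refine tendsto_nhdsWithin_iff.mpr ⟨?_, ?_⟩
    · have : Tendsto (fun u => u - s) (𝓝 (w + s)) (𝓝 (w + s - s)) :=
        (continuous_id.sub continuous_const).tendsto _
      rw [add_sub_cancel_right] at this
      exact this.mono_left nhdsWithin_le_nhds
    · filter_upwards [self_mem_nhdsWithin] with u hu h'
      exact hu (by simpa [sub_eq_iff_eq_add] using h')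
  refine ((h.comp hT).const_mul k).congr' ?_
  filter_upwards [hT.eventually hg] with u hu
  rw [Function.comp_apply, ← hu, sub_add_cancel]

/-- Multiplying by θ(u) removes the simple poles and turns the multipliers into the constants 1 and
exp(-2πiv). The second is of the form exp(2πint) only if v is in the lattice, so
`entire_eq_zero_of_multiplier` applies. -/
theorem eq_zero_of_quasiperiodic {t v : ℂ} (ht : 0 < t.im) (hv : ¬ InLattice t v) {f : ℂ → ℂ}
    (hd : ∀ u, ¬ InLattice t u → DifferentiableAt ℂ f u)
    (h1 : ∀ u, ¬ InLattice t u → f (u + 1) = -f u)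
    (h2 : ∀ u, ¬ InLattice t u → f (u + t) = -cexp (2 * π * 𝕚 * (u - v) + π * 𝕚 * t) * f u)
    (hO : f =O[𝓝[≠] 0] fun u => u⁻¹) {u : ℂ} (hu : ¬ InLattice t u) : f u = 0 := by
  set g₀ : ℂ → ℂ := fun u => f u * theta u t
  set c := cexp (-(2 * π * 𝕚 * v))
  have hc0 : c ≠ 0 := Complex.exp_ne_zero _
  have hg1 : ∀ u, ¬ InLattice t u → g₀ (u + 1) = 1 * g₀ u := fun u hu => by
    simp only [g₀, h1 u hu, theta_add_one]; ring
  have hg2 : ∀ u, ¬ InLattice t u → g₀ (u + t) = c * g₀ u := fun u hu => by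
    have : cexp (2 * π * 𝕚 * (u - v) + π * 𝕚 * t) * cexp (-π * 𝕚 * t - 2 * π * 𝕚 * u) = c := by
      rw [← Complex.exp_add]; congr 1; ring
    simp only [g₀, h2 u hu, theta_add_modulus, ← this]; ring
  have hev := eventually_not_inLattice ht
  have hgd : ∀ u, ¬ InLattice t u → DifferentiableAt ℂ g₀ u := fun u hu =>
    (hd u hu).mul (theta_differentiable ht u)
  have hlim0 : ∃ L, Tendsto g₀ (𝓝[≠] 0) (𝓝 L) := by
    have hθ : (fun u => theta u t) =O[𝓝[≠] 0] fun u => u := by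
      have := ((theta_differentiable ht 0).hasDerivAt.differentiableAt.isBigO_sub).mono
        (nhdsWithin_le_nhds (s := {0}ᶜ))
      simpa [theta_zero] using this
    have hb : g₀ =O[𝓝[≠] 0] fun _ => (1 : ℂ) := by
      refine (hO.mul hθ).congr' EventuallyEq.rfl ?_
      filter_upwards [self_mem_nhdsWithin] with u hu
      exact inv_mul_cancel₀ hu
    refine ⟨_, Complex.tendsto_limUnder_of_differentiable_on_punctured_nhds_of_bounded_under
      ((hev 0).mono hgd) ?_⟩
    have hb2 : (fun z => g₀ z - g₀ 0) =O[𝓝[≠] 0] fun _ => (1 : ℂ) :=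
      hb.sub (isBigO_const_const _ one_ne_zero _)
    simpa [isBigO_one_iff] using (isBigO_one_iff ℂ).mp hb2
  -- The limit at 0 is carried to every lattice point by the two multipliers.
  have hlim : ∀ w, ∃ L, Tendsto g₀ (𝓝[≠] w) (𝓝 L) := by
    intro w
    by_cases hw : InLattice t w
    · refine hw.induction (P := fun w => ∃ L, Tendsto g₀ (𝓝[≠] w) (𝓝 L)) hlim0 ?_ ?_
      · refine fun w => ⟨fun ⟨L, hL⟩ => ?_, fun ⟨L, hL⟩ =>
          ⟨_, tendsto_translate hL ((hev w).mono hg1)⟩⟩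
        have := tendsto_translate (s := -1) (k := 1) hL ((hev (w + 1)).mono fun u hu => by
          have hu' : ¬ InLattice t (u + -1) := fun h => hu (by
            rw [← inLattice_add_one_iff] at h; simpa using h)
          simpa using (hg1 _ hu').symm)
        exact ⟨_, by simpa using this⟩
      · refine fun w => ⟨fun ⟨L, hL⟩ => ?_, fun ⟨L, hL⟩ =>
          ⟨_, tendsto_translate hL ((hev w).mono hg2)⟩⟩
        have := tendsto_translate (s := -t) (k := c⁻¹) hL ((hev (w + t)).mono fun u hu => by
          have hu' : ¬ InLattice t (u + -t) := fun h => hu (by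
            rw [← inLattice_add_modulus_iff] at h; simpa using h)
          have := hg2 _ hu'
          rw [neg_add_cancel_right] at this
          rw [this, inv_mul_cancel_left₀ hc0])
        exact ⟨_, by simpa using this⟩
    · exact ⟨_, (hgd w hw).continuousAt.tendsto.mono_left nhdsWithin_le_nhds⟩
  -- The values of `f` on the lattice carry no information, so the entire extension is defined by
  -- punctured limits.
  choose g hg using hlim
  have hgeq : ∀ w, ¬ InLattice t w → g w = g₀ w := fun w hw =>
    tendsto_nhds_unique (hg w) ((hgd w hw).continuousAt.tendsto.mono_left nhdsWithin_le_nhds)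
  have hopen : ∀ w, ¬ InLattice t w → ∀ᶠ u in 𝓝 w, ¬ InLattice t u := fun w hw => by
    have := hev w
    rw [eventually_nhdsWithin_iff] at this
    filter_upwards [this] with u h
    by_cases h' : u = w
    · rwa [h']
    · exact h h'
  have hgdiff : Differentiable ℂ g := by
    intro w
    refine (Complex.analyticAt_of_differentiable_on_punctured_nhds_of_continuousAt ?_
      ?_).differentiableAt
    · filter_upwards [hev w] with u hu
      exact (hgd u hu).congr_of_eventuallyEq ((hopen u hu).mono hgeq)
    · rw [continuousAt_iff_punctured_nhds]
      exact (hg w).congr' ((hev w).mono fun u hu => (hgeq u hu).symm)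
  have hgz : ∀ z, g z = 0 := by
    refine entire_eq_zero_of_multiplier hgdiff (t := t) (c := c) ?_ ?_ ?_
    · intro z
      have := tendsto_nhds_unique (hg (z + 1)) (tendsto_translate (hg z) ((hev z).mono hg1))
      simpa using this
    · exact fun z => tendsto_nhds_unique (hg (z + t)) (tendsto_translate (hg z) ((hev z).mono hg2))
    · intro n hn
      obtain ⟨k, hk⟩ := Complex.exp_eq_exp_iff_exists_int.mp hn
      refine hv ⟨-n, -k, ?_⟩
      have h2 : (2 * π * 𝕚 : ℂ) ≠ 0 := Complex.two_pi_I_ne_zero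
      refine mul_left_cancel₀ h2 ?_
      push_cast
      linear_combination -hk
  -- θ is not yet known to be nonzero off the lattice. It is divided out only near `u`, and `f u` is
  -- recovered by continuity.
  have hf0 : ∀ᶠ w in 𝓝[≠] u, f w = 0 := by
    filter_upwards [hev u, theta_eventually_ne_zero ht u] with w hw hθ
    have := (hgeq w hw).symm.trans (hgz w)
    exact (mul_eq_zero.mp this).resolve_right hθ
  exact tendsto_nhds_unique ((hd u hu).continuousAt.tendsto.mono_left nhdsWithin_le_nhds)
    ((tendsto_const_nhds (x := (0 : ℂ))).congr' (hf0.mono fun _ h => h.symm))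

/-- The theta function vanishes on the lattice only. -/
theorem theta_ne_zero {t v : ℂ} (ht : 0 < t.im) (hv : ¬ InLattice t v) : theta v t ≠ 0 := by
  intro h0
  -- With θ(v) = 0 the inhomogeneous term of `appell_add_modulus` disappears, and the uniqueness
  -- lemma kills the Appell series.
  have hz : ∀ u, ¬ InLattice t u → appell u v t = 0 := by
    intro u hu
    have := eq_zero_of_quasiperiodic ht hv (f := fun u => cexp (π * 𝕚 * u) * appell u v t)
      (fun u hu => ?_) (fun u _ => ?_) (fun u hu => ?_) ?_ hu
    · exact (mul_eq_zero.mp this).resolve_left (Complex.exp_ne_zero _)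
    · refine DifferentiableAt.mul (by fun_prop) ?_
      exact appell_differentiableAt differentiable_id (differentiable_const v)
        (differentiable_const t) ht hu
    · rw [appell_add_one, mul_add, mul_one, Complex.exp_add, Complex.exp_pi_mul_I]
      ring
    · rw [appell_add_modulus ht hu, h0, mul_zero, zero_add]
      have : cexp (π * 𝕚 * (u + t)) * cexp (-(2 * π * 𝕚 * v)) * cexp (2 * π * 𝕚 * u)
          = cexp (2 * π * 𝕚 * (u - v) + π * 𝕚 * t) * cexp (π * 𝕚 * u) := by
        simp only [← Complex.exp_add]; congr 1; ring
      linear_combination -appell u v t * this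
    · have hc : ContinuousAt (fun u : ℂ => cexp (π * 𝕚 * u)) 0 := by fun_prop
      simpa using ((hc.tendsto.mono_left nhdsWithin_le_nhds).isBigO_one ℂ).mul
        (appell_isBigO_inv v ht)
  obtain ⟨s, T, h0s, hT, h⟩ := exists_appell_tail (u := id) (v := fun _ => v) (t := fun _ => t)
    (z₀ := 0) differentiable_id (differentiable_const _) (differentiable_const _) ht
  set E : ℂ → ℂ := fun u => 1 - cexp (2 * π * 𝕚 * u)
  have hE : ContinuousAt E 0 := by fun_prop
  have hE0 : E 0 = 0 := by simp [E]
  have hrest : ContinuousAt (fun z => (∑ n ∈ s.erase 0, appellTerm n z v t) + T z) 0 := by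
    refine ContinuousAt.add (tendsto_finsetSum _ fun n hn => ?_) hT.continuousAt
    refine DifferentiableAt.continuousAt (𝕜 := ℂ) (f := fun z => appellTerm n z v t) ?_
    refine appellTerm_differentiableAt (u := id) (v := fun _ => v) (t := fun _ => t)
      differentiableAt_id (differentiableAt_const _) (differentiableAt_const _) ?_
    intro h0
    obtain ⟨k, hk⟩ := Complex.exp_eq_one_iff.mp (sub_eq_zero.mp h0).symm
    refine (Finset.mem_erase.mp hn).1 (int_eq_zero_of_mul_eq_intCast ht (k := k) ?_)
    have h2 : (2 * π * 𝕚 : ℂ) ≠ 0 := Complex.two_pi_I_ne_zero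
    simp only [id_eq, zero_add] at hk
    exact mul_left_cancel₀ h2 (by rw [hk]; ring)
  have hlim : Tendsto (fun z => E z * ((∑ n ∈ s.erase 0, appellTerm n z v t) + T z))
      (𝓝[≠] 0) (𝓝 0) := by
    have := (hE.mul hrest).tendsto.mono_left (nhdsWithin_le_nhds (s := {0}ᶜ))
    rw [Pi.mul_apply, hE0, zero_mul] at this
    exact this
  -- The vanishing series times 1 - exp(2πiz): the term n = 0 contributes exactly 1, so the
  -- remainder equals -1, although it tends to 0.
  have hconst : ∀ᶠ z in 𝓝[≠] (0 : ℂ),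
      E z * ((∑ n ∈ s.erase 0, appellTerm n z v t) + T z) = -1 := by
    filter_upwards [h.filter_mono nhdsWithin_le_nhds, eventually_not_inLattice ht 0] with z hsum hzl
    rw [id_eq, hz z hzl, ← Finset.add_sum_erase _ _ h0s] at hsum
    have hne : E z ≠ 0 := by simpa using one_sub_exp_ne_zero hzl 0
    have h1 : appellTerm 0 z v t = 1 / E z := by simp [appellTerm, appellCoeff, E]
    have h2 : E z * appellTerm 0 z v t = 1 := by rw [h1, mul_one_div_cancel hne]
    linear_combination E z * (-hsum) - h2
  have := tendsto_nhds_unique hlim ((tendsto_const_nhds (x := (-1 : ℂ))).congr'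
    (hconst.mono fun _ h => h.symm))
  norm_num at this

/-! ### The error function -/

/-- The error function `2 ∫₀ˣ exp (-π t²) dt`. -/
def errE (x : ℝ) : ℝ := 2 * ∫ t in (0 : ℝ)..x, Real.exp (-π * t ^ 2)

theorem errE_zero : errE 0 = 0 := by simp [errE]

theorem errE_neg (x : ℝ) : errE (-x) = -errE x := by
  have h := intervalIntegral.integral_comp_neg (a := 0) (b := x)
    (f := fun t : ℝ => Real.exp (-π * t ^ 2))
  simp only [neg_sq, neg_zero] at h
  rw [errE, errE, intervalIntegral.integral_symm, ← h]
  ring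

theorem hasDerivAt_errE (x : ℝ) : HasDerivAt errE (2 * Real.exp (-π * x ^ 2)) x := by
  have hc : Continuous fun t : ℝ => Real.exp (-π * t ^ 2) := by fun_prop
  exact (hc.integral_hasStrictDerivAt 0 x).hasDerivAt.const_mul 2

theorem integrable_gaussian : MeasureTheory.Integrable fun t : ℝ => Real.exp (-π * t ^ 2) :=
  integrable_exp_neg_mul_sq Real.pi_pos

theorem one_sub_errE (x : ℝ) : 1 - errE x = 2 * ∫ t in Ioi x, Real.exp (-π * t ^ 2) := by
  have h0 : ∫ t in Ioi (0 : ℝ), Real.exp (-π * t ^ 2) = 1 / 2 := by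
    rw [integral_gaussian_Ioi, div_self Real.pi_ne_zero, Real.sqrt_one]
  have h := intervalIntegral.integral_interval_add_Ioi (a := (0 : ℝ)) (b := x)
    (f := fun t => Real.exp (-π * t ^ 2)) integrable_gaussian.integrableOn
    integrable_gaussian.integrableOn
  rw [errE]
  linarith

theorem one_sub_errE_pos (x : ℝ) : 0 < 1 - errE x := by
  rw [one_sub_errE]
  refine mul_pos two_pos ?_
  rw [MeasureTheory.setIntegral_pos_iff_support_of_nonneg_ae
    (Eventually.of_forall fun t => (Real.exp_pos _).le) integrable_gaussian.integrableOn]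
  have : Function.support (fun t : ℝ => Real.exp (-π * t ^ 2)) = univ := by
    ext t; simp [Real.exp_ne_zero]
  rw [this]
  simp

/-- Shift the tail to start at 0 and drop the cross term: (t + x)² ≥ t² + x² for t, x ≥ 0. -/
theorem one_sub_errE_le {x : ℝ} (hx : 0 ≤ x) : 1 - errE x ≤ Real.exp (-π * x ^ 2) := by
  have h0 : ∫ t in Ioi (0 : ℝ), Real.exp (-π * t ^ 2) = 1 / 2 := by
    rw [integral_gaussian_Ioi, div_self Real.pi_ne_zero, Real.sqrt_one]
  have hshift : ∫ t in Ioi x, Real.exp (-π * t ^ 2) = ∫ t in Ioi (0 : ℝ),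
      Real.exp (-π * (t + x) ^ 2) := by
    rw [← MeasureTheory.integral_indicator measurableSet_Ioi,
      ← MeasureTheory.integral_indicator measurableSet_Ioi,
      ← MeasureTheory.integral_add_right_eq_self _ x]
    congr 1
    ext t
    simp [indicator]
  have hle : ∫ t in Ioi (0 : ℝ), Real.exp (-π * (t + x) ^ 2)
      ≤ ∫ t in Ioi (0 : ℝ), Real.exp (-π * x ^ 2) * Real.exp (-π * t ^ 2) := by
    refine MeasureTheory.setIntegral_mono_on (integrable_gaussian.comp_add_right x).integrableOn
      (integrable_gaussian.const_mul _).integrableOn measurableSet_Ioi fun t ht => ?_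
    rw [← Real.exp_add, Real.exp_le_exp]
    have : 0 ≤ π * (t * x) := mul_nonneg Real.pi_pos.le (mul_nonneg (le_of_lt ht) hx)
    nlinarith
  rw [MeasureTheory.integral_const_mul, h0] at hle
  rw [one_sub_errE, hshift]
  linarith

theorem abs_sign_sub_errE_le_of_nonneg {s x : ℝ} (hs : s ≠ 0) (h : 0 ≤ s * x) :
    |Real.sign s - errE x| ≤ Real.exp (-π * x ^ 2) := by
  rcases lt_or_gt_of_ne hs with hs | hs
  · have hx : 0 ≤ -x := by nlinarith
    rw [Real.sign_of_neg hs, show (-1 : ℝ) - errE x = -(1 - errE (-x)) by rw [errE_neg]; ring,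
      abs_neg, abs_of_pos (one_sub_errE_pos _)]
    simpa using one_sub_errE_le hx
  · have hx : 0 ≤ x := by nlinarith
    rw [Real.sign_of_pos hs, abs_of_pos (one_sub_errE_pos _)]
    exact one_sub_errE_le hx

theorem abs_sign_sub_errE_le_two (s x : ℝ) : |Real.sign s - errE x| ≤ 2 := by
  have h1 := one_sub_errE_pos x
  have h2 := one_sub_errE_pos (-x)
  rw [errE_neg] at h2
  rcases Real.sign_apply_eq s with h | h | h <;> rw [h, abs_le] <;> constructor <;> linarith

/-- If s and s + a do not have opposite signs, the Gaussian tail bound applies. Otherwise |s + a| ≤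
|a| ≤ A, and the factor exp(2πyA²) lifts the right side above the trivial bound 2. -/
theorem abs_sign_sub_errE_shift_le {s a A y : ℝ} (hs : s ≠ 0) (hy : 0 < y) (ha : |a| ≤ A) :
    |Real.sign s - errE ((s + a) * √(2 * y))|
      ≤ 2 * Real.exp (2 * π * y * A ^ 2) * Real.exp (-2 * π * y * (s + a) ^ 2) := by
  have hsq : -π * ((s + a) * √(2 * y)) ^ 2 = -2 * π * y * (s + a) ^ 2 := by
    rw [mul_pow, Real.sq_sqrt (by positivity)]; ring
  have hA : 1 ≤ Real.exp (2 * π * y * A ^ 2) := Real.one_le_exp (by positivity)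
  have hpos := Real.exp_pos (-2 * π * y * (s + a) ^ 2)
  by_cases h : 0 ≤ s * (s + a)
  · have h' : 0 ≤ s * ((s + a) * √(2 * y)) := by
      rw [← mul_assoc]; positivity
    have := abs_sign_sub_errE_le_of_nonneg hs h'
    rw [hsq] at this
    nlinarith
  · refine (abs_sign_sub_errE_le_two _ _).trans ?_
    rw [mul_assoc, ← Real.exp_add]
    have h1 : (s + a) ^ 2 ≤ A ^ 2 := by
      have : (s + a) ^ 2 ≤ a ^ 2 := by nlinarith [sq_nonneg s]
      exact this.trans (sq_le_sq' (by linarith [(abs_le.mp ha).1]) (abs_le.mp ha).2)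
    have h2 : 1 ≤ Real.exp (2 * π * y * A ^ 2 + -2 * π * y * (s + a) ^ 2) := by
      refine Real.one_le_exp ?_
      have : 0 ≤ 2 * π * y * (A ^ 2 - (s + a) ^ 2) :=
        mul_nonneg (by positivity) (by linarith)
      linarith
    linarith

/-! ### The function `R` -/

/-- The exponential factor in the terms of `R`. -/
def rExp (n : ℤ) (u t : ℂ) : ℂ :=
  cexp (-π * 𝕚 * ((n : ℂ) + 1 / 2) ^ 2 * t - 2 * π * 𝕚 * ((n : ℂ) + 1 / 2) * u + π * 𝕚 * n)

/-- The error function factor in the terms of `R`. -/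
def rCoeff (n : ℤ) (s y : ℝ) : ℝ :=
  Real.sign ((n : ℝ) + 1 / 2) - errE (((n : ℝ) + 1 / 2 + s / y) * √(2 * y))

/-- Zwegers' function `R` with a complex modulus. -/
def zR (u t : ℂ) : ℂ := ∑' n : ℤ, (rCoeff n u.im t.im : ℂ) * rExp n u t

theorem zwegersR_eq_zR (u : ℂ) (τ : ℍ) : zwegersR u τ = zR u τ := by
  refine tsum_congr fun n => ?_
  rw [rExp, Complex.exp_add, ← neg_one_zpow_eq_exp, rCoeff, errE]
  simp only [UpperHalfPlane.im]
  push_cast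
  ring

theorem half_int_ne_zero (n : ℤ) : (n : ℝ) + 1 / 2 ≠ 0 := by
  intro h
  have : (2 * n + 1 : ℤ) = 0 := by
    have : (2 * (n : ℝ) + 1) = 0 := by linarith
    exact_mod_cast this
  omega

theorem norm_rExp (n : ℤ) (u t : ℂ) : ‖rExp n u t‖
    = Real.exp (π * ((n : ℝ) + 1 / 2) ^ 2 * t.im + 2 * π * ((n : ℝ) + 1 / 2) * u.im) := by
  rw [rExp, Complex.norm_exp]
  congr 1
  have : -π * 𝕚 * ((n : ℂ) + 1 / 2) ^ 2 * t - 2 * π * 𝕚 * ((n : ℂ) + 1 / 2) * u + π * 𝕚 * n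
      = ((-π * ((n : ℝ) + 1 / 2) ^ 2 : ℝ) : ℂ) * (𝕚 * t)
        + ((-2 * π * ((n : ℝ) + 1 / 2) : ℝ) : ℂ) * (𝕚 * u) + ((π * n : ℝ) : ℂ) * 𝕚 := by
    push_cast; ring
  rw [this, Complex.add_re, Complex.add_re, Complex.re_ofReal_mul, Complex.re_ofReal_mul,
    Complex.I_mul_re, Complex.I_mul_re, Complex.re_ofReal_mul, Complex.I_re]
  ring

/-- A Gaussian majorant for the terms of `R` on a horizontal strip. -/
def rBound (B y : ℝ) (n : ℤ) : ℝ :=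
  Real.exp (-π * y * ((n : ℝ) + 1 / 2) ^ 2 + 2 * π * |(n : ℝ) + 1 / 2| * B)

theorem rBound_le {B y : ℝ} (hB : 0 ≤ B) (hy : 0 < y) (n : ℤ) : rBound B y n
    ≤ Real.exp (π * B) * Real.exp (-π * (y * n ^ 2 - 2 * (B + y / 2) * |n|)) := by
  rw [rBound, ← Real.exp_add, Real.exp_le_exp]
  have h1 : |(n : ℝ) + 1 / 2| ≤ |(n : ℝ)| + 1 / 2 := by
    have := abs_add_le (n : ℝ) (1 / 2)
    rwa [abs_of_pos (by norm_num : (0 : ℝ) < 1 / 2)] at this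
  have h2 : -|(n : ℝ)| ≤ n := neg_abs_le _
  have h3 : -y * ((n : ℝ) + 1 / 2) ^ 2 + 2 * |(n : ℝ) + 1 / 2| * B
      ≤ B - (y * n ^ 2 - 2 * (B + y / 2) * |(n : ℝ)|) := by
    have := mul_le_mul_of_nonneg_right h1 hB
    nlinarith
  have := mul_le_mul_of_nonneg_left h3 Real.pi_pos.le
  push_cast
  linarith

/-- The weight pays for the factor ν = n + 1/2 produced by differentiating in u. -/
theorem summable_rBound_mul {B y : ℝ} (hB : 0 ≤ B) (hy : 0 < y) :
    Summable fun n : ℤ => (1 + |(n : ℝ) + 1 / 2|) * rBound B y n := by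
  have h0 := summable_pow_mul_jacobiTheta₂_term_bound (B + y / 2) hy 0
  have h1 := summable_pow_mul_jacobiTheta₂_term_bound (B + y / 2) hy 1
  refine Summable.of_nonneg_of_le (fun n => by unfold rBound; positivity) (fun n => ?_)
    ((h0.add h1).mul_left (2 * Real.exp (π * B)))
  have hle : 1 + |(n : ℝ) + 1 / 2| ≤ 2 * (1 + |(n : ℝ)|) := by
    have := abs_add_le (n : ℝ) (1 / 2)
    rw [abs_of_pos (by norm_num : (0 : ℝ) < 1 / 2)] at this
    have := abs_nonneg (n : ℝ)
    linarith
  calc (1 + |(n : ℝ) + 1 / 2|) * rBound B y n ≤ 2 * (1 + |(n : ℝ)|)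
        * (Real.exp (π * B) * Real.exp (-π * (y * n ^ 2 - 2 * (B + y / 2) * |n|))) := by
        gcongr
        · exact (Real.exp_pos _).le
        · exact rBound_le hB hy n
    _ = _ := by push_cast; ring

/-- The exponential grows like exp(πyν²) and the Gaussian decays at twice that rate; after expanding
the square, a term -2π(Im u)²/y is dropped. -/
theorem gaussian_mul_norm_rExp_le {B : ℝ} {u t : ℂ} (hu : |u.im| ≤ B) (ht : 0 < t.im) (n : ℤ) :
    Real.exp (-2 * π * t.im * ((n : ℝ) + 1 / 2 + u.im / t.im) ^ 2) * ‖rExp n u t‖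
      ≤ rBound B t.im n := by
  rw [norm_rExp, ← Real.exp_add, rBound, Real.exp_le_exp]
  have e : -2 * π * t.im * ((n : ℝ) + 1 / 2 + u.im / t.im) ^ 2
      + (π * ((n : ℝ) + 1 / 2) ^ 2 * t.im + 2 * π * ((n : ℝ) + 1 / 2) * u.im)
      = -π * t.im * ((n : ℝ) + 1 / 2) ^ 2 + 2 * π * (-((n : ℝ) + 1 / 2) * u.im)
        - 2 * π * (u.im ^ 2 / t.im) := by
    field_simp; ring
  have h1 : -((n : ℝ) + 1 / 2) * u.im ≤ |(n : ℝ) + 1 / 2| * B := by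
    calc -((n : ℝ) + 1 / 2) * u.im ≤ |-((n : ℝ) + 1 / 2) * u.im| := le_abs_self _
      _ = |(n : ℝ) + 1 / 2| * |u.im| := by rw [abs_mul, abs_neg]
      _ ≤ _ := by gcongr
  have h2 : 0 ≤ 2 * π * (u.im ^ 2 / t.im) := by positivity
  have h3 := mul_le_mul_of_nonneg_left h1 Real.two_pi_pos.le
  rw [e]
  linarith

theorem abs_rCoeff_mul_norm_rExp_le {B : ℝ} {u t : ℂ} (hu : |u.im| ≤ B) (ht : 0 < t.im) (n : ℤ) :
    |rCoeff n u.im t.im| * ‖rExp n u t‖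
      ≤ 2 * Real.exp (2 * π * t.im * (B / t.im) ^ 2) * rBound B t.im n := by
  have h1 := abs_sign_sub_errE_shift_le (a := u.im / t.im) (A := B / t.im) (half_int_ne_zero n) ht
    (by rw [abs_div, abs_of_pos ht]; gcongr)
  calc |rCoeff n u.im t.im| * ‖rExp n u t‖ ≤ (2 * Real.exp (2 * π * t.im * (B / t.im) ^ 2)
        * Real.exp (-2 * π * t.im * ((n : ℝ) + 1 / 2 + u.im / t.im) ^ 2)) * ‖rExp n u t‖ := by
        gcongr; exact h1
    _ ≤ _ := by
        rw [mul_assoc]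
        gcongr
        exact gaussian_mul_norm_rExp_le hu ht n

theorem summable_rBound {B y : ℝ} (hB : 0 ≤ B) (hy : 0 < y) : Summable (rBound B y) := by
  refine Summable.of_nonneg_of_le (fun n => (Real.exp_pos _).le) (fun n => ?_)
    (summable_rBound_mul hB hy)
  have : 0 ≤ |(n : ℝ) + 1 / 2| * rBound B y n := mul_nonneg (abs_nonneg _) (Real.exp_pos _).le
  linarith

theorem summable_zR (u : ℂ) {t : ℂ} (ht : 0 < t.im) :
    Summable fun n : ℤ => (rCoeff n u.im t.im : ℂ) * rExp n u t := by
  refine Summable.of_norm_bounded ((summable_rBound (abs_nonneg u.im) ht).mul_left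
    (2 * Real.exp (2 * π * t.im * (|u.im| / t.im) ^ 2))) fun n => ?_
  rw [norm_mul, Complex.norm_real, Real.norm_eq_abs]
  exact abs_rCoeff_mul_norm_rExp_le le_rfl ht n

theorem zR_add_one (u t : ℂ) : zR (u + 1) t = -zR u t := by
  rw [zR, zR, ← tsum_neg]
  refine tsum_congr fun n => ?_
  rw [← mul_neg, Complex.add_im, Complex.one_im, add_zero, rExp, rExp, neg_exp]
  congr 1
  rw [Complex.exp_eq_exp_iff_exists_int]
  exact ⟨-n - 1, by push_cast; ring⟩

theorem zR_translation (u t : ℂ) : zR u (t + 1) = cexp (-π * 𝕚 / 4) * zR u t := by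
  rw [zR, zR, ← tsum_mul_left]
  refine tsum_congr fun n => ?_
  rw [mul_left_comm, Complex.add_im, Complex.one_im, add_zero, rExp, rExp, ← Complex.exp_add]
  congr 1
  have h : cexp (-(π * 𝕚 * ((n : ℂ) * (n + 1)))) = 1 := by
    rw [Complex.exp_neg, exp_int_mul_succ, inv_one]
  rw [show -π * 𝕚 * ((n : ℂ) + 1 / 2) ^ 2 * (t + 1) - 2 * π * 𝕚 * ((n : ℂ) + 1 / 2) * u + π * 𝕚 * n
    = (-π * 𝕚 / 4 + (-π * 𝕚 * ((n : ℂ) + 1 / 2) ^ 2 * t - 2 * π * 𝕚 * ((n : ℂ) + 1 / 2) * u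
      + π * 𝕚 * n)) + -(π * 𝕚 * ((n : ℂ) * (n + 1))) by ring, Complex.exp_add, h, mul_one]

/-- Under n ↦ n - 1 the argument of the error function is unchanged, while sgn(n + 1/2) changes only
at n = 0, by 2. That single term is the inhomogeneity, built to cancel the one in
`appell_add_modulus`. -/
theorem zR_add_modulus (u : ℂ) {t : ℂ} (ht : 0 < t.im) :
    zR (u + t) t = cexp (2 * π * 𝕚 * u + π * 𝕚 * t)
      * (2 * cexp (-π * 𝕚 * u - π * 𝕚 * t / 4) - zR u t) := by
  have hsum := ((hasSum_ite_eq (0 : ℤ) (2 * cexp (-π * 𝕚 * u - π * 𝕚 * t / 4))).sub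
    (summable_zR u ht).hasSum).mul_left (cexp (2 * π * 𝕚 * u + π * 𝕚 * t))
  rw [← zR] at hsum
  rw [← hsum.tsum_eq, zR, ← (Equiv.subRight (1 : ℤ)).tsum_eq]
  refine tsum_congr fun n => ?_
  rw [Equiv.subRight_apply]
  have hE : rExp (n - 1) (u + t) t = -(cexp (2 * π * 𝕚 * u + π * 𝕚 * t) * rExp n u t) := by
    rw [rExp, rExp, ← Complex.exp_add, neg_exp, Complex.exp_eq_exp_iff_exists_int]
    exact ⟨-1, by push_cast; ring⟩
  have harg : ((n - 1 : ℤ) : ℝ) + 1 / 2 + (u + t).im / t.im = (n : ℝ) + 1 / 2 + u.im / t.im := by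
    rw [Complex.add_im]; push_cast; field_simp; ring
  have hc : rCoeff (n - 1) (u + t).im t.im
      = rCoeff n u.im t.im - (if n = 0 then 2 else 0) := by
    rw [rCoeff, rCoeff, harg]
    by_cases hn : n = 0
    · subst hn
      rw [Real.sign_of_neg (by push_cast; norm_num), Real.sign_of_pos (by push_cast; norm_num)]
      norm_num
      ring
    · rw [if_neg hn, sub_zero]
      congr 1
      rcases lt_or_gt_of_ne hn with h | h
      · have h' : (n : ℝ) ≤ -1 := by exact_mod_cast (by omega : n ≤ -1)
        rw [Real.sign_of_neg (by push_cast; linarith), Real.sign_of_neg (by linarith)]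
      · have h' : (1 : ℝ) ≤ n := by exact_mod_cast (by omega : 1 ≤ n)
        rw [Real.sign_of_pos (by push_cast; linarith), Real.sign_of_pos (by linarith)]
  rw [hE, hc]
  by_cases hn : n = 0
  · subst hn
    have : rExp 0 u t = cexp (-π * 𝕚 * u - π * 𝕚 * t / 4) := by
      rw [rExp]; congr 1; push_cast; ring
    rw [if_pos rfl, if_pos rfl, this]
    push_cast
    ring
  · rw [if_neg hn, if_neg hn]
    push_cast
    ring

/-! ### The real differential of `R` in the elliptic variable. -/

/-- The imaginary part as a real linear map `ℂ → ℂ`. -/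
def imC : ℂ →L[ℝ] ℂ := Complex.ofRealCLM.comp Complex.imCLM

theorem norm_imC_le : ‖imC‖ ≤ 1 := by
  refine ContinuousLinearMap.opNorm_le_bound _ zero_le_one fun z => ?_
  simpa [imC] using Complex.abs_im_le_norm z

theorem hasDerivAt_rCoeff (n : ℤ) {y : ℝ} (hy : 0 < y) (s : ℝ) :
    HasDerivAt (fun s => rCoeff n s y)
      (-(2 * √(2 * y) / y) * Real.exp (-2 * π * y * ((n : ℝ) + 1 / 2 + s / y) ^ 2)) s := by
  have h1 : HasDerivAt (fun s : ℝ => ((n : ℝ) + 1 / 2 + s / y) * √(2 * y)) (1 / y * √(2 * y)) s :=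
    (((hasDerivAt_id s).div_const y).const_add _).mul_const _
  have h2 := ((hasDerivAt_errE _).comp s h1).const_sub (Real.sign ((n : ℝ) + 1 / 2))
  refine h2.congr_deriv ?_
  rw [mul_pow, Real.sq_sqrt (by positivity), show -π * (((n : ℝ) + 1 / 2 + s / y) ^ 2 * (2 * y))
    = -2 * π * y * ((n : ℝ) + 1 / 2 + s / y) ^ 2 by ring]
  ring

/-- The coefficient of the real differential of a term of `R` in the direction `Im u`. -/
def rImCoeff (n : ℤ) (u t : ℂ) : ℂ :=
  ((-(2 * √(2 * t.im) / t.im)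
    * Real.exp (-2 * π * t.im * ((n : ℝ) + 1 / 2 + u.im / t.im) ^ 2) : ℝ) : ℂ) * rExp n u t

theorem hasFDerivAt_rTerm (n : ℤ) {t : ℂ} (ht : 0 < t.im) (u : ℂ) :
    HasFDerivAt (fun u : ℂ => (rCoeff n u.im t.im : ℂ) * rExp n u t)
      (((rCoeff n u.im t.im : ℂ) * (-2 * π * 𝕚 * ((n : ℂ) + 1 / 2) * rExp n u t))
          • ContinuousLinearMap.id ℝ ℂ + rImCoeff n u t • imC) u := by
  have h1 : HasFDerivAt (fun u : ℂ => ((rCoeff n u.im t.im : ℝ) : ℂ)) _ u :=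
    Complex.ofRealCLM.hasFDerivAt.comp u
      (((hasDerivAt_rCoeff n ht u.im).hasFDerivAt).comp u Complex.imCLM.hasFDerivAt)
  have h2 : HasDerivAt (fun u : ℂ => rExp n u t)
      (-2 * π * 𝕚 * ((n : ℂ) + 1 / 2) * rExp n u t) u := by
    have : HasDerivAt (fun u : ℂ => -π * 𝕚 * ((n : ℂ) + 1 / 2) ^ 2 * t
        - 2 * π * 𝕚 * ((n : ℂ) + 1 / 2) * u + π * 𝕚 * n) (-(2 * π * 𝕚 * ((n : ℂ) + 1 / 2))) u := by
      exact ((((hasDerivAt_id' u).const_mul (2 * π * 𝕚 * ((n : ℂ) + 1 / 2))).const_sub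
        (-π * 𝕚 * ((n : ℂ) + 1 / 2) ^ 2 * t)).add_const (π * 𝕚 * n)).congr_deriv (by ring)
    refine this.cexp.congr_deriv ?_
    rw [rExp]; ring
  refine (h1.mul (h2.hasFDerivAt.restrictScalars ℝ)).congr_fderiv ?_
  ext z
  simp [imC, rImCoeff]
  ring

/-- The derivative of the error function is a Gaussian, and Gaussian times exponential is, up to a
factor free of n, a theta term in conj u with modulus -conj t. -/
theorem hasSum_rImCoeff (u : ℂ) {t : ℂ} (ht : 0 < t.im) :
    HasSum (fun n => rImCoeff n u t) (-(2 * √(2 * t.im) / t.im : ℝ)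
      * Real.exp (-2 * π * (u.im ^ 2 / t.im)) * (𝕚 * theta (conj u) (-conj t))) := by
  have him : 0 < (-conj t).im := by simpa using ht
  have h := ((summable_theta_term (-conj u) him).hasSum.mul_left (-𝕚)).mul_left
    ((-(2 * √(2 * t.im) / t.im : ℝ) * Real.exp (-2 * π * (u.im ^ 2 / t.im)) : ℂ))
  rw [← theta_eq_tsum, theta_neg, show -𝕚 * -theta (conj u) (-conj t)
    = 𝕚 * theta (conj u) (-conj t) by ring] at h
  refine h.congr_fun fun n => ?_
  suffices key : (Real.exp (-2 * π * t.im * ((n : ℝ) + 1 / 2 + u.im / t.im) ^ 2) : ℂ) * rExp n u t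
      = Real.exp (-2 * π * (u.im ^ 2 / t.im)) * (-𝕚 * cexp (π * 𝕚 * ((n : ℂ) + 1 / 2) ^ 2 * -conj t
        + 2 * π * 𝕚 * ((n : ℂ) + 1 / 2) * (-conj u + 1 / 2))) by
    rw [rImCoeff, Complex.ofReal_mul, Complex.ofReal_neg]
    linear_combination -(((2 * √(2 * t.im) / t.im : ℝ) : ℂ)) * key
  rw [rExp, show -𝕚 = cexp (-π / 2 * 𝕚) by rw [Complex.exp_neg_pi_div_two_mul_I],
    Complex.ofReal_exp, Complex.ofReal_exp, ← Complex.exp_add, ← Complex.exp_add, ← Complex.exp_add]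
  congr 1
  have hy : (t.im : ℂ) ≠ 0 := by exact_mod_cast ht.ne'
  have hcu : conj u = u - 2 * (u.im : ℂ) * 𝕚 := by
    apply Complex.ext <;> simp; ring
  have hct : conj t = t - 2 * (t.im : ℂ) * 𝕚 := by
    apply Complex.ext <;> simp; ring
  rw [hcu, hct]
  push_cast
  field_simp
  ring_nf
  simp only [Complex.I_sq]
  ring

/-- The antiholomorphic derivative of `R`. -/
def rConj (u t : ℂ) : ℂ :=
  (√(2 * t.im) / t.im : ℝ) * Real.exp (-2 * π * (u.im ^ 2 / t.im)) * theta (conj u) (-conj t)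

/-- Only the antiholomorphic coefficient is used later, so the holomorphic one stays existential.
Differentiation is termwise on a strip around u. -/
theorem exists_hasFDerivAt_zR (u : ℂ) {t : ℂ} (ht : 0 < t.im) : ∃ a : ℂ,
    HasFDerivAt (fun u => zR u t) (a • ContinuousLinearMap.id ℝ ℂ
      + rConj u t • (Complex.conjCLE : ℂ →L[ℝ] ℂ)) u := by
  set B := |u.im| + 1
  have hB : 0 ≤ B := by positivity
  set S : Set ℂ := {w | |w.im| < B}
  have hSo : IsOpen S := isOpen_lt Complex.continuous_im.abs continuous_const
  have hSc : Convex ℝ S := by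
    have : S = Complex.imCLM ⁻¹' (Ioo (-B) B) := by ext w; simp [S, abs_lt]
    rw [this]
    exact (convex_Ioo _ _).linear_preimage Complex.imCLM.toLinearMap
  have huS : u ∈ S := lt_add_one |u.im|
  set K := 2 * Real.exp (2 * π * t.im * (B / t.im) ^ 2)
  set L := 2 * √(2 * t.im) / t.im
  have hL : 0 ≤ L := by positivity
  have hK : 0 ≤ K := by positivity
  have hα : ∀ (n : ℤ) (w : ℂ), w ∈ S →
      ‖(rCoeff n w.im t.im : ℂ) * (-2 * π * 𝕚 * ((n : ℂ) + 1 / 2) * rExp n w t)‖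
        ≤ 2 * π * |(n : ℝ) + 1 / 2| * (K * rBound B t.im n) := by
    intro n w hw
    have h1 := abs_rCoeff_mul_norm_rExp_le (B := B) (le_of_lt hw) ht n
    have h2 : ‖((n : ℂ) + 1 / 2)‖ = |(n : ℝ) + 1 / 2| := by
      rw [← Real.norm_eq_abs, ← Complex.norm_real]; push_cast; rfl
    rw [norm_mul, norm_mul, norm_mul, norm_mul, norm_mul, Complex.norm_real, Complex.norm_real,
      Complex.norm_I, h2, Real.norm_eq_abs, Real.norm_eq_abs, abs_of_pos Real.pi_pos, norm_neg,
      Complex.norm_two]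
    calc |rCoeff n w.im t.im| * (2 * π * 1 * |(n : ℝ) + 1 / 2| * ‖rExp n w t‖)
        = 2 * π * |(n : ℝ) + 1 / 2| * (|rCoeff n w.im t.im| * ‖rExp n w t‖) := by ring
      _ ≤ _ := by gcongr
  have hβ : ∀ (n : ℤ) (w : ℂ), w ∈ S → ‖rImCoeff n w t‖ ≤ L * rBound B t.im n := by
    intro n w hw
    have h1 := gaussian_mul_norm_rExp_le (B := B) (le_of_lt hw) ht n
    rw [rImCoeff, norm_mul, Complex.norm_real, Real.norm_eq_abs, abs_mul, abs_neg, abs_of_nonneg hL,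
      abs_of_pos (Real.exp_pos _), mul_assoc]
    gcongr
  have hbound : Summable fun n : ℤ => (2 * π * K + L) * ((1 + |(n : ℝ) + 1 / 2|) * rBound B t.im n) :=
    (summable_rBound_mul hB ht).mul_left _
  have hder := hasFDerivAt_tsum_of_isPreconnected hbound hSo hSc.isPreconnected
    (fun n w _ => hasFDerivAt_rTerm n ht w) (fun n w hw => ?_) huS (summable_zR u ht) huS
  swap
  · have h1 := hα n w hw
    have h2 := hβ n w hw
    have hr : 0 ≤ rBound B t.im n := (Real.exp_pos _).le
    have hν := abs_nonneg ((n : ℝ) + 1 / 2)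
    refine (norm_add_le _ _).trans ?_
    rw [norm_smul, norm_smul]
    have h3 : ‖rImCoeff n w t‖ * ‖imC‖ ≤ L * rBound B t.im n :=
      (mul_le_of_le_one_right (norm_nonneg _) norm_imC_le).trans h2
    have h4 := (mul_le_of_le_one_right (norm_nonneg ((rCoeff n w.im t.im : ℂ)
      * (-2 * π * 𝕚 * ((n : ℂ) + 1 / 2) * rExp n w t)))
      (ContinuousLinearMap.norm_id_le (𝕜 := ℝ) (E := ℂ))).trans h1
    have h5 : 0 ≤ 2 * π * K * rBound B t.im n := by positivity
    have h6 : 0 ≤ L * |(n : ℝ) + 1 / 2| * rBound B t.im n := by positivity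
    linarith
  have hsα : Summable fun n : ℤ =>
      (rCoeff n u.im t.im : ℂ) * (-2 * π * 𝕚 * ((n : ℂ) + 1 / 2) * rExp n u t) := by
    refine Summable.of_norm_bounded (g := fun n : ℤ =>
      (2 * π * K) * ((1 + |(n : ℝ) + 1 / 2|) * rBound B t.im n))
      ((summable_rBound_mul hB ht).mul_left _) fun n => (hα n u huS).trans ?_
    have hr : 0 ≤ 2 * π * K * rBound B t.im n := mul_nonneg (by positivity) (Real.exp_pos _).le
    linarith
  have hsβ := hasSum_rImCoeff u ht
  rw [Summable.tsum_add (hsα.smul_const _) (hsβ.summable.smul_const _), hsα.tsum_smul_const,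
    hsβ.summable.tsum_smul_const, hsβ.tsum_eq] at hder
  set α := ∑' n : ℤ, (rCoeff n u.im t.im : ℂ) * (-2 * π * 𝕚 * ((n : ℂ) + 1 / 2) * rExp n u t)
  -- The `imC` coefficient is -2i·`rConj`; writing Im z = (z - conj z)/(2i) sends half of it into
  -- the holomorphic coefficient.
  refine ⟨α - rConj u t, hder.congr_fderiv ?_⟩
  ext z
  have hz : conj z = z - 2 * (z.im : ℂ) * 𝕚 := by apply Complex.ext <;> simp; ring
  simp only [imC, rConj, add_apply, smul_apply,
    ContinuousLinearMap.id_apply, ContinuousLinearMap.comp_apply, Complex.imCLM_apply,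
    Complex.ofRealCLM_apply, smul_eq_mul, ContinuousLinearEquiv.coe_coe, Complex.conjCLE_apply, hz]
  push_cast
  ring

/-! ### The completed Appell–Lerch function -/

/-- The completed Appell–Lerch function with a complex modulus. -/
def muC (u v t : ℂ) : ℂ :=
  cexp (π * 𝕚 * u) / theta v t * appell u v t + 𝕚 / 2 * zR (u - v) t

theorem muHat_eq_muC (u v : ℂ) (τ : ℍ) : muHat u v τ = muC u v τ := by
  rw [muHat, mu_eq_appell, zwegersR_eq_zR, muC]

theorem muC_add_one (u v t : ℂ) : muC (u + 1) v t = -muC u v t := by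
  rw [muC, muC, appell_add_one, show u + 1 - v = u - v + 1 by ring, zR_add_one, mul_add, mul_one,
    Complex.exp_add, Complex.exp_pi_mul_I]
  ring

theorem muC_add_one_right (u v t : ℂ) : muC u (v + 1) t = -muC u v t := by
  have h : zR (u - (v + 1)) t = -zR (u - v) t := by
    have := zR_add_one (u - (v + 1)) t
    rw [show u - (v + 1) + 1 = u - v by ring] at this
    rw [this, neg_neg]
  rw [muC, muC, appell_add_one_right, theta_add_one, h, div_neg]
  ring

theorem muC_translation (u v t : ℂ) : muC u v (t + 1) = cexp (-π * 𝕚 / 4) * muC u v t := by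
  rw [muC, muC, appell_translation, theta_translation, zR_translation,
    show -π * 𝕚 / 4 = -(π * 𝕚 / 4) by ring, Complex.exp_neg, div_mul_eq_div_div_swap]
  ring

theorem muC_add_modulus_both (u v t : ℂ) : muC (u + t) (v + t) t = muC u v t := by
  rw [muC, muC, appell_add_modulus_both, theta_add_modulus, add_sub_add_right_eq_sub]
  have e : cexp (π * 𝕚 * (u + t)) * cexp (-(2 * π * 𝕚 * v) - 2 * π * 𝕚 * t)
      = cexp (π * 𝕚 * u) * cexp (-π * 𝕚 * t - 2 * π * 𝕚 * v) := by
    rw [← Complex.exp_add, ← Complex.exp_add]; ring_nf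
  congr 1
  have h0 := Complex.exp_ne_zero (-π * 𝕚 * t - 2 * π * 𝕚 * v)
  by_cases hθ : theta v t = 0
  · simp [hθ]
  · generalize cexp (π * 𝕚 * (u + t)) = a at *
    generalize cexp (-(2 * π * 𝕚 * v) - 2 * π * 𝕚 * t) = b at *
    generalize cexp (-π * 𝕚 * t - 2 * π * 𝕚 * v) = c at *
    field_simp
    linear_combination appell u v t * e

/-- The θ(v) in the error term of the Appell series cancels against the prefactor. What remains is
minus the error term of (i/2)R, which is the reason for this completion. -/
theorem muC_add_modulus {u v t : ℂ} (ht : 0 < t.im) (hu : ¬ InLattice t u) (hv : ¬ InLattice t v) :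
    muC (u + t) v t = -cexp (2 * π * 𝕚 * (u - v) + π * 𝕚 * t) * muC u v t := by
  have hθ := theta_ne_zero ht hv
  rw [muC, muC, appell_add_modulus ht hu, show u + t - v = u - v + t by ring, zR_add_modulus _ ht]
  have e1 : cexp (π * 𝕚 * (u + t)) * cexp (-(2 * π * 𝕚 * v))
      * cexp (-π * 𝕚 * t / 4 + π * 𝕚 * (v + 1 / 2))
      = cexp (π / 2 * 𝕚)
        * (cexp (2 * π * 𝕚 * (u - v) + π * 𝕚 * t) * cexp (-π * 𝕚 * (u - v) - π * 𝕚 * t / 4)) := by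
    simp only [← Complex.exp_add]
    congr 1
    ring
  have e2 : cexp (π * 𝕚 * (u + t)) * cexp (-(2 * π * 𝕚 * v)) * cexp (2 * π * 𝕚 * u)
      = cexp (2 * π * 𝕚 * (u - v) + π * 𝕚 * t) * cexp (π * 𝕚 * u) := by
    simp only [← Complex.exp_add]
    congr 1
    ring
  rw [Complex.exp_pi_div_two_mul_I] at e1
  generalize cexp (π * 𝕚 * (u + t)) = a at *
  generalize cexp (-(2 * π * 𝕚 * v)) = b at *
  generalize cexp (-π * 𝕚 * t / 4 + π * 𝕚 * (v + 1 / 2)) = c at *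
  generalize cexp (2 * π * 𝕚 * (u - v) + π * 𝕚 * t) = d at *
  generalize cexp (-π * 𝕚 * (u - v) - π * 𝕚 * t / 4) = e at *
  generalize cexp (2 * π * 𝕚 * u) = f at *
  generalize cexp (π * 𝕚 * u) = g at *
  field_simp
  linear_combination (-2 * theta v t) * e1 - 2 * appell u v t * e2

/-! ### The inversion t ↦ -1/t. -/

theorem conj_eq_sub_im (z : ℂ) : conj z = z - 2 * (z.im : ℂ) * 𝕚 := by
  apply Complex.ext <;> simp; ring

theorem inLattice_div_iff {t u : ℂ} (ht : t ≠ 0) : InLattice (-1 / t) (u / t) ↔ InLattice t u := by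
  constructor
  · rintro ⟨m, n, h⟩
    refine ⟨n, -m, ?_⟩
    field_simp at h
    push_cast
    linear_combination h
  · rintro ⟨m, n, rfl⟩
    refine ⟨-n, m, ?_⟩
    push_cast
    field_simp
    ring

theorem im_neg_one_div {t : ℂ} : (-1 / t).im = t.im / Complex.normSq t := by
  rw [neg_div, Complex.neg_im, one_div, Complex.inv_im]
  ring

theorem im_neg_one_div_pos {t : ℂ} (ht : 0 < t.im) : 0 < (-1 / t).im := by
  rw [im_neg_one_div]
  exact div_pos ht (Complex.normSq_pos.mpr fun h => by simp [h] at ht)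

theorem quadratic_im_identity (w : ℂ) {t : ℂ} (ht : 0 < t.im) :
    (w ^ 2 / t).im + (w / t).im ^ 2 / (-1 / t).im = w.im ^ 2 / t.im := by
  have h0 : t ≠ 0 := fun h => by simp [h] at ht
  have hN : Complex.normSq t ≠ 0 := Complex.normSq_eq_zero.not.mpr h0
  rw [im_neg_one_div, Complex.div_im, Complex.div_im, pow_two, Complex.mul_im, Complex.mul_re]
  have hN' : t.re * t.re + t.im * t.im = Complex.normSq t := (Complex.normSq_apply t).symm
  field_simp
  rw [← hN']
  ring

theorem exp_conj_identity (w : ℂ) {t : ℂ} (ht : 0 < t.im) :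
    cexp (π * 𝕚 * w ^ 2 / t) * Real.exp (-2 * π * ((w / t).im ^ 2 / (-1 / t).im))
      * cexp (π * 𝕚 * conj w ^ 2 / (-conj t)) = Real.exp (-2 * π * (w.im ^ 2 / t.im)) := by
  rw [← quadratic_im_identity w ht, Complex.ofReal_exp, Complex.ofReal_exp, ← Complex.exp_add,
    ← Complex.exp_add]
  congr 1
  have h := conj_eq_sub_im (w ^ 2 / t)
  rw [map_div₀, map_pow] at h
  push_cast
  rw [div_neg, mul_div_assoc, mul_div_assoc, h]
  linear_combination (2 * π * ((w ^ 2 / t).im : ℂ)) * Complex.I_sq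

/-- The left side is the antiholomorphic derivative of the function in
`zR_inversion_differentiable`; conj t⁻¹ comes from the inner map w ↦ w/t. It vanishes by
`theta_inversion` at modulus -conj t, whose square root is the conjugate of the root s of -it, with
s·conj s = |t|. -/
theorem rConj_inversion (w : ℂ) {t : ℂ} (ht : 0 < t.im) :
    rConj w t + 1 / (-𝕚 * t) ^ (1 / 2 : ℂ) * cexp (π * 𝕚 * w ^ 2 / t) * rConj (w / t) (-1 / t)
      * conj t⁻¹ = 0 := by
  have h0 : t ≠ 0 := fun h => by simp [h] at ht
  have hc0 : conj t ≠ 0 := (map_ne_zero _).mpr h0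
  set s := (-𝕚 * t) ^ (1 / 2 : ℂ)
  have hs0 : s ≠ 0 := by
    rw [Ne, Complex.cpow_eq_zero_iff]; simp [h0]
  have hs2 : s ^ 2 = -𝕚 * t := by
    rw [← Complex.cpow_nat_mul]; simp
  have hsc : (-𝕚 * -conj t) ^ (1 / 2 : ℂ) = conj s := by
    have hre : 0 < (-𝕚 * t).re := by simpa using ht
    have harg : (-𝕚 * t).arg ≠ π := by
      intro h
      rw [Complex.arg_eq_pi_iff] at h
      linarith [h.1]
    have := Complex.cpow_conj (-𝕚 * t) (1 / 2) harg
    simp only [map_mul, map_neg, Complex.conj_I, map_div₀, map_one, map_ofNat] at this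
    rw [show s = _ from this, Complex.conj_conj]
    congr 1
    ring
  have hsn : (Real.sqrt (Complex.normSq t) : ℂ) = s * conj s := by
    rw [Complex.mul_conj, Complex.normSq_eq_norm_sq, Complex.normSq_eq_norm_sq,
      Real.sqrt_sq (norm_nonneg _), ← norm_pow, hs2]
    simp
  have hcs2 : conj s ^ 2 = 𝕚 * conj t := by
    rw [← map_pow, hs2]; simp
  have hth : theta (conj (w / t)) (-conj (-1 / t))
      = 𝕚 * conj s * cexp (π * 𝕚 * conj w ^ 2 / (-conj t)) * theta (conj w) (-conj t) := by
    have h1 : conj (w / t) = -(conj w / (-conj t)) := by rw [map_div₀, div_neg, neg_neg]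
    have h2 : -conj (-1 / t) = -1 / (-conj t) := by
      rw [map_div₀, map_neg, map_one, div_neg, neg_div]
    rw [h1, h2, theta_neg, theta_inversion _ (neg_ne_zero.mpr hc0), hsc]
    ring
  have hN : 0 < Complex.normSq t := Complex.normSq_pos.mpr h0
  have hcoef : √(2 * (-1 / t).im) / (-1 / t).im
      = √(2 * t.im) / t.im * √(Complex.normSq t) := by
    rw [im_neg_one_div, ← mul_div_assoc, Real.sqrt_div' _ hN.le]
    have h1 := Real.sqrt_ne_zero'.mpr hN
    have h2 := Real.sq_sqrt hN.le
    field_simp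
    rw [h2]
  have hexp := exp_conj_identity w ht
  rw [rConj, rConj, hth, hcoef, ← hexp, map_inv₀]
  push_cast
  rw [hsn]
  have k : 1 / s * (s * conj s) * 𝕚 * conj s * (conj t)⁻¹ = -1 := by
    rw [show 1 / s * (s * conj s) * 𝕚 * conj s * (conj t)⁻¹
      = (s⁻¹ * s) * 𝕚 * conj s ^ 2 * (conj t)⁻¹ by ring, hcs2, inv_mul_cancel₀ hs0]
    rw [show 1 * 𝕚 * (𝕚 * conj t) * (conj t)⁻¹ = 𝕚 ^ 2 * (conj t * (conj t)⁻¹) by ring,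
      mul_inv_cancel₀ hc0, Complex.I_sq, mul_one]
  linear_combination ((√(2 * t.im) : ℂ) / t.im * (cexp (π * 𝕚 * w ^ 2 / t)
    * cexp (-2 * π * (((w / t).im : ℂ) ^ 2 / ((-1 / t).im : ℂ)))
    * cexp (π * 𝕚 * conj w ^ 2 / (-conj t))) * theta (conj w) (-conj t)) * k

/-- The combination of `R` and its inversion is entire. -/
theorem zR_inversion_differentiable {t : ℂ} (ht : 0 < t.im) : Differentiable ℂ fun w =>
    zR w t + 1 / (-𝕚 * t) ^ (1 / 2 : ℂ) * cexp (π * 𝕚 * w ^ 2 / t) * zR (w / t) (-1 / t) := by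
  intro w
  obtain ⟨a, ha⟩ := exists_hasFDerivAt_zR w ht
  obtain ⟨b, hb⟩ := exists_hasFDerivAt_zR (w / t) (im_neg_one_div_pos ht)
  set k := 1 / (-𝕚 * t) ^ (1 / 2 : ℂ)
  have hdiv : HasFDerivAt (fun w : ℂ => w / t) (t⁻¹ • ContinuousLinearMap.id ℝ ℂ) w := by
    simpa [div_eq_inv_mul] using (hasFDerivAt_id (𝕜 := ℝ) w).const_mul t⁻¹
  have hcomp := hb.comp w hdiv
  have hexp : HasDerivAt (fun w : ℂ => k * cexp (π * 𝕚 * w ^ 2 / t))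
      (k * (cexp (π * 𝕚 * w ^ 2 / t) * (π * 𝕚 * (2 * w) / t))) w := by
    have h1 : HasDerivAt (fun w : ℂ => π * 𝕚 * w ^ 2 / t) (π * 𝕚 * (2 * w) / t) w := by
      simpa using ((hasDerivAt_pow 2 w).const_mul (π * 𝕚)).div_const t
    exact h1.cexp.const_mul k
  have htot := ha.add ((hexp.hasFDerivAt.restrictScalars ℝ).mul hcomp)
  set c := a + k * cexp (π * 𝕚 * w ^ 2 / t) * b * t⁻¹
    + k * (cexp (π * 𝕚 * w ^ 2 / t) * (π * 𝕚 * (2 * w) / t)) * zR (w / t) (-1 / t)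
  have hfin : HasFDerivAt (fun w => zR w t + k * cexp (π * 𝕚 * w ^ 2 / t) * zR (w / t) (-1 / t))
      (c • ContinuousLinearMap.id ℝ ℂ) w := by
    refine htot.congr_fderiv ?_
    ext z
    have hz := rConj_inversion w ht
    simp only [add_apply, smul_apply, ContinuousLinearMap.id_apply, ContinuousLinearMap.comp_apply,
      smul_eq_mul, ContinuousLinearEquiv.coe_coe, Complex.conjCLE_apply, map_mul, Function.comp_apply,
      ContinuousLinearMap.coe_restrictScalars', ContinuousLinearMap.toSpanSingleton_apply]
    linear_combination (conj z) * hz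
  -- The conjugate-linear part being zero, the real differential is complex linear.
  exact (hasFDerivAt_of_restrictScalars ℝ (f' := c • ContinuousLinearMap.id ℂ ℂ) hfin
    (by ext z; simp)).differentiableAt

/-- Inversion exchanges the two periods, so the combination `key` has the same multipliers in u as
μ̂(u, v; t). Its R-part is entire and its Appell parts have at most simple poles, so
`eq_zero_of_quasiperiodic` makes it vanish. -/
theorem muC_inversion {u v t : ℂ} (ht : 0 < t.im) (hu : ¬ InLattice t u) (hv : ¬ InLattice t v) :
    muC (u / t) (v / t) (-1 / t)
      = -(-𝕚 * t) ^ (1 / 2 : ℂ) * cexp (-(π * 𝕚 * (u - v) ^ 2 / t)) * muC u v t := by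
  have h0 : t ≠ 0 := fun h => by simp [h] at ht
  have ht' := im_neg_one_div_pos ht
  set s := (-𝕚 * t) ^ (1 / 2 : ℂ)
  have hs0 : s ≠ 0 := by
    rw [Ne, Complex.cpow_eq_zero_iff]; simp [h0]
  have hv' : ¬ InLattice (-1 / t) (v / t) := by rwa [inLattice_div_iff h0]
  have hl : ∀ {u}, ¬ InLattice t u → ¬ InLattice (-1 / t) (u / t) := fun h => by
    rwa [inLattice_div_iff h0]
  have hsplit : ∀ u, muC u v t + 1 / s * cexp (π * 𝕚 * (u - v) ^ 2 / t)
      * muC (u / t) (v / t) (-1 / t) = (cexp (π * 𝕚 * u) / theta v t * appell u v t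
        + 1 / s * cexp (π * 𝕚 * (u - v) ^ 2 / t) * (cexp (π * 𝕚 * (u / t)) / theta (v / t) (-1 / t)
          * appell (u / t) (v / t) (-1 / t)))
        + 𝕚 / 2 * (zR (u - v) t
          + 1 / s * cexp (π * 𝕚 * (u - v) ^ 2 / t) * zR ((u - v) / t) (-1 / t)) := fun u => by
    rw [muC, muC, ← sub_div]; ring
  have hR : Differentiable ℂ fun u => 𝕚 / 2 * (zR (u - v) t
      + 1 / s * cexp (π * 𝕚 * (u - v) ^ 2 / t) * zR ((u - v) / t) (-1 / t)) :=
    ((zR_inversion_differentiable ht).comp (differentiable_id.sub_const v)).const_mul _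
  have key := eq_zero_of_quasiperiodic ht hv (f := fun u => muC u v t
      + 1 / s * cexp (π * 𝕚 * (u - v) ^ 2 / t) * muC (u / t) (v / t) (-1 / t))
    (fun u hu => ?_) (fun u hu => ?_) (fun u hu => ?_) ?_ hu
  · have e : cexp (-(π * 𝕚 * (u - v) ^ 2 / t)) * cexp (π * 𝕚 * (u - v) ^ 2 / t) = 1 := by
      rw [← Complex.exp_add, neg_add_cancel, Complex.exp_zero]
    have e2 : s * (1 / s) = 1 := mul_one_div_cancel hs0
    linear_combination (s * cexp (-(π * 𝕚 * (u - v) ^ 2 / t))) * key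
      - (s * (1 / s) * muC (u / t) (v / t) (-1 / t)) * e - muC (u / t) (v / t) (-1 / t) * e2
  · simp only [hsplit]
    refine DifferentiableAt.add (DifferentiableAt.add ?_ ?_) (hR u)
    · exact DifferentiableAt.mul (by fun_prop) (appell_differentiableAt differentiable_id
        (differentiable_const v) (differentiable_const t) ht hu)
    · refine DifferentiableAt.mul (by fun_prop) (DifferentiableAt.mul (by fun_prop) ?_)
      exact appell_differentiableAt (u := fun u => u / t) (by fun_prop)
        (differentiable_const _) (differentiable_const _) ht' (hl hu)
  · have hu1 : ¬ InLattice t (u + 1) := by rwa [inLattice_add_one_iff]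
    -- The step u ↦ u + 1 is the step by minus the new modulus -1/t, so the law is used from u + 1
    -- back to u.
    have h := muC_add_modulus ht' (hl hu1) hv'
    rw [show (u + 1) / t + -1 / t = u / t by ring] at h
    have e : cexp (π * 𝕚 * (u + 1 - v) ^ 2 / t) = cexp (π * 𝕚 * (u - v) ^ 2 / t)
        * cexp (2 * π * 𝕚 * ((u + 1) / t - v / t) + π * 𝕚 * (-1 / t)) := by
      rw [← Complex.exp_add]; congr 1; field_simp; ring
    rw [muC_add_one, e, h]
    ring
  · have h := muC_add_one (u / t) (v / t) (-1 / t)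
    have e : cexp (π * 𝕚 * (u + t - v) ^ 2 / t) = cexp (π * 𝕚 * (u - v) ^ 2 / t)
        * cexp (2 * π * 𝕚 * (u - v) + π * 𝕚 * t) := by
      rw [← Complex.exp_add]; congr 1; field_simp; ring
    rw [muC_add_modulus ht hu hv, e, add_div, div_self h0, h]
    ring
  · simp only [hsplit]
    have hb1 : (fun u : ℂ => cexp (π * 𝕚 * u) / theta v t) =O[𝓝[≠] 0] fun _ => (1 : ℂ) := by
      have : Continuous fun u : ℂ => cexp (π * 𝕚 * u) / theta v t := by fun_prop
      exact (this.continuousAt.tendsto.mono_left nhdsWithin_le_nhds).isBigO_one ℂ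
    have hb2 : (fun u : ℂ => 1 / s * cexp (π * 𝕚 * (u - v) ^ 2 / t)) =O[𝓝[≠] 0]
        fun _ => (1 : ℂ) := by
      have : Continuous fun u : ℂ => 1 / s * cexp (π * 𝕚 * (u - v) ^ 2 / t) := by fun_prop
      exact (this.continuousAt.tendsto.mono_left nhdsWithin_le_nhds).isBigO_one ℂ
    have hb3 : (fun u : ℂ => cexp (π * 𝕚 * (u / t)) / theta (v / t) (-1 / t)) =O[𝓝[≠] 0]
        fun _ => (1 : ℂ) := by
      have : Continuous fun u : ℂ => cexp (π * 𝕚 * (u / t)) / theta (v / t) (-1 / t) := by fun_prop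
      exact (this.continuousAt.tendsto.mono_left nhdsWithin_le_nhds).isBigO_one ℂ
    have hdiv : Tendsto (fun u : ℂ => u / t) (𝓝[≠] 0) (𝓝[≠] 0) := by
      refine tendsto_nhdsWithin_iff.mpr ⟨?_, ?_⟩
      · have : Tendsto (fun u : ℂ => u / t) (𝓝 0) (𝓝 (0 / t)) :=
          (continuous_id.div_const t).tendsto _
        rw [zero_div] at this
        exact this.mono_left nhdsWithin_le_nhds
      · filter_upwards [self_mem_nhdsWithin] with u hu
        exact div_ne_zero hu h0
    have ha1 := hb1.mul (appell_isBigO_inv v ht)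
    have ha2 := hb2.mul (hb3.mul ((appell_isBigO_inv (v / t) ht').comp_tendsto hdiv))
    have hinv : (fun u : ℂ => (1 : ℂ) * (1 * ((fun u => u⁻¹) ∘ fun u => u / t) u)) =O[𝓝[≠] 0]
        fun u => u⁻¹ := by
      have : (fun u : ℂ => (1 : ℂ) * (1 * ((fun u => u⁻¹) ∘ fun u => u / t) u))
          = fun u => t * u⁻¹ := by
        ext u; simp [div_eq_mul_inv, mul_comm]
      rw [this]
      exact (isBigO_refl _ _).const_mul_left t
    simp only [one_mul] at ha1
    exact (ha1.add (ha2.trans hinv)).add (isBigO_inv_of_continuousAt (hR 0).continuousAt)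

/-! ### Roots of unity -/

/-- `z` is a root of unity. -/
def IsUnityRoot (z : ℂ) : Prop := ∃ m : ℕ, 0 < m ∧ z ^ m = 1

theorem IsUnityRoot.one : IsUnityRoot 1 := ⟨1, one_pos, one_pow 1⟩

theorem IsUnityRoot.mul {z w : ℂ} (hz : IsUnityRoot z) (hw : IsUnityRoot w) :
    IsUnityRoot (z * w) := by
  obtain ⟨m, hm, h⟩ := hz
  obtain ⟨n, hn, h'⟩ := hw
  exact ⟨m * n, Nat.mul_pos hm hn, by rw [mul_pow, pow_mul, h, mul_comm m, pow_mul, h']; simp⟩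

theorem IsUnityRoot.inv {z : ℂ} (hz : IsUnityRoot z) : IsUnityRoot z⁻¹ := by
  obtain ⟨m, hm, h⟩ := hz
  exact ⟨m, hm, by rw [inv_pow, h, inv_one]⟩

theorem IsUnityRoot.neg_one : IsUnityRoot (-1) := ⟨2, two_pos, by norm_num⟩

theorem IsUnityRoot.neg {z : ℂ} (hz : IsUnityRoot z) : IsUnityRoot (-z) := by
  simpa using IsUnityRoot.neg_one.mul hz

theorem IsUnityRoot.ne_zero {z : ℂ} (hz : IsUnityRoot z) : z ≠ 0 := by
  obtain ⟨m, hm, h⟩ := hz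
  rintro rfl
  simp [hm.ne'] at h

theorem IsUnityRoot.norm_eq_one {z : ℂ} (hz : IsUnityRoot z) : ‖z‖ = 1 := by
  obtain ⟨m, hm, h⟩ := hz
  exact Complex.norm_eq_one_of_pow_eq_one h hm.ne'

theorem IsUnityRoot.exp_rat (q : ℚ) : IsUnityRoot (cexp (π * 𝕚 * q)) := by
  refine ⟨2 * q.den, by have := q.den_pos; omega, ?_⟩
  rw [← Complex.exp_nat_mul, Complex.exp_eq_one_iff]
  refine ⟨q.num, ?_⟩
  have h : (q : ℂ) * q.den = q.num := by exact_mod_cast Rat.mul_den_eq_num q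
  push_cast
  linear_combination (2 * π * 𝕚) * h

/-- Two functions agree up to a root of unity. -/
def UnityRel (F G : ℍ → ℂ) : Prop := ∃ ζ, IsUnityRoot ζ ∧ ∀ τ, F τ = ζ * G τ

theorem UnityRel.refl (F : ℍ → ℂ) : UnityRel F F := ⟨1, .one, fun _ => (one_mul _).symm⟩

theorem UnityRel.symm {F G : ℍ → ℂ} (h : UnityRel F G) : UnityRel G F := by
  obtain ⟨ζ, hζ, h⟩ := h
  exact ⟨ζ⁻¹, hζ.inv, fun τ => by rw [h, inv_mul_cancel_left₀ hζ.ne_zero]⟩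

theorem UnityRel.trans {F G H : ℍ → ℂ} (h : UnityRel F G) (h' : UnityRel G H) : UnityRel F H := by
  obtain ⟨ζ, hζ, h⟩ := h
  obtain ⟨ξ, hξ, h'⟩ := h'
  exact ⟨ζ * ξ, hζ.mul hξ, fun τ => by rw [h, h', mul_assoc]⟩

/-! ### Specialization at torsion points -/

/-- The torsion point `p₁ τ + p₂`. -/
def torsionPt (p : ℚ × ℚ) (t : ℂ) : ℂ := p.1 * t + p.2

/-- `p` is not an integral vector. -/
def NonIntegral (p : ℚ × ℚ) : Prop := ¬ ∃ m n : ℤ, p = ((m : ℚ), (n : ℚ))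

theorem torsionPt_not_inLattice {p : ℚ × ℚ} (hp : NonIntegral p) {t : ℂ} (ht : 0 < t.im) :
    ¬ InLattice t (torsionPt p t) := by
  rintro ⟨m, n, h⟩
  have h1 : (p.1 : ℝ) = m := by
    have := congrArg Complex.im h
    simp only [torsionPt, Complex.add_im, Complex.mul_im, Complex.ratCast_re, Complex.ratCast_im,
      Complex.intCast_re, Complex.intCast_im, zero_mul, add_zero] at this
    exact mul_right_cancel₀ ht.ne' this
  have h1' : p.1 = m := by exact_mod_cast h1
  have h2 : (p.2 : ℂ) = n := by
    rw [torsionPt, h1'] at h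
    push_cast at h
    exact add_left_cancel h
  have h2' : p.2 = n := by exact_mod_cast h2
  exact hp ⟨m, n, Prod.ext h1' h2'⟩

/-- The completed Appell–Lerch function at a pair of torsion points, normalized so as to be
modular of weight `1/2`. -/
def torsionMu (p r : ℚ × ℚ) (τ : ℍ) : ℂ :=
  cexp (-(π * 𝕚 * ((p.1 : ℂ) - r.1) ^ 2 * τ)) * muC (torsionPt p τ) (torsionPt r τ) τ

theorem torsionMu_add_snd (p r : ℚ × ℚ) (τ : ℍ) :
    torsionMu (p + (0, 1)) r τ = -torsionMu p r τ := by
  have h : torsionPt (p + (0, 1)) τ = torsionPt p τ + 1 := by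
    simp [torsionPt, add_assoc]
  rw [torsionMu, torsionMu, h, muC_add_one]
  simp

theorem torsionMu_add_snd_right (p r : ℚ × ℚ) (τ : ℍ) :
    torsionMu p (r + (0, 1)) τ = -torsionMu p r τ := by
  have h : torsionPt (r + (0, 1)) τ = torsionPt r τ + 1 := by
    simp [torsionPt, add_assoc]
  rw [torsionMu, torsionMu, h, muC_add_one_right]
  simp

theorem torsionPt_add_fst (p : ℚ × ℚ) (t : ℂ) :
    torsionPt (p + (1, 0)) t = torsionPt p t + t := by
  simp [torsionPt]; ring

theorem torsionMu_add_fst_both (p r : ℚ × ℚ) (τ : ℍ) :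
    torsionMu (p + (1, 0)) (r + (1, 0)) τ = torsionMu p r τ := by
  rw [torsionMu, torsionMu, torsionPt_add_fst, torsionPt_add_fst, muC_add_modulus_both]
  simp

/-- The normalizing exponential absorbs the τ-dependence of the multiplier and leaves -exp(2πi(p₂ -
r₂)). -/
theorem torsionMu_add_fst {p r : ℚ × ℚ} (hp : NonIntegral p) (hr : NonIntegral r) :
    UnityRel (torsionMu (p + (1, 0)) r) (torsionMu p r) := by
  refine ⟨_, (IsUnityRoot.exp_rat (2 * (p.2 - r.2))).neg, fun τ => ?_⟩
  rw [torsionMu, torsionMu, torsionPt_add_fst, muC_add_modulus τ.im_pos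
    (torsionPt_not_inLattice hp τ.im_pos) (torsionPt_not_inLattice hr τ.im_pos)]
  have e : cexp (-(π * 𝕚 * (((p + (1, 0)).1 : ℚ) - (r.1 : ℂ)) ^ 2 * τ))
      * cexp (2 * π * 𝕚 * (torsionPt p τ - torsionPt r τ) + π * 𝕚 * τ)
      = cexp (π * 𝕚 * (2 * (p.2 - r.2) : ℚ)) * cexp (-(π * 𝕚 * ((p.1 : ℂ) - r.1) ^ 2 * τ)) := by
    rw [← Complex.exp_add, ← Complex.exp_add]
    congr 1
    simp only [torsionPt, Prod.fst_add]
    push_cast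
    ring
  linear_combination (-muC (torsionPt p τ) (torsionPt r τ) τ) * e

theorem NonIntegral.add_int {p : ℚ × ℚ} (hp : NonIntegral p) (m n : ℤ) :
    NonIntegral (p + ((m : ℚ), (n : ℚ))) := by
  rintro ⟨k, l, h⟩
  refine hp ⟨k - m, l - n, ?_⟩
  rw [← add_right_cancel_iff (a := ((m : ℚ), (n : ℚ))), h]
  ext <;> simp

/-- A predicate on rational vectors invariant under both unit translations is invariant under
integral translations. -/
theorem int_translate_induction {P : ℚ × ℚ → Prop} (h1 : ∀ p, P (p + (1, 0)) ↔ P p)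
    (h2 : ∀ p, P (p + (0, 1)) ↔ P p) {p : ℚ × ℚ} (hp : P p) (m n : ℤ) :
    P (p + ((m : ℚ), (n : ℚ))) := by
  have hn : P (p + (0, (n : ℚ))) := by
    induction n using Int.induction_on with
    | zero => rwa [Int.cast_zero, Prod.mk_zero_zero, add_zero]
    | succ k ih =>
      rw [show p + (0, ((k + 1 : ℤ) : ℚ)) = p + (0, ((k : ℤ) : ℚ)) + (0, 1) by
        ext <;> simp; ring]
      exact (h2 _).mpr ih
    | pred k ih =>
      rw [← h2, show p + (0, ((-k - 1 : ℤ) : ℚ)) + (0, 1) = p + (0, ((-k : ℤ) : ℚ)) by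
        ext <;> simp; ring]
      exact ih
  induction m using Int.induction_on with
  | zero => simpa using hn
  | succ k ih =>
    rw [show p + (((k + 1 : ℤ) : ℚ), (n : ℚ)) = p + (((k : ℤ) : ℚ), (n : ℚ)) + (1, 0) by
      ext <;> simp; ring]
    exact (h1 _).mpr ih
  | pred k ih =>
    rw [← h1, show p + (((-k - 1 : ℤ) : ℚ), (n : ℚ)) + (1, 0) = p + (((-k : ℤ) : ℚ), (n : ℚ)) by
      ext <;> simp; ring]
    exact ih

theorem nonIntegral_add_fst_iff (p : ℚ × ℚ) : NonIntegral (p + (1, 0)) ↔ NonIntegral p := by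
  refine ⟨fun h => ?_, fun h => by simpa using h.add_int 1 0⟩
  have := h.add_int (-1) 0
  rwa [add_assoc, show ((1, 0) : ℚ × ℚ) + (((-1 : ℤ) : ℚ), ((0 : ℤ) : ℚ)) = 0 by ext <;> simp,
    add_zero] at this

theorem nonIntegral_add_snd_iff (p : ℚ × ℚ) : NonIntegral (p + (0, 1)) ↔ NonIntegral p := by
  refine ⟨fun h => ?_, fun h => by simpa using h.add_int 0 1⟩
  have := h.add_int 0 (-1)
  rwa [add_assoc, show ((0, 1) : ℚ × ℚ) + (((0 : ℤ) : ℚ), ((-1 : ℤ) : ℚ)) = 0 by ext <;> simp,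
    add_zero] at this

theorem unityRel_of_neg {F G : ℍ → ℂ} (h : ∀ τ, F τ = -G τ) : UnityRel F G :=
  ⟨-1, .neg_one, fun τ => by rw [h]; ring⟩

/-- Up to roots of unity, `torsionMu` depends only on the classes modulo `ℤ²`. -/
theorem torsionMu_add_int {p r : ℚ × ℚ} (hp : NonIntegral p) (hr : NonIntegral r) (m n m' n' : ℤ) :
    UnityRel (torsionMu (p + ((m : ℚ), (n : ℚ))) (r + ((m' : ℚ), (n' : ℚ)))) (torsionMu p r) := by
  have hleft : ∀ r, NonIntegral r →
      UnityRel (torsionMu (p + ((m : ℚ), (n : ℚ))) r) (torsionMu p r) := by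
    intro r hr
    refine (int_translate_induction
      (P := fun p' => NonIntegral p' ∧ UnityRel (torsionMu p' r) (torsionMu p r)) ?_ ?_
      ⟨hp, UnityRel.refl _⟩ m n).2
    · intro q
      rw [nonIntegral_add_fst_iff]
      refine and_congr_right fun hq => ?_
      exact ⟨(torsionMu_add_fst hq hr).symm.trans, (torsionMu_add_fst hq hr).trans⟩
    · intro q
      rw [nonIntegral_add_snd_iff]
      refine and_congr_right fun hq => ?_
      have := unityRel_of_neg (torsionMu_add_snd q r)
      exact ⟨this.symm.trans, this.trans⟩
  refine (hleft _ (hr.add_int m' n')).trans ?_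
  refine (int_translate_induction
    (P := fun r' => NonIntegral r' ∧ UnityRel (torsionMu p r') (torsionMu p r)) ?_ ?_
    ⟨hr, UnityRel.refl _⟩ m' n').2
  · intro q
    rw [nonIntegral_add_fst_iff]
    refine and_congr_right fun hq => ?_
    -- A shift of r alone is a shift of both points, which changes nothing, followed by undoing the
    -- shift of p.
    have h1 : UnityRel (torsionMu (p + (1, 0)) (q + (1, 0))) (torsionMu p (q + (1, 0))) :=
      torsionMu_add_fst hp ((nonIntegral_add_fst_iff q).mpr hq)
    have h2 : UnityRel (torsionMu p (q + (1, 0))) (torsionMu p q) := by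
      refine h1.symm.trans ⟨1, .one, fun τ => ?_⟩
      rw [torsionMu_add_fst_both, one_mul]
    exact ⟨h2.symm.trans, h2.trans⟩
  · intro q
    rw [nonIntegral_add_snd_iff]
    refine and_congr_right fun hq => ?_
    have := unityRel_of_neg (torsionMu_add_snd_right p q)
    exact ⟨this.symm.trans, this.trans⟩

/-! ### Modular transformation -/

/-- The right action of `SL₂(ℤ)` on rational row vectors. -/
def vecAct (p : ℚ × ℚ) (γ : SL(2, ℤ)) : ℚ × ℚ :=
  (p.1 * γ 0 0 + p.2 * γ 1 0, p.1 * γ 0 1 + p.2 * γ 1 1)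

theorem vecAct_one (p : ℚ × ℚ) : vecAct p 1 = p := by
  ext <;> simp [vecAct]

theorem vecAct_mul (p : ℚ × ℚ) (γ δ : SL(2, ℤ)) :
    vecAct p (γ * δ) = vecAct (vecAct p γ) δ := by
  ext <;> simp [vecAct, Matrix.mul_apply, Fin.sum_univ_two] <;> ring

theorem NonIntegral.vecAct {p : ℚ × ℚ} (hp : NonIntegral p) (γ : SL(2, ℤ)) :
    NonIntegral (vecAct p γ) := by
  rintro ⟨m, n, h⟩
  refine hp ⟨m * γ⁻¹ 0 0 + n * γ⁻¹ 1 0, m * γ⁻¹ 0 1 + n * γ⁻¹ 1 1, ?_⟩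
  have : p = MockV.vecAct (MockV.vecAct p γ) γ⁻¹ := by
    rw [← vecAct_mul, mul_inv_cancel, vecAct_one]
  rw [this, h]
  ext <;> simp [MockV.vecAct]

theorem denom_linear_ne_zero (γ : SL(2, ℤ)) (τ : ℍ) :
    ((γ 1 0 : ℤ) : ℂ) * (τ : ℂ) + ((γ 1 1 : ℤ) : ℂ) ≠ 0 := by
  have := denom_ne_zero γ τ
  rwa [ModularGroup.denom_apply] at this

theorem autFactor_ne_zero (γ : SL(2, ℤ)) (τ : ℍ) : autFactor (1 / 2) γ τ ≠ 0 := by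
  rw [autFactor, Ne, Complex.cpow_eq_zero_iff, not_and_or]
  exact Or.inl (denom_linear_ne_zero γ τ)

theorem autFactor_sq (γ : SL(2, ℤ)) (τ : ℍ) :
    autFactor (1 / 2) γ τ ^ 2 = ((γ 1 0 : ℤ) : ℂ) * (τ : ℂ) + ((γ 1 1 : ℤ) : ℂ) := by
  rw [autFactor, ← Complex.cpow_nat_mul]
  norm_num

theorem continuous_autFactor (γ : SL(2, ℤ)) : Continuous (autFactor (1 / 2) γ) := by
  unfold autFactor
  by_cases hc : γ 1 0 = 0
  · simp only [hc, Int.cast_zero, zero_mul, zero_add]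
    exact continuous_const
  · refine Continuous.cpow ?_ continuous_const fun τ => ?_
    · exact (continuous_const.mul UpperHalfPlane.continuous_coe).add continuous_const
    · refine Complex.mem_slitPlane_iff.mpr (Or.inr ?_)
      simp [hc, τ.im_ne_zero]

theorem coe_smul_int (γ : SL(2, ℤ)) (τ : ℍ) : ((γ • τ : ℍ) : ℂ)
    = (((γ 0 0 : ℤ) : ℂ) * τ + ((γ 0 1 : ℤ) : ℂ)) / (((γ 1 0 : ℤ) : ℂ) * τ + ((γ 1 1 : ℤ) : ℂ)) := by
  rw [coe_specialLinearGroup_apply]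
  simp

theorem continuous_smul_int (γ : SL(2, ℤ)) : Continuous fun τ : ℍ => γ • τ := by
  rw [UpperHalfPlane.isEmbedding_coe.continuous_iff]
  have hc := UpperHalfPlane.continuous_coe
  refine Continuous.congr (((continuous_const.mul hc).add continuous_const).div
    ((continuous_const.mul hc).add continuous_const) (denom_linear_ne_zero γ))
    fun τ => (coe_smul_int γ τ).symm

/-- Both sides are continuous square roots of the same nonvanishing function, by the cocycle
relation for cτ + d. On the connected half plane they differ by one global sign, so no branches need
to be followed. -/
theorem autFactor_mul (γ δ : SL(2, ℤ)) : ∃ ε : ℂ, IsUnityRoot ε ∧ ∀ τ : ℍ,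
    autFactor (1 / 2) γ (δ • τ) * autFactor (1 / 2) δ τ = ε * autFactor (1 / 2) (γ * δ) τ := by
  have hc : Continuous fun τ : ℍ => autFactor (1 / 2) γ (δ • τ) * autFactor (1 / 2) δ τ :=
    ((continuous_autFactor γ).comp (continuous_smul_int δ)).mul (continuous_autFactor δ)
  have h := isPreconnected_univ.eq_or_eq_neg_of_sq_eq hc.continuousOn
    (continuous_autFactor (γ * δ)).continuousOn (fun τ _ => ?_)
    (fun {τ} _ => autFactor_ne_zero (γ * δ) τ)
  · rcases h with h | h
    · exact ⟨1, .one, fun τ => by rw [one_mul]; exact h (mem_univ τ)⟩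
    · exact ⟨-1, .neg_one, fun τ => by rw [neg_one_mul]; exact h (mem_univ τ)⟩
  · simp only [Pi.pow_apply, mul_pow, autFactor_sq]
    have h0 := denom_linear_ne_zero δ τ
    rw [coe_smul_int]
    simp only [Matrix.SpecialLinearGroup.coe_mul, Matrix.mul_apply, Fin.sum_univ_two]
    push_cast
    linear_combination ((γ 1 0 : ℤ) : ℂ)
      * div_mul_cancel₀ (((δ 0 0 : ℤ) : ℂ) * (τ : ℂ) + ((δ 0 1 : ℤ) : ℂ)) h0

/-- The arguments of -i and of τ add without crossing the branch cut. -/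
theorem neg_I_mul_sqrt (τ : ℍ) :
    (-𝕚 * τ) ^ (1 / 2 : ℂ) = cexp (-π * 𝕚 / 4) * (τ : ℂ) ^ (1 / 2 : ℂ) := by
  have h0 : (τ : ℂ) ≠ 0 := τ.ne_zero
  have hI : (-𝕚 : ℂ) ≠ 0 := neg_ne_zero.mpr Complex.I_ne_zero
  have harg : (-𝕚).arg + (τ : ℂ).arg ∈ Ioc (-π) π := by
    have h1 := Complex.arg_lt_pi_iff.mpr (Or.inr τ.im_ne_zero)
    have h2 := Complex.arg_nonneg_iff.mpr τ.im_pos.le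
    rw [Complex.arg_neg_I]
    constructor <;> linarith [Real.pi_pos]
  rw [Complex.cpow_def_of_ne_zero (mul_ne_zero hI h0), Complex.cpow_def_of_ne_zero h0,
    Complex.log_mul hI h0 harg, Complex.log_neg_I, ← Complex.exp_add]
  congr 1
  ring

/-- The transformation law of `torsionMu` under a fixed element of `SL₂(ℤ)`. -/
def TransformsUnder (γ : SL(2, ℤ)) : Prop := ∀ p r, NonIntegral p → NonIntegral r →
  ∃ ζ, IsUnityRoot ζ ∧ ∀ τ : ℍ, torsionMu p r (γ • τ)
    = ζ * autFactor (1 / 2) γ τ * torsionMu (vecAct p γ) (vecAct r γ) τ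

theorem transformsUnder_T : TransformsUnder ModularGroup.T := by
  intro p r _ _
  refine ⟨_, (IsUnityRoot.exp_rat (-(p.1 - r.1) ^ 2)).mul (IsUnityRoot.exp_rat (-1 / 4)),
    fun τ => ?_⟩
  have hT : ((ModularGroup.T • τ : ℍ) : ℂ) = τ + 1 := by
    rw [modular_T_smul, coe_vadd]; push_cast; ring
  have haut : autFactor (1 / 2) ModularGroup.T τ = 1 := by
    simp [autFactor, ModularGroup.coe_T]
  have hv : ∀ p : ℚ × ℚ, torsionPt p (τ + 1) = torsionPt (vecAct p ModularGroup.T) τ := by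
    intro p
    simp [torsionPt, vecAct, ModularGroup.coe_T]
    ring
  have h1 : ∀ p : ℚ × ℚ, (vecAct p ModularGroup.T).1 = p.1 := by
    intro p; simp [vecAct, ModularGroup.coe_T]
  rw [torsionMu, torsionMu, hT, hv, hv, muC_translation, haut, h1, h1]
  have e : cexp (-(π * 𝕚 * ((p.1 : ℂ) - r.1) ^ 2 * (τ + 1))) * cexp (-π * 𝕚 / 4)
      = cexp (π * 𝕚 * (-(p.1 - r.1) ^ 2 : ℚ)) * cexp (π * 𝕚 * (-1 / 4 : ℚ))
        * cexp (-(π * 𝕚 * ((p.1 : ℂ) - r.1) ^ 2 * τ)) := by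
    simp only [← Complex.exp_add]
    congr 1
    push_cast
    ring
  linear_combination muC (torsionPt (vecAct p ModularGroup.T) τ)
    (torsionPt (vecAct r ModularGroup.T) τ) τ * e

/-- With P = p₁ - r₁ and Q = p₂ - r₂, the exponents combine as P²/τ - (Qτ - P)²/τ = 2PQ - Q²τ: a
constant, and the normalization belonging to pS = (p₂, -p₁). -/
theorem transformsUnder_S : TransformsUnder ModularGroup.S := by
  intro p r hp hr
  refine ⟨_, ((IsUnityRoot.exp_rat (2 * (p.1 - r.1) * (p.2 - r.2))).mul
    (IsUnityRoot.exp_rat (-1 / 4))).neg, fun τ => ?_⟩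
  have h0 : (τ : ℂ) ≠ 0 := τ.ne_zero
  have hS : ((ModularGroup.S • τ : ℍ) : ℂ) = -1 / τ := by
    rw [modular_S_smul]; simp [neg_div, inv_neg]
  have haut : autFactor (1 / 2) ModularGroup.S τ = (τ : ℂ) ^ (1 / 2 : ℂ) := by
    simp [autFactor, ModularGroup.coe_S]
  have hv : ∀ p : ℚ × ℚ, torsionPt p (-1 / τ) = torsionPt (vecAct p ModularGroup.S) τ / τ := by
    intro p
    simp [torsionPt, vecAct, ModularGroup.coe_S]
    field_simp
    ring
  rw [torsionMu, torsionMu, hS, hv, hv, muC_inversion τ.im_pos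
    (torsionPt_not_inLattice (hp.vecAct _) τ.im_pos)
    (torsionPt_not_inLattice (hr.vecAct _) τ.im_pos), haut, neg_I_mul_sqrt]
  have hd : torsionPt (vecAct p ModularGroup.S) τ - torsionPt (vecAct r ModularGroup.S) τ
      = ((p.2 : ℂ) - r.2) * τ - ((p.1 : ℂ) - r.1) := by
    simp [torsionPt, vecAct, ModularGroup.coe_S]
    ring
  have h1 : ∀ p : ℚ × ℚ, (vecAct p ModularGroup.S).1 = p.2 := by
    intro p; simp [vecAct, ModularGroup.coe_S]
  rw [hd, h1, h1]
  have e : cexp (-(π * 𝕚 * ((p.1 : ℂ) - r.1) ^ 2 * (-1 / τ))) * cexp (-π * 𝕚 / 4)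
      * cexp (-(π * 𝕚 * (((p.2 : ℂ) - r.2) * τ - ((p.1 : ℂ) - r.1)) ^ 2 / τ))
      = cexp (π * 𝕚 * (2 * (p.1 - r.1) * (p.2 - r.2) : ℚ)) * cexp (π * 𝕚 * (-1 / 4 : ℚ))
        * cexp (-(π * 𝕚 * ((p.2 : ℂ) - r.2) ^ 2 * τ)) := by
    simp only [← Complex.exp_add]
    congr 1
    push_cast
    field_simp
    ring
  linear_combination (-(τ : ℂ) ^ (1 / 2 : ℂ) * muC (torsionPt (vecAct p ModularGroup.S) τ)
    (torsionPt (vecAct r ModularGroup.S) τ) τ) * e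

theorem TransformsUnder.mul {γ δ : SL(2, ℤ)} (hγ : TransformsUnder γ) (hδ : TransformsUnder δ) :
    TransformsUnder (γ * δ) := by
  intro p r hp hr
  obtain ⟨ζ, hζ, h⟩ := hγ p r hp hr
  obtain ⟨ξ, hξ, h'⟩ := hδ _ _ (hp.vecAct γ) (hr.vecAct γ)
  obtain ⟨ε, hε, ha⟩ := autFactor_mul γ δ
  refine ⟨ζ * ξ * ε, (hζ.mul hξ).mul hε, fun τ => ?_⟩
  rw [mul_smul, h, h', vecAct_mul, vecAct_mul]
  linear_combination (ζ * ξ * torsionMu (vecAct (vecAct p γ) δ) (vecAct (vecAct r γ) δ) τ) * ha τ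

theorem TransformsUnder.one : TransformsUnder 1 := by
  intro p r _ _
  refine ⟨1, .one, fun τ => ?_⟩
  simp [vecAct_one, autFactor]

theorem TransformsUnder.inv {γ : SL(2, ℤ)} (hγ : TransformsUnder γ) : TransformsUnder γ⁻¹ := by
  intro p r hp hr
  obtain ⟨ζ, hζ, h⟩ := hγ _ _ (hp.vecAct γ⁻¹) (hr.vecAct γ⁻¹)
  obtain ⟨ε, hε, ha⟩ := autFactor_mul γ γ⁻¹
  refine ⟨ζ⁻¹ * ε⁻¹, hζ.inv.mul hε.inv, fun τ => ?_⟩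
  have h1 := h (γ⁻¹ • τ)
  have h2 := ha τ
  have h3 : autFactor (1 / 2) (γ * γ⁻¹) τ = 1 := by simp [autFactor]
  rw [smul_inv_smul, ← vecAct_mul, ← vecAct_mul, inv_mul_cancel, vecAct_one, vecAct_one] at h1
  rw [h3, mul_one] at h2
  rw [h1, ← h2]
  have := hζ.ne_zero
  have := autFactor_ne_zero γ (γ⁻¹ • τ)
  have := autFactor_ne_zero γ⁻¹ τ
  field_simp

theorem transformsUnder (γ : SL(2, ℤ)) : TransformsUnder γ := by
  have : γ ∈ Subgroup.closure {ModularGroup.S, ModularGroup.T} := by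
    simp [SpecialLinearGroup.SL2Z_generators]
  induction this using Subgroup.closure_induction with
  | one => exact .one
  | mem g hg =>
    rcases hg with rfl | rfl
    · exact transformsUnder_S
    · exact transformsUnder_T
  | mul g h _ _ ig ih => exact ig.mul ih
  | inv g _ ig => exact ig.inv

/-! ### Expansions in fractional powers of `q` -/

/-- `f` has an expansion `∑_{n ≥ m} c(n) q^(n/N)`. -/
def HasQExp (N : ℕ) (m : ℤ) (c : ℤ → ℂ) (f : ℍ → ℂ) : Prop :=
  (∀ n < m, c n = 0) ∧ ∀ τ : ℍ, HasSum (fun n : ℤ => c n * qpow ((n : ℚ) / N) τ) (f τ)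

theorem norm_qpow (r : ℚ) (τ : ℍ) : ‖qpow r τ‖ = Real.exp (-2 * π * r * τ.im) := by
  rw [qpow, Complex.norm_exp]
  congr 1
  have : 2 * π * 𝕚 * (r : ℂ) * (τ : ℂ) = ((2 * π * r : ℝ) : ℂ) * (𝕚 * τ) := by push_cast; ring
  rw [this, Complex.re_ofReal_mul, Complex.I_mul_re, coe_im]
  ring

theorem qpow_add (r s : ℚ) (τ : ℍ) : qpow (r + s) τ = qpow r τ * qpow s τ := by
  rw [qpow, qpow, qpow, ← Complex.exp_add]; push_cast; ring_nf

theorem qpow_nat_mul (r : ℚ) (k : ℕ) (τ : ℍ) : qpow (k * r) τ = qpow r τ ^ k := by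
  rw [qpow, qpow, ← Complex.exp_nat_mul]; push_cast; ring_nf

theorem qpow_zero (τ : ℍ) : qpow 0 τ = 1 := by simp [qpow]

open scoped Manifold in
/-- A periodic holomorphic function on the upper half plane that grows at most exponentially at
the cusp has an expansion in powers of `q^(1/N)`. -/
theorem exists_hasQExp {g : ℂ → ℂ} (hg : ∀ z : ℂ, 0 < z.im → DifferentiableAt ℂ g z) {N : ℕ}
    (hN : 0 < N) (hper : ∀ z : ℂ, 0 < z.im → g (z + N) = g z) {M : ℝ}
    (hgrow : (fun τ : ℍ => g τ) =O[atImInfty] fun τ => Real.exp (M * τ.im)) :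
    ∃ m c, HasQExp N m c fun τ => g τ := by
  have hN' : (0 : ℝ) < N := by exact_mod_cast hN
  have hNc : (N : ℂ) ≠ 0 := by exact_mod_cast hN.ne'
  -- K is chosen so that multiplication by q^(K/N), which keeps the period N, makes the function
  -- bounded at infinity; the coefficients are shifted back by K at the end.
  obtain ⟨K, hK⟩ := exists_nat_ge (M * N / (2 * π))
  have hKM : M ≤ 2 * π * K / N := by
    rw [le_div_iff₀ hN']
    have := (div_le_iff₀ Real.two_pi_pos).mp hK
    linarith
  set G : ℍ → ℂ := fun τ => qpow ((K : ℚ) / N) τ * g τ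
  have hGeq : ∀ z : ℂ, 0 < z.im →
      (G ∘ ofComplex) z = cexp (2 * π * 𝕚 * ((K : ℂ) / N) * z) * g z := by
    intro z hz
    simp only [Function.comp_apply, ofComplex_apply_of_im_pos hz, G, qpow]
    push_cast
    rfl
  have hGper : Function.Periodic (G ∘ ofComplex) (N : ℝ) := by
    intro z
    rcases le_or_gt z.im 0 with hz | hz
    · rw [Function.comp_apply, Function.comp_apply,
        ofComplex_apply_eq_of_im_nonpos (w := z + ((N : ℝ) : ℂ)) (w' := z) (by simpa using hz) hz]
    · rw [hGeq _ (by simpa using hz), hGeq _ hz]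
      have h1 := hper z hz
      push_cast
      rw [h1, mul_add, Complex.exp_add, show 2 * π * 𝕚 * ((K : ℂ) / N) * N = K * (2 * π * 𝕚) by
        field_simp, Complex.exp_nat_mul_two_pi_mul_I, mul_one]
  have hGhol : MDiff G := by
    rw [UpperHalfPlane.mdifferentiable_iff]
    intro z hz
    refine DifferentiableAt.differentiableWithinAt ?_
    refine DifferentiableAt.congr_of_eventuallyEq (f := fun z =>
      cexp (2 * π * 𝕚 * ((K : ℂ) / N) * z) * g z) ?_ ?_
    · exact DifferentiableAt.mul (by fun_prop) (hg z hz)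
    · filter_upwards [isOpen_upperHalfPlaneSet.mem_nhds hz] with w hw
      exact hGeq w hw
  have hGbdd : IsBoundedAtImInfty G := by
    have h1 : (fun τ : ℍ => qpow ((K : ℚ) / N) τ) =O[atImInfty]
        fun τ => Real.exp (-(M * τ.im)) := by
      refine IsBigO.of_bound 1 (Eventually.of_forall fun τ => ?_)
      rw [norm_qpow, Real.norm_eq_abs, abs_of_pos (Real.exp_pos _), one_mul, Real.exp_le_exp]
      have := mul_le_mul_of_nonneg_right hKM τ.im_pos.le
      push_cast
      calc -2 * π * (K / N) * τ.im = -(2 * π * K / N * τ.im) := by ring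
        _ ≤ _ := neg_le_neg this
    refine (h1.mul hgrow).trans (IsBigO.of_bound 1 (Eventually.of_forall fun τ => ?_))
    rw [← Real.exp_add, neg_add_cancel, Real.exp_zero]
    simp
  have hsum := hasSum_qExpansion hN' hGper hGhol hGbdd
  refine ⟨-K, fun n => if 0 ≤ n + K then (qExpansion N G).coeff (n + K).toNat else 0,
    fun n hn => if_neg (by omega), fun τ => ?_⟩
  have h1 := (hsum τ).mul_left (qpow (-(K : ℚ) / N) τ)
  have hcancel : qpow (-(K : ℚ) / N) τ * G τ = g τ := by
    simp only [G]
    rw [← mul_assoc, ← qpow_add, neg_div, neg_add_cancel, qpow_zero, one_mul]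
  rw [hcancel] at h1
  have hinj : Function.Injective fun k : ℕ => (k : ℤ) - K := fun a b h => by
    simp only at h; omega
  rw [← hinj.hasSum_iff]
  · refine h1.congr_fun fun k => ?_
    simp only [Function.comp_apply, sub_add_cancel, Nat.cast_nonneg, if_true, Int.toNat_natCast,
      smul_eq_mul]
    have : qpow (((k : ℤ) - K : ℤ) / N : ℚ) τ
        = qpow (-(K : ℚ) / N) τ * Function.Periodic.qParam N τ ^ k := by
      rw [Function.Periodic.qParam, ← Complex.exp_nat_mul, qpow, qpow, ← Complex.exp_add]
      congr 1
      push_cast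
      field_simp
      ring
    rw [this]
    ring
  · intro n hn
    simp only []
    rw [if_neg, zero_mul]
    intro h
    exact hn ⟨(n + K).toNat, by simp [Int.toNat_of_nonneg h]⟩

/-- The leading behaviour of a `q`-expansion. -/
theorem HasQExp.isBigO {N : ℕ} (hN : 0 < N) {m : ℤ} {c : ℤ → ℂ} {f : ℍ → ℂ}
    (h : HasQExp N m c f) :
    f =O[atImInfty] fun τ => Real.exp (-(2 * π * m / N) * τ.im) := by
  have hN' : (0 : ℝ) < N := by exact_mod_cast hN
  have hs := (h.2 UpperHalfPlane.I).summable.norm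
  set S := ∑' n : ℤ, ‖c n * qpow ((n : ℚ) / N) UpperHalfPlane.I‖
  refine IsBigO.of_bound (S * Real.exp (2 * π * m / N)) ?_
  have hev : ∀ᶠ τ : ℍ in atImInfty, 1 ≤ τ.im :=
    (atImInfty_mem _).mpr ⟨1, fun _ h => h⟩
  filter_upwards [hev] with τ hτ
  -- For y ≥ 1 each term is compared with its value at τ = i; the loss is controlled by the lowest
  -- exponent m.
  have hle : ∀ n : ℤ, ‖c n * qpow ((n : ℚ) / N) τ‖
      ≤ Real.exp (-(2 * π * m / N) * (τ.im - 1)) * ‖c n * qpow ((n : ℚ) / N) UpperHalfPlane.I‖ := by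
    intro n
    rcases lt_or_ge n m with hn | hn
    · simp [h.1 n hn]
    · rw [norm_mul, norm_mul, norm_qpow, norm_qpow, mul_left_comm, ← Real.exp_add]
      refine mul_le_mul_of_nonneg_left (Real.exp_le_exp.mpr ?_) (norm_nonneg _)
      have h1 : (m : ℝ) / N ≤ n / N := by gcongr
      have h2 : 0 ≤ 2 * π * (τ.im - 1) * ((n : ℝ) / N - m / N) :=
        mul_nonneg (mul_nonneg Real.two_pi_pos.le (by linarith)) (by linarith)
      rw [UpperHalfPlane.I_im]
      push_cast
      linarith [show -(2 * π * m / N) * (τ.im - 1) + -2 * π * (n / N) * 1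
        - -2 * π * (n / N) * τ.im = 2 * π * (τ.im - 1) * ((n : ℝ) / N - m / N) by ring]
  have h1 : ‖f τ‖ ≤ Real.exp (-(2 * π * m / N) * (τ.im - 1)) * S := by
    rw [← (h.2 τ).tsum_eq]
    refine tsum_of_norm_bounded (hs.hasSum.mul_left _) hle
  refine h1.trans (le_of_eq ?_)
  have h2 : Real.exp (-(2 * π * m / N) * (τ.im - 1))
      = Real.exp (2 * π * m / N) * Real.exp (-(2 * π * m / N) * τ.im) := by
    rw [← Real.exp_add]; congr 1; ring
  rw [Real.norm_eq_abs, abs_of_pos (Real.exp_pos _), h2]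
  ring

/-- Up to an exponentially decaying error, `f` is a polynomial in a fractional power of `q⁻¹`. -/
def PolyGrowth (f : ℍ → ℂ) : Prop :=
  ∃ (N : ℕ) (P : Polynomial ℂ) (ε : ℝ), 0 < N ∧ 0 < ε ∧
    (fun τ : ℍ => f τ - P.eval (qpow (-1 / (N : ℚ)) τ)) =O[atImInfty]
      (fun τ : ℍ => Real.exp (-ε * τ.im))

/-- The terms with n ≤ 0 form the polynomial; the rest starts at q^(1/N) and decays like
exp(-2πy/N). -/
theorem HasQExp.polyGrowth {N : ℕ} (hN : 0 < N) {m : ℤ} {c : ℤ → ℂ} {f : ℍ → ℂ}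
    (h : HasQExp N m c f) : PolyGrowth f := by
  have hN' : (0 : ℝ) < N := by exact_mod_cast hN
  obtain ⟨K, hK⟩ : ∃ K : ℕ, -(K : ℤ) ≤ m := ⟨m.natAbs, by omega⟩
  set P : Polynomial ℂ := ∑ k ∈ Finset.range (K + 1), Polynomial.C (c (-k)) * Polynomial.X ^ k
  refine ⟨N, P, 2 * π / N, hN, by positivity, ?_⟩
  have hP : ∀ τ : ℍ, HasSum (fun n : ℤ => (if 1 ≤ n then 0 else c n) * qpow ((n : ℚ) / N) τ)
      (P.eval (qpow (-1 / (N : ℚ)) τ)) := by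
    intro τ
    have hev : P.eval (qpow (-1 / (N : ℚ)) τ)
        = ∑ k ∈ Finset.range (K + 1), c (-k) * qpow (((-(k : ℤ) : ℤ) : ℚ) / N) τ := by
      simp only [P, Polynomial.eval_finsetSum, Polynomial.eval_mul, Polynomial.eval_C,
        Polynomial.eval_pow, Polynomial.eval_X, ← qpow_nat_mul]
      refine Finset.sum_congr rfl fun k _ => ?_
      congr 2
      push_cast
      ring
    have hinj : Function.Injective fun k : ℕ => -(k : ℤ) := fun a b h => by
      simp only at h; omega
    rw [hev, ← hinj.hasSum_iff]
    · have h2 : ∀ k : ℕ, ((fun n : ℤ => (if 1 ≤ n then 0 else c n) * qpow ((n : ℚ) / N) τ) ∘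
          fun k : ℕ => -(k : ℤ)) k = c (-k) * qpow (((-(k : ℤ) : ℤ) : ℚ) / N) τ := by
        intro k
        simp only [Function.comp_apply]
        rw [if_neg (by omega)]
      rw [← Finset.sum_congr rfl fun k _ => h2 k]
      refine hasSum_sum_of_ne_finset_zero fun k hk => ?_
      rw [h2, h.1 _ (by simp at hk; omega), zero_mul]
    · intro n hn
      rw [if_pos, zero_mul]
      by_contra h
      exact hn ⟨n.natAbs, by simp only; omega⟩
  have hdiff : HasQExp N 1 (fun n => if 1 ≤ n then c n else 0)
      (fun τ => f τ - P.eval (qpow (-1 / (N : ℚ)) τ)) := by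
    refine ⟨fun n hn => if_neg (by omega), fun τ => ?_⟩
    refine ((h.2 τ).sub (hP τ)).congr_fun fun n => ?_
    by_cases hn : 1 ≤ n <;> simp [hn]
  simpa [neg_div] using hdiff.isBigO hN

theorem PolyGrowth.add {f g : ℍ → ℂ} (hf : PolyGrowth f) (hg : PolyGrowth g) :
    PolyGrowth fun τ => f τ + g τ := by
  obtain ⟨N, P, ε, hN, hε, h⟩ := hf
  obtain ⟨M, Q, δ, hM, hδ, h'⟩ := hg
  -- Both polynomials are rewritten in the common root q^(-1/(NM)).
  refine ⟨N * M, P.comp (Polynomial.X ^ M) + Q.comp (Polynomial.X ^ N), min ε δ,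
    Nat.mul_pos hN hM, lt_min hε hδ, ?_⟩
  have hN' : (N : ℚ) ≠ 0 := by exact_mod_cast hN.ne'
  have hM' : (M : ℚ) ≠ 0 := by exact_mod_cast hM.ne'
  have e1 : ∀ τ : ℍ, qpow (-1 / ((N * M : ℕ) : ℚ)) τ ^ M = qpow (-1 / (N : ℚ)) τ := fun τ => by
    rw [← qpow_nat_mul]; congr 1; push_cast; field_simp
  have e2 : ∀ τ : ℍ, qpow (-1 / ((N * M : ℕ) : ℚ)) τ ^ N = qpow (-1 / (M : ℚ)) τ := fun τ => by
    rw [← qpow_nat_mul]; congr 1; push_cast; field_simp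
  have hmono : ∀ {a b : ℝ}, b ≤ a → (fun τ : ℍ => Real.exp (-a * τ.im)) =O[atImInfty]
      fun τ => Real.exp (-b * τ.im) := by
    intro a b hab
    refine IsBigO.of_bound 1 (Eventually.of_forall fun τ => ?_)
    rw [one_mul, Real.norm_eq_abs, Real.norm_eq_abs, abs_of_pos (Real.exp_pos _),
      abs_of_pos (Real.exp_pos _), Real.exp_le_exp]
    have := mul_le_mul_of_nonneg_right hab τ.im_pos.le
    linarith
  refine ((h.trans (hmono (min_le_left ε δ))).add (h'.trans (hmono (min_le_right ε δ)))).congr_left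
    fun τ => ?_
  simp only [Polynomial.eval_add, Polynomial.eval_comp, Polynomial.eval_pow, Polynomial.eval_X,
    e1, e2]
  ring

theorem PolyGrowth.const_mul {f : ℍ → ℂ} (hf : PolyGrowth f) (a : ℂ) :
    PolyGrowth fun τ => a * f τ := by
  obtain ⟨N, P, ε, hN, hε, h⟩ := hf
  refine ⟨N, Polynomial.C a * P, ε, hN, hε, (h.const_mul_left a).congr_left fun τ => ?_⟩
  simp only [Polynomial.eval_mul, Polynomial.eval_C]
  ring

theorem PolyGrowth.of_isBigO {f : ℍ → ℂ} {ε : ℝ} (hε : 0 < ε)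
    (h : f =O[atImInfty] fun τ => Real.exp (-ε * τ.im)) : PolyGrowth f :=
  ⟨1, 0, ε, one_pos, hε, by simpa using h⟩

theorem PolyGrowth.qpow_neg {r : ℚ} (hr : 0 ≤ r) : PolyGrowth (qpow (-r)) := by
  refine ⟨r.den, Polynomial.X ^ r.num.toNat, 1, r.den_pos, one_pos, ?_⟩
  have : ∀ τ : ℍ, qpow (-r) τ - (Polynomial.X ^ r.num.toNat : Polynomial ℂ).eval
      (qpow (-1 / (r.den : ℚ)) τ) = 0 := fun τ => by
    rw [Polynomial.eval_pow, Polynomial.eval_X, ← qpow_nat_mul, sub_eq_zero]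
    congr 1
    have h1 : ((r.num.toNat : ℕ) : ℚ) = r.num := by
      exact_mod_cast Int.toNat_of_nonneg (Rat.num_nonneg.mpr hr)
    rw [h1]
    nth_rewrite 1 [← Rat.num_div_den r]
    ring
  simp only [this]
  exact isBigO_zero _ _

theorem PolyGrowth.sum {ι : Type*} (s : Finset ι) {f : ι → ℍ → ℂ}
    (hf : ∀ i ∈ s, PolyGrowth (f i)) : PolyGrowth fun τ => ∑ i ∈ s, f i τ := by
  classical
  induction s using Finset.induction_on with
  | empty => exact .of_isBigO one_pos (by simpa using isBigO_zero _ _)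
  | insert i s hi ih =>
    simp only [Finset.sum_insert hi]
    exact (hf i (Finset.mem_insert_self i s)).add
      (ih fun j hj => hf j (Finset.mem_insert_of_mem hj))

/-- The inverse of a nonzero function with a `q`-expansion grows at most exponentially. -/
theorem HasQExp.inv_isBigO {N : ℕ} (hN : 0 < N) {m : ℤ} {c : ℤ → ℂ} {f : ℍ → ℂ}
    (h : HasQExp N m c f) {τ₀ : ℍ} (h0 : f τ₀ ≠ 0) :
    ∃ M : ℝ, (fun τ => (f τ)⁻¹) =O[atImInfty] fun τ => Real.exp (M * τ.im) := by
  have hN' : (0 : ℝ) < N := by exact_mod_cast hN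
  obtain ⟨n₀, hn₀⟩ : ∃ n, c n ≠ 0 := by
    by_contra hc
    push Not at hc
    have := h.2 τ₀
    simp only [hc, zero_mul] at this
    exact h0 (this.unique hasSum_zero)
  -- Once y is large, the term of least index with nonzero coefficient is at least twice the
  -- remainder.
  obtain ⟨k, hk, hmin⟩ : ∃ k, c k ≠ 0 ∧ ∀ n < k, c n = 0 := by
    obtain ⟨k, hk, hle⟩ := Int.exists_least_of_bdd (P := fun n => c n ≠ 0)
      ⟨m, fun n hn => by by_contra hlt; exact hn (h.1 n (by omega))⟩ ⟨n₀, hn₀⟩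
    exact ⟨k, hk, fun n hn => by by_contra hne; exact absurd (hle n hne) (by omega)⟩
  have hrest : HasQExp N (k + 1) (fun n => if n = k then 0 else c n)
      (fun τ => f τ - c k * qpow ((k : ℚ) / N) τ) := by
    refine ⟨fun n hn => ?_, fun τ => ?_⟩
    · by_cases hnk : n = k
      · simp [hnk]
      · simpa [hnk] using hmin n (by omega)
    · refine ((h.2 τ).sub (hasSum_ite_eq k (c k * qpow ((k : ℚ) / N) τ))).congr_fun fun n => ?_
      by_cases hnk : n = k
      · subst hnk; simp
      · simp [hnk]
  obtain ⟨K, hKpos, hK⟩ := (hrest.isBigO hN).exists_pos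
  rw [isBigOWith_iff] at hK
  refine ⟨2 * π * k / N, IsBigO.of_bound (2 / ‖c k‖) ?_⟩
  have hsmall : ∀ᶠ τ : ℍ in atImInfty, K * Real.exp (-(2 * π / N) * τ.im) ≤ ‖c k‖ / 2 := by
    have ht : Tendsto (fun τ : ℍ => K * Real.exp (-(2 * π / N) * τ.im)) atImInfty (𝓝 (K * 0)) := by
      refine Tendsto.const_mul _ (Real.tendsto_exp_atBot.comp ?_)
      exact (tendsto_comap (f := UpperHalfPlane.im)).const_mul_atTop_of_neg
        (neg_lt_zero.mpr (by positivity))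
    rw [mul_zero] at ht
    exact ht.eventually (Iic_mem_nhds (half_pos (norm_pos_iff.mpr hk)))
  filter_upwards [hK, hsmall] with τ hτ hs
  have hck : 0 < ‖c k‖ := norm_pos_iff.mpr hk
  have hq : ‖qpow ((k : ℚ) / N) τ‖ = Real.exp (-(2 * π * k / N) * τ.im) := by
    rw [norm_qpow]; congr 1; push_cast; ring
  set E := Real.exp (-(2 * π * k / N) * τ.im)
  have hE : 0 < E := Real.exp_pos _
  have h1 : ‖f τ - c k * qpow ((k : ℚ) / N) τ‖ ≤ ‖c k‖ / 2 * E := by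
    refine hτ.trans ?_
    rw [Real.norm_eq_abs, abs_of_pos (Real.exp_pos _)]
    have : Real.exp (-(2 * π * ((k + 1 : ℤ) : ℝ) / N) * τ.im)
        = Real.exp (-(2 * π / N) * τ.im) * E := by
      rw [← Real.exp_add]; congr 1; push_cast; ring
    rw [this, ← mul_assoc]
    exact mul_le_mul_of_nonneg_right hs hE.le
  have h2 : ‖c k‖ / 2 * E ≤ ‖f τ‖ := by
    have h3 := norm_sub_norm_le (c k * qpow ((k : ℚ) / N) τ) (f τ)
    rw [norm_sub_rev, norm_mul, hq] at h3
    linarith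
  rw [norm_inv, Real.norm_eq_abs, abs_of_pos (Real.exp_pos _)]
  have h4 : Real.exp (2 * π * k / N * τ.im) = E⁻¹ := by
    rw [← Real.exp_neg]; congr 1; ring
  rw [h4]
  calc ‖f τ‖⁻¹ ≤ (‖c k‖ / 2 * E)⁻¹ := inv_anti₀ (by positivity) h2
    _ = 2 / ‖c k‖ * E⁻¹ := by field_simp

/-! ### The holomorphic part at torsion points -/

/-- The holomorphic summand of `torsionMu p r`, as a function of a complex variable. -/
def torsionHol (p r : ℚ × ℚ) (z : ℂ) : ℂ :=
  cexp (-(π * 𝕚 * (((p.1 - r.1 : ℚ) : ℂ)) ^ 2 * z)) *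
    (cexp (π * 𝕚 * torsionPt p z) / theta (torsionPt r z) z
      * appell (torsionPt p z) (torsionPt r z) z)

theorem differentiable_torsionPt (p : ℚ × ℚ) : Differentiable ℂ (torsionPt p) := by
  unfold torsionPt; fun_prop

theorem torsionHol_differentiableAt {p r : ℚ × ℚ} (hp : NonIntegral p) (hr : NonIntegral r) {z : ℂ}
    (hz : 0 < z.im) : DifferentiableAt ℂ (torsionHol p r) z := by
  have h1 := differentiable_torsionPt p
  have h2 := differentiable_torsionPt r
  unfold torsionHol
  refine DifferentiableAt.mul (by fun_prop) (DifferentiableAt.mul (DifferentiableAt.div ?_ ?_ ?_) ?_)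
  · exact (h1 z).const_mul _ |>.cexp
  · exact theta_differentiableAt (h2 z) differentiableAt_id hz
  · exact theta_ne_zero hz (torsionPt_not_inLattice hr hz)
  · exact appell_differentiableAt h1 h2 differentiable_id hz (torsionPt_not_inLattice hp hz)

theorem theta_periodic (t : ℂ) : Function.Periodic (fun z => theta z t) 2 := fun z => by
  show theta (z + 2) t = theta z t
  rw [show z + 2 = z + 1 + 1 by ring, theta_add_one, theta_add_one, neg_neg]

theorem theta_periodic_modulus (z : ℂ) : Function.Periodic (fun t => theta z t) 8 := fun t => by
  show theta z (t + 8) = theta z t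
  have h : ∀ n : ℕ, theta z (t + n) = cexp (π * 𝕚 / 4) ^ n * theta z t := by
    intro n
    induction n with
    | zero => simp
    | succ n ih =>
      rw [show t + ((n + 1 : ℕ) : ℂ) = t + n + 1 by push_cast; ring, theta_translation, ih]
      ring
  have h8 := h 8
  rw [← Complex.exp_nat_mul] at h8
  push_cast at h8
  rw [h8, show (8 : ℂ) * (π * 𝕚 / 4) = 2 * π * 𝕚 by ring, Complex.exp_two_pi_mul_I, one_mul]

theorem torsionPt_add {p : ℚ × ℚ} {D : ℕ} {k : ℤ} (h : (D : ℚ) * p.1 = k) (z : ℂ) (e : ℕ) :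
    torsionPt p (z + e * D) = torsionPt p z + (e * k : ℤ) := by
  have h' : (D : ℂ) * (p.1 : ℂ) = k := by exact_mod_cast h
  simp only [torsionPt]
  push_cast
  rw [← h']
  ring

/-- The translation by 16D² is a multiple of the period 8 in the modulus and moves the torsion point
by 16Dl, a multiple of the period 2. The same number serves for the Gaussian factor in
`torsionHol_add`, where it gives exp(-2πi·8(k - l)²) = 1. -/
theorem theta_torsionPt_add {r : ℚ × ℚ} {D : ℕ} {l : ℤ} (hl : (D : ℚ) * r.1 = l) (z : ℂ) :
    theta (torsionPt r (z + (16 * D ^ 2 : ℕ))) (z + (16 * D ^ 2 : ℕ)) = theta (torsionPt r z) z := by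
  have h1 : torsionPt r (z + (16 * D ^ 2 : ℕ)) = torsionPt r z + (8 * D * l : ℤ) * 2 := by
    have := torsionPt_add hl z (16 * D)
    push_cast at this ⊢
    rw [show z + 16 * (D : ℂ) ^ 2 = z + 16 * D * D by ring, this]
    ring
  have h2 : z + ((16 * D ^ 2 : ℕ) : ℂ) = z + (2 * D ^ 2 : ℕ) * 8 := by push_cast; ring
  rw [h1, h2]
  have h3 := (theta_periodic_modulus (torsionPt r z + (8 * D * l : ℤ) * 2)).nat_mul (2 * D ^ 2) z
  have h4 := (theta_periodic z).int_mul (8 * D * l) (torsionPt r z)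
  exact h3.trans h4

theorem torsionHol_add {p r : ℚ × ℚ} {D : ℕ} {k l : ℤ} (hk : (D : ℚ) * p.1 = k)
    (hl : (D : ℚ) * r.1 = l) (z : ℂ) :
    torsionHol p r (z + (16 * D ^ 2 : ℕ)) = torsionHol p r z := by
  unfold torsionHol
  rw [theta_torsionPt_add hl]
  have hu : torsionPt p (z + (16 * D ^ 2 : ℕ)) = torsionPt p z + (16 * D * k : ℤ) := by
    have := torsionPt_add hk z (16 * D)
    push_cast at this ⊢
    rw [show z + 16 * (D : ℂ) ^ 2 = z + 16 * D * D by ring, this]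
  have hv : torsionPt r (z + (16 * D ^ 2 : ℕ)) = torsionPt r z + (16 * D * l : ℤ) := by
    have := torsionPt_add hl z (16 * D)
    push_cast at this ⊢
    rw [show z + 16 * (D : ℂ) ^ 2 = z + 16 * D * D by ring, this]
  have ha : appell (torsionPt p z + (16 * D * k : ℤ)) (torsionPt r z + (16 * D * l : ℤ))
      (z + (16 * D ^ 2 : ℕ)) = appell (torsionPt p z) (torsionPt r z) z := by
    have h1 : ∀ v t, Function.Periodic (fun u => appell u v t) 1 := fun v t u =>
      appell_add_one u v t
    have h2 : ∀ u t, Function.Periodic (fun v => appell u v t) 1 := fun u t v =>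
      appell_add_one_right u v t
    have h3 : ∀ u v, Function.Periodic (fun t => appell u v t) 1 := fun u v t =>
      appell_translation u v t
    have e1 := (h1 (torsionPt r z + (16 * D * l : ℤ)) (z + (16 * D ^ 2 : ℕ))).int_mul
      (16 * D * k) (torsionPt p z)
    have e2 := (h2 (torsionPt p z) (z + (16 * D ^ 2 : ℕ))).int_mul (16 * D * l) (torsionPt r z)
    have e3 := (h3 (torsionPt p z) (torsionPt r z)).nat_mul (16 * D ^ 2) z
    simp only [mul_one] at e1 e2 e3
    rw [e1, e2, e3]
  have hw : (D : ℂ) * ((p.1 - r.1 : ℚ) : ℂ) = k - l := by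
    have : (D : ℚ) * (p.1 - r.1) = k - l := by rw [mul_sub, hk, hl]
    exact_mod_cast this
  have e1 : cexp (-(π * 𝕚 * ((p.1 - r.1 : ℚ) : ℂ) ^ 2 * (z + (16 * D ^ 2 : ℕ))))
      = cexp (-(π * 𝕚 * ((p.1 - r.1 : ℚ) : ℂ) ^ 2 * z)) := by
    have : -(π * 𝕚 * ((p.1 - r.1 : ℚ) : ℂ) ^ 2 * (z + (16 * D ^ 2 : ℕ)))
        = -(π * 𝕚 * ((p.1 - r.1 : ℚ) : ℂ) ^ 2 * z)
          + ((-8 * (k - l) ^ 2 : ℤ) : ℂ) * (2 * π * 𝕚) := by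
      have h8 : ((-8 * (k - l) ^ 2 : ℤ) : ℂ) = -8 * ((k : ℂ) - l) ^ 2 := by push_cast; ring
      rw [h8, ← hw, Nat.cast_mul, Nat.cast_pow, Nat.cast_ofNat]
      ring
    rw [this, Complex.exp_add, Complex.exp_int_mul_two_pi_mul_I, mul_one]
  have e2 : cexp (π * 𝕚 * (torsionPt p z + (16 * D * k : ℤ))) = cexp (π * 𝕚 * torsionPt p z) := by
    have : π * 𝕚 * (torsionPt p z + (16 * D * k : ℤ))
        = π * 𝕚 * torsionPt p z + ((8 * D * k : ℤ) : ℂ) * (2 * π * 𝕚) := by push_cast; ring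
    rw [this, Complex.exp_add, Complex.exp_int_mul_two_pi_mul_I, mul_one]
  rw [hu, hv, ha, e1, e2]

theorem im_torsionPt (p : ℚ × ℚ) (z : ℂ) : (torsionPt p z).im = p.1 * z.im := by
  have h1 : (p.1 : ℂ) = ((p.1 : ℝ) : ℂ) := by push_cast; rfl
  have h2 : (p.2 : ℂ) = ((p.2 : ℝ) : ℂ) := by push_cast; rfl
  rw [torsionPt, h1, h2, Complex.add_im, Complex.im_ofReal_mul, Complex.ofReal_im, add_zero]

theorem eventually_one_le_im : ∀ᶠ τ : ℍ in atImInfty, 1 ≤ τ.im :=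
  (atImInfty_mem _).mpr ⟨1, fun _ h => h⟩

/-- A Gaussian sum with linearly moving centre grows at most exponentially. -/
theorem isBigO_of_gaussian_terms {f : ℍ → ℂ} {a : ℤ → ℍ → ℂ} {b s : ℝ} {K : ℝ}
    (hf : ∀ τ, f τ = ∑' n, a n τ)
    (ha : ∀ n τ, 1 ≤ τ.im → ‖a n τ‖ ≤ K * Real.exp (-π * ((n + s) ^ 2 - b) * τ.im))
    (hs : Summable fun n : ℤ => Real.exp (-π * ((n + s) ^ 2 - b))) :
    f =O[atImInfty] fun τ => Real.exp (π * b * τ.im) := by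
  refine IsBigO.of_bound (K * (Real.exp (-π * b) * ∑' n : ℤ, Real.exp (-π * ((n + s) ^ 2 - b)))) ?_
  filter_upwards [eventually_one_le_im] with τ hτ
  rw [hf, Real.norm_eq_abs, abs_of_pos (Real.exp_pos _)]
  have hK : 0 ≤ K := by
    have := (norm_nonneg _).trans (ha 0 τ hτ)
    exact nonneg_of_mul_nonneg_left this (Real.exp_pos _)
  have hb := (hs.hasSum.mul_left (Real.exp (-π * b))).mul_left K |>.mul_right
    (Real.exp (π * b * τ.im))
  refine tsum_of_norm_bounded hb fun n => (ha n τ hτ).trans ?_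
  rw [mul_assoc K, ← Real.exp_add, ← Real.exp_add]
  refine mul_le_mul_of_nonneg_left (Real.exp_le_exp.mpr ?_) hK
  nlinarith [mul_nonneg (mul_nonneg Real.pi_pos.le (sq_nonneg ((n : ℝ) + s))) (sub_nonneg.mpr hτ)]

theorem summable_gaussian (b s : ℝ) {d : ℝ} (hd : 0 < d) :
    Summable fun n : ℤ => Real.exp (-π * d * ((n + s) ^ 2 - b)) := by
  have h := (summable_appellBound (|s| * d) hd).mul_left (Real.exp (π * d * |b|))
  refine Summable.of_nonneg_of_le (fun _ => (Real.exp_pos _).le) (fun n => ?_) h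
  rw [← Real.exp_add, Real.exp_le_exp]
  have h1 : -((n : ℝ) * s) ≤ |(n : ℝ)| * |s| := by
    rw [← abs_mul]; exact neg_le_abs _
  have h2 := le_abs_self b
  have h3 := Real.pi_pos
  have h5 : (0 : ℝ) ≤ |(n : ℝ)| := abs_nonneg _
  have h6 : ((|n| : ℤ) : ℝ) = |(n : ℝ)| := by push_cast; rfl
  have key : 0 ≤ (π * d) * (|b| - b + s ^ 2 + 2 * (|(n : ℝ)| * |s| + n * s) + |(n : ℝ)|) := by
    refine mul_nonneg (by positivity) ?_
    nlinarith [sq_nonneg s]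
  rw [h6]
  linarith [key]

/-- Completing the square, the n-th term has norm exp(-π((n + 1/2 + r₁)² - r₁²)y). -/
theorem theta_torsionPt_isBigO (r : ℚ × ℚ) :
    (fun τ : ℍ => theta (torsionPt r τ) τ) =O[atImInfty]
      fun τ => Real.exp (π * (r.1 : ℝ) ^ 2 * τ.im) := by
  refine isBigO_of_gaussian_terms (s := 1 / 2 + r.1) (K := 1) (fun τ => theta_eq_tsum _ _)
    (fun n τ hτ => le_of_eq ?_) (by simpa using summable_gaussian ((r.1 : ℝ) ^ 2) (1 / 2 + r.1) one_pos)
  rw [Complex.norm_exp, one_mul]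
  congr 1
  have h : π * 𝕚 * ((n : ℂ) + 1 / 2) ^ 2 * τ + 2 * π * 𝕚 * ((n : ℂ) + 1 / 2)
      * (torsionPt r τ + 1 / 2) = ((π * ((n : ℝ) + 1 / 2) ^ 2 : ℝ) : ℂ) * (𝕚 * τ)
        + ((2 * π * ((n : ℝ) + 1 / 2) : ℝ) : ℂ) * (𝕚 * (torsionPt r τ + ((1 / 2 : ℝ) : ℂ))) := by
    push_cast; ring
  rw [h, Complex.add_re, Complex.re_ofReal_mul, Complex.re_ofReal_mul, Complex.I_mul_re,
    Complex.I_mul_re, Complex.add_im, Complex.ofReal_im, im_torsionPt, coe_im]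
  ring

/-- The denominators of the Appell sum at a torsion point stay away from zero. -/
theorem exists_le_norm_one_sub_exp {p : ℚ × ℚ} (hp : NonIntegral p) :
    ∃ κ : ℝ, 0 < κ ∧ ∀ (n : ℤ) (τ : ℍ), 1 ≤ τ.im →
      κ ≤ ‖1 - cexp (2 * π * 𝕚 * (torsionPt p τ + n * τ))‖ := by
  have hden : (0 : ℝ) < p.1.den := by exact_mod_cast p.1.den_pos
  have hd : 0 < 1 - Real.exp (-2 * π * (1 / p.1.den)) := by
    rw [sub_pos, Real.exp_lt_one_iff]
    have : 0 < π * (1 / (p.1.den : ℝ)) := by positivity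
    linarith
  -- A nonzero p₁ + n is at least 1/den(p₁) in absolute value, which keeps the exponential off the
  -- unit circle.
  have hmain : ∀ (n : ℤ) (τ : ℍ), 1 ≤ τ.im → p.1 + n ≠ 0 →
      1 - Real.exp (-2 * π * (1 / p.1.den))
        ≤ ‖1 - cexp (2 * π * 𝕚 * (torsionPt p τ + n * τ))‖ := by
    intro n τ hτ hn
    refine one_sub_le_norm_of_im_ge ?_
    rw [im_torsionPt, coe_im, ← add_mul, abs_mul, abs_of_pos τ.im_pos]
    have h1 : 1 / (p.1.den : ℝ) ≤ |(p.1 : ℝ) + n| := by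
      have h2 : ((p.1.num + n * p.1.den : ℤ) : ℝ) = ((p.1 : ℝ) + n) * p.1.den := by
        have : ((p.1.num + n * p.1.den : ℤ) : ℚ) = (p.1 + n) * p.1.den := by
          push_cast
          rw [add_mul, Rat.mul_den_eq_num]
        exact_mod_cast this
      have h3 : p.1.num + n * p.1.den ≠ 0 := by
        intro h0
        rw [h0, Int.cast_zero, eq_comm, mul_eq_zero] at h2
        rcases h2 with h2 | h2
        · exact hn (by exact_mod_cast h2)
        · exact hden.ne' h2
      have h4 : (1 : ℝ) ≤ |((p.1.num + n * p.1.den : ℤ) : ℝ)| := by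
        exact_mod_cast Int.one_le_abs h3
      rw [h2, abs_mul, abs_of_pos hden] at h4
      rwa [div_le_iff₀ hden]
    calc 1 / (p.1.den : ℝ) ≤ |(p.1 : ℝ) + n| := h1
      _ ≤ |(p.1 : ℝ) + n| * τ.im := le_mul_of_one_le_right (abs_nonneg _) hτ
  by_cases hInt : ∃ m : ℤ, p.1 = m
  -- If p₁ is an integer, one n gives the constant denominator 1 - exp(2πip₂), nonzero because p₂ is
  -- then not an integer.
  · obtain ⟨m, hm⟩ := hInt
    have hne : 1 - cexp (2 * π * 𝕚 * p.2) ≠ 0 := by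
      intro h0
      rw [sub_eq_zero, eq_comm, Complex.exp_eq_one_iff] at h0
      obtain ⟨k, hk⟩ := h0
      refine hp ⟨m, k, Prod.ext hm ?_⟩
      have h1 : (p.2 : ℂ) = k := by
        have h2 : (2 * π * 𝕚) ≠ 0 := Complex.two_pi_I_ne_zero
        refine mul_left_cancel₀ h2 ?_
        rw [hk]; ring
      exact_mod_cast h1
    refine ⟨min (1 - Real.exp (-2 * π * (1 / p.1.den))) ‖1 - cexp (2 * π * 𝕚 * p.2)‖,
      lt_min hd (norm_pos_iff.mpr hne), fun n τ hτ => ?_⟩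
    by_cases hn : p.1 + n = 0
    · refine (min_le_right _ _).trans (le_of_eq ?_)
      have : torsionPt p τ + n * τ = p.2 := by
        have h1 : (p.1 : ℂ) + n = 0 := by exact_mod_cast hn
        rw [torsionPt]
        linear_combination (τ : ℂ) * h1
      rw [this]
    · exact (min_le_left _ _).trans (hmain n τ hτ hn)
  · refine ⟨_, hd, fun n τ hτ => hmain n τ hτ fun h => hInt ⟨-n, ?_⟩⟩
    push_cast
    linarith

theorem appell_torsionPt_isBigO {p : ℚ × ℚ} (hp : NonIntegral p) (r : ℚ × ℚ) :
    (fun τ : ℍ => appell (torsionPt p τ) (torsionPt r τ) τ) =O[atImInfty]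
      fun τ => Real.exp (π * (1 / 2 + r.1 : ℝ) ^ 2 * τ.im) := by
  obtain ⟨κ, hκ, hle⟩ := exists_le_norm_one_sub_exp hp
  refine isBigO_of_gaussian_terms (s := 1 / 2 + r.1) (K := κ⁻¹) (fun τ => rfl)
    (fun n τ hτ => ?_) (by simpa using summable_gaussian ((1 / 2 + r.1 : ℝ) ^ 2) (1 / 2 + r.1) one_pos)
  rw [appellTerm, norm_div, norm_appellCoeff, div_eq_inv_mul, im_torsionPt, coe_im]
  refine mul_le_mul (inv_anti₀ hκ (hle n τ hτ)) (le_of_eq ?_) (Real.exp_pos _).le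
    (inv_pos.mpr hκ).le
  congr 1
  ring

/-- Every factor grows at most exponentially at infinity. For 1/θ this follows from the leading term
of the q-expansion of θ. -/
theorem torsionHol_hasQExp {p r : ℚ × ℚ} (hp : NonIntegral p) (hr : NonIntegral r) {D : ℕ}
    (hD : 0 < D) {k l : ℤ} (hk : (D : ℚ) * p.1 = k) (hl : (D : ℚ) * r.1 = l) :
    ∃ m c, HasQExp (16 * D ^ 2) m c fun τ => torsionHol p r τ := by
  have hN : 0 < 16 * D ^ 2 := by positivity
  obtain ⟨m, c, hθ⟩ := exists_hasQExp (g := fun z => theta (torsionPt r z) z)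
    (fun z hz => theta_differentiableAt (differentiable_torsionPt r z) differentiableAt_id hz) hN
    (fun z _ => theta_torsionPt_add hl z) (theta_torsionPt_isBigO r)
  obtain ⟨M, hinv⟩ := hθ.inv_isBigO hN (τ₀ := UpperHalfPlane.I)
    (theta_ne_zero UpperHalfPlane.I.im_pos (torsionPt_not_inLattice hr UpperHalfPlane.I.im_pos))
  have h1 : (fun τ : ℍ => cexp (-(π * 𝕚 * (((p.1 - r.1 : ℚ) : ℂ)) ^ 2 * τ))) =O[atImInfty]
      fun τ => Real.exp (π * (p.1 - r.1 : ℝ) ^ 2 * τ.im) := by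
    refine IsBigO.of_bound 1 (Eventually.of_forall fun τ => le_of_eq ?_)
    rw [Complex.norm_exp, Real.norm_eq_abs, abs_of_pos (Real.exp_pos _), one_mul]
    congr 1
    have : -(π * 𝕚 * (((p.1 - r.1 : ℚ) : ℂ)) ^ 2 * τ)
        = ((-(π * (p.1 - r.1 : ℝ) ^ 2) : ℝ) : ℂ) * (𝕚 * τ) := by push_cast; ring
    rw [this, Complex.re_ofReal_mul, Complex.I_mul_re, coe_im]
    ring
  have h2 : (fun τ : ℍ => cexp (π * 𝕚 * torsionPt p τ)) =O[atImInfty]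
      fun τ => Real.exp (-(π * p.1) * τ.im) := by
    refine IsBigO.of_bound 1 (Eventually.of_forall fun τ => le_of_eq ?_)
    rw [Complex.norm_exp, Real.norm_eq_abs, abs_of_pos (Real.exp_pos _), one_mul]
    congr 1
    rw [mul_assoc, Complex.re_ofReal_mul, Complex.I_mul_re, im_torsionPt, coe_im]
    ring
  refine exists_hasQExp (g := torsionHol p r) (M := π * (p.1 - r.1 : ℝ) ^ 2 + (-(π * p.1) + M
    + π * (1 / 2 + r.1 : ℝ) ^ 2)) (fun z hz => torsionHol_differentiableAt hp hr hz) hN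
    (fun z _ => torsionHol_add hk hl z) ?_
  refine ((h1.mul ((h2.mul hinv).mul (appell_torsionPt_isBigO hp r))).congr_left
    fun τ => ?_).congr_right fun τ => ?_
  · rw [torsionHol, div_eq_mul_inv]
  · rw [← Real.exp_add, ← Real.exp_add, ← Real.exp_add]
    congr 1
    ring

theorem torsionHol_polyGrowth {p r : ℚ × ℚ} (hp : NonIntegral p) (hr : NonIntegral r) :
    PolyGrowth fun τ => torsionHol p r τ := by
  have hD : 0 < p.1.den * r.1.den := Nat.mul_pos p.1.den_pos r.1.den_pos
  obtain ⟨m, c, h⟩ := torsionHol_hasQExp hp hr hD (k := p.1.num * r.1.den)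
    (l := r.1.num * p.1.den)
    (by push_cast; rw [← Rat.mul_den_eq_num p.1]; ring)
    (by push_cast; rw [← Rat.mul_den_eq_num r.1]; ring)
  exact h.polyGrowth (by positivity)

/-! ### The non-holomorphic part at torsion points -/

/-- The terms of the non-holomorphic series with frequencies `n + s`. -/
def nonHolTerm (s : ℝ) (b : ℤ → ℂ) (n : ℤ) (z : ℂ) : ℂ :=
  b n * ((Real.sign (n + s) - errE ((n + s) * √(2 * z.im)) : ℝ) : ℂ)
    * cexp (-π * 𝕚 * (n + s) ^ 2 * z)

/-- The series `∑ b(n) (sgn λ - E(λ √(2y))) exp (-π i λ² z)` over `λ = n + s`. -/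
def nonHol (s : ℝ) (b : ℤ → ℂ) (z : ℂ) : ℂ := ∑' n, nonHolTerm s b n z

theorem norm_exp_neg_sq (s : ℝ) (n : ℤ) (z : ℂ) :
    ‖cexp (-π * 𝕚 * (n + s) ^ 2 * z)‖ = Real.exp (π * (n + s) ^ 2 * z.im) := by
  rw [Complex.norm_exp]
  congr 1
  have : -π * 𝕚 * ((n : ℂ) + s) ^ 2 * z = ((-π * ((n : ℝ) + s) ^ 2 : ℝ) : ℂ) * (𝕚 * z) := by
    push_cast; ring
  rw [this, Complex.re_ofReal_mul, Complex.I_mul_re]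
  ring

theorem norm_nonHolTerm_le (s : ℝ) (b : ℤ → ℂ) (n : ℤ) {z : ℂ} (hz : 0 < z.im) :
    ‖nonHolTerm s b n z‖ ≤ ‖b n‖ * Real.exp (-π * (n + s) ^ 2 * z.im) := by
  rw [nonHolTerm, norm_mul, norm_mul, Complex.norm_real, Real.norm_eq_abs, norm_exp_neg_sq,
    mul_assoc]
  refine mul_le_mul_of_nonneg_left ?_ (norm_nonneg _)
  have h : |Real.sign (n + s) - errE ((n + s) * √(2 * z.im))|
      ≤ Real.exp (-π * ((n + s) * √(2 * z.im)) ^ 2) := by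
    rcases eq_or_ne ((n : ℝ) + s) 0 with h0 | h0
    -- Since `Real.sign 0 = 0`, a zero frequency contributes nothing.
    · simp [h0, errE_zero]
    · exact abs_sign_sub_errE_le_of_nonneg h0 (by
        rw [← mul_assoc]; exact mul_nonneg (mul_self_nonneg _) (Real.sqrt_nonneg _))
  refine (mul_le_mul_of_nonneg_right h (Real.exp_pos _).le).trans (le_of_eq ?_)
  rw [← Real.exp_add, mul_pow, Real.sq_sqrt (by positivity)]
  congr 1
  ring

theorem nonHolTerm_eq_zero {s : ℝ} {n : ℤ} (h : (n : ℝ) + s = 0) (b : ℤ → ℂ) (z : ℂ) :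
    nonHolTerm s b n z = 0 := by
  simp [nonHolTerm, h, errE_zero]

theorem exists_le_abs_int_add (s : ℚ) : ∃ κ : ℝ, 0 < κ ∧ ∀ n : ℤ, (n : ℝ) + s ≠ 0 →
    κ ≤ |(n : ℝ) + s| := by
  have hden : (0 : ℝ) < s.den := by exact_mod_cast s.den_pos
  refine ⟨1 / s.den, by positivity, fun n hn => ?_⟩
  have h2 : ((n * s.den + s.num : ℤ) : ℝ) = ((n : ℝ) + s) * s.den := by
    have : ((n * s.den + s.num : ℤ) : ℚ) = (n + s) * s.den := by
      push_cast
      rw [add_mul, Rat.mul_den_eq_num]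
    exact_mod_cast this
  have h3 : n * s.den + s.num ≠ 0 := by
    intro h0
    rw [h0, Int.cast_zero, eq_comm, mul_eq_zero] at h2
    exact h2.elim hn hden.ne'
  have h4 : (1 : ℝ) ≤ |((n * s.den + s.num : ℤ) : ℝ)| := by exact_mod_cast Int.one_le_abs h3
  rw [h2, abs_mul, abs_of_pos hden] at h4
  rwa [div_le_iff₀ hden]

theorem summable_nonHolTerm (s : ℝ) {b : ℤ → ℂ} (hb : ∀ n, ‖b n‖ ≤ 1) {z : ℂ} (hz : 0 < z.im) :
    Summable fun n => nonHolTerm s b n z := by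
  refine Summable.of_norm_bounded (summable_gaussian 0 s hz) fun n => ?_
  refine (norm_nonHolTerm_le s b n hz).trans ?_
  refine (mul_le_of_le_one_left (Real.exp_pos _).le (hb n)).trans (le_of_eq ?_)
  congr 1
  ring

/-- For rational s the nonzero frequencies n + s stay at distance κ from 0, which gives the decay
exp(-πκ²y). -/
theorem nonHol_isBigO (s : ℚ) {b : ℤ → ℂ} (hb : ∀ n, ‖b n‖ ≤ 1) :
    ∃ ε : ℝ, 0 < ε ∧ (fun τ : ℍ => nonHol s b τ) =O[atImInfty]
      fun τ => Real.exp (-ε * τ.im) := by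
  obtain ⟨κ, hκ, hle⟩ := exists_le_abs_int_add s
  refine ⟨π * κ ^ 2, by positivity, ?_⟩
  have hs : Summable fun n : ℤ => Real.exp (-π * ((n : ℝ) + s) ^ 2) := by
    simpa using summable_gaussian 0 s one_pos
  refine IsBigO.of_bound (Real.exp (π * κ ^ 2) * ∑' n : ℤ, Real.exp (-π * ((n : ℝ) + s) ^ 2)) ?_
  filter_upwards [eventually_one_le_im] with τ hτ
  rw [Real.norm_eq_abs, abs_of_pos (Real.exp_pos _)]
  refine tsum_of_norm_bounded ((hs.hasSum.mul_left (Real.exp (π * κ ^ 2))).mul_right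
    (Real.exp (-(π * κ ^ 2) * τ.im))) fun n => ?_
  rcases eq_or_ne ((n : ℝ) + s) 0 with h0 | h0
  · rw [nonHolTerm_eq_zero h0, norm_zero]
    positivity
  · refine (norm_nonHolTerm_le s b n τ.im_pos).trans ?_
    refine (mul_le_of_le_one_left (Real.exp_pos _).le (hb n)).trans ?_
    rw [← Real.exp_add, ← Real.exp_add, Real.exp_le_exp, coe_im]
    have h1 : κ ^ 2 ≤ ((n : ℝ) + s) ^ 2 := by
      rw [← sq_abs ((n : ℝ) + s)]
      exact pow_le_pow_left₀ hκ.le (hle n h0) 2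
    have h2 := mul_nonneg (mul_nonneg Real.pi_pos.le (sub_nonneg.mpr h1)) (sub_nonneg.mpr hτ)
    linarith [h2]

/-- The unimodular coefficients of the non-holomorphic series at a torsion point. -/
def torsionCoeff (w : ℚ) (n : ℤ) : ℂ := cexp (-(2 * π * 𝕚 * (n + 1 / 2) * w) + π * 𝕚 * n)

theorem norm_torsionCoeff (w : ℚ) (n : ℤ) : ‖torsionCoeff w n‖ = 1 := by
  have : -(2 * π * 𝕚 * ((n : ℂ) + 1 / 2) * w) + π * 𝕚 * n
      = ((-(2 * π * ((n : ℝ) + 1 / 2) * w) + π * n : ℝ) : ℂ) * 𝕚 := by push_cast; ring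
  rw [torsionCoeff, this, Complex.norm_exp_ofReal_mul_I]

/-- The Gaussian factor completes the square, and the frequencies become λ = ν + w₁. The sign is
still that of ν, so this is not yet `nonHol`. -/
theorem exp_mul_zR_torsionPt (w : ℚ × ℚ) {z : ℂ} (hz : 0 < z.im) :
    cexp (-(π * 𝕚 * (w.1 : ℂ) ^ 2 * z)) * zR (torsionPt w z) z
      = ∑' n : ℤ, torsionCoeff w.2 n * ((Real.sign ((n : ℝ) + 1 / 2)
          - errE ((n + (1 / 2 + w.1 : ℚ)) * √(2 * z.im)) : ℝ) : ℂ)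
        * cexp (-π * 𝕚 * (n + ((1 / 2 + w.1 : ℚ) : ℝ)) ^ 2 * z) := by
  rw [zR, ← tsum_mul_left]
  refine tsum_congr fun n => ?_
  have h1 : rCoeff n (torsionPt w z).im z.im = Real.sign ((n : ℝ) + 1 / 2)
      - errE ((n + (1 / 2 + w.1 : ℚ)) * √(2 * z.im)) := by
    rw [rCoeff, im_torsionPt, mul_div_cancel_right₀ _ hz.ne']
    push_cast
    rw [add_assoc]
  have h2 : cexp (-(π * 𝕚 * (w.1 : ℂ) ^ 2 * z)) * rExp n (torsionPt w z) z
      = torsionCoeff w.2 n * cexp (-π * 𝕚 * (n + ((1 / 2 + w.1 : ℚ) : ℝ)) ^ 2 * z) := by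
    rw [rExp, torsionCoeff, ← Complex.exp_add, ← Complex.exp_add, torsionPt]
    congr 1
    push_cast
    ring
  rw [h1, mul_left_comm, h2]
  ring

theorem torsionMu_eq (p r : ℚ × ℚ) (τ : ℍ) : torsionMu p r τ = torsionHol p r τ
    + 𝕚 / 2 * (cexp (-(π * 𝕚 * ((p - r).1 : ℂ) ^ 2 * τ)) * zR (torsionPt (p - r) τ) τ) := by
  have h : torsionPt p τ - torsionPt r τ = torsionPt (p - r) τ := by
    simp only [torsionPt, Prod.fst_sub, Prod.snd_sub]
    push_cast
    ring
  rw [torsionMu, torsionHol, muC, h, Prod.fst_sub]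
  push_cast
  ring

theorem exp_neg_sq_eq_qpow (s : ℚ) (n : ℤ) (τ : ℍ) :
    cexp (-π * 𝕚 * (n + (s : ℝ)) ^ 2 * τ) = qpow (-((n + s) ^ 2 / 2)) τ := by
  rw [qpow]
  congr 1
  push_cast
  ring

theorem sign_eq_of_lt_abs {s : ℝ} {n : ℤ} (h : |s| + 1 < |(n : ℝ)|) :
    Real.sign ((n : ℝ) + 1 / 2) = Real.sign (n + s) := by
  have hs := abs_le.mp (le_refl |s|)
  have h0 := abs_nonneg s
  rcases lt_abs.mp h with h1 | h1
  · rw [Real.sign_of_pos (by linarith), Real.sign_of_pos (by linarith [hs.1])]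
  · rw [Real.sign_of_neg (by linarith), Real.sign_of_neg (by linarith [hs.2])]

/-- The signs of ν and λ differ for finitely many n only. Exchanging them costs a finite sum of
terms q^(-λ²/2) with λ²/2 ≥ 0, admissible in `PolyGrowth`, and leaves the decaying `nonHol`. -/
theorem torsionMu_polyGrowth {p r : ℚ × ℚ} (hp : NonIntegral p) (hr : NonIntegral r) :
    PolyGrowth (torsionMu p r) := by
  set w := p - r
  set s : ℚ := 1 / 2 + w.1
  set b := torsionCoeff w.2
  have hb : ∀ n, ‖b n‖ ≤ 1 := fun n => (norm_torsionCoeff _ n).le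
  obtain ⟨K, hK⟩ := exists_nat_ge (|(s : ℝ)| + 1)
  set S : Finset ℤ := Finset.Icc (-(K : ℤ)) K
  have hS : ∀ n ∉ S, Real.sign ((n : ℝ) + 1 / 2) = Real.sign (n + s) := by
    intro n hn
    refine sign_eq_of_lt_abs (hK.trans_lt ?_)
    have : (K : ℤ) < |n| := by
      by_contra hle
      exact hn (Finset.mem_Icc.mpr (abs_le.mp (not_lt.mp hle)))
    exact_mod_cast this
  have hdecomp : ∀ τ : ℍ, torsionMu p r τ = torsionHol p r τ + (𝕚 / 2 * (∑ n ∈ S,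
      (b n * ((Real.sign ((n : ℝ) + 1 / 2) - Real.sign (n + s) : ℝ) : ℂ))
        * qpow (-((n + s) ^ 2 / 2)) τ) + 𝕚 / 2 * nonHol s b τ) := by
    intro τ
    rw [torsionMu_eq, exp_mul_zR_torsionPt _ τ.im_pos, ← mul_add]
    congr 2
    have h1 : HasSum (fun n : ℤ => (b n * ((Real.sign ((n : ℝ) + 1 / 2)
        - Real.sign (n + s) : ℝ) : ℂ)) * qpow (-((n + s) ^ 2 / 2)) τ) _ :=
      hasSum_sum_of_ne_finset_zero (s := S) fun n hn => by
        rw [hS n hn, sub_self, Complex.ofReal_zero, mul_zero, zero_mul]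
    have h2 := (summable_nonHolTerm s hb τ.im_pos).hasSum
    refine ((h1.add h2).congr_fun fun n => ?_).tsum_eq
    rw [nonHolTerm, ← exp_neg_sq_eq_qpow]
    change b n * ((Real.sign ((n : ℝ) + 1 / 2) - errE ((n + s) * √(2 * (τ : ℂ).im)) : ℝ) : ℂ)
      * cexp (-π * 𝕚 * (n + (s : ℝ)) ^ 2 * τ) = _
    rw [Complex.ofReal_sub, Complex.ofReal_sub, Complex.ofReal_sub]
    ring
  obtain ⟨ε, hε, hO⟩ := nonHol_isBigO s hb
  have hfun : torsionMu p r = fun τ => _ := funext hdecomp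
  rw [hfun]
  refine (torsionHol_polyGrowth hp hr).add (PolyGrowth.add (PolyGrowth.const_mul
    (PolyGrowth.sum S fun n _ => PolyGrowth.const_mul (PolyGrowth.qpow_neg (by positivity)) _) _)
    (PolyGrowth.const_mul (.of_isBigO hε hO) _))

/-- Adding to n a number in (0, 1) always gives the sign of n + 1/2, so no correction terms occur.
In the application that number is A/C. -/
theorem torsionMu_eq_of_sign {p r : ℚ × ℚ} (h0 : 0 < 1 / 2 + (p - r).1) (h1 : 1 / 2 + (p - r).1 < 1)
    (τ : ℍ) : torsionMu p r τ = torsionHol p r τ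
      + 𝕚 / 2 * nonHol ((1 / 2 + (p - r).1 : ℚ) : ℝ) (torsionCoeff (p - r).2) τ := by
  rw [torsionMu_eq, exp_mul_zR_torsionPt _ τ.im_pos, nonHol]
  congr 2
  refine tsum_congr fun n => ?_
  have hs0 : (0 : ℝ) < ((1 / 2 + (p - r).1 : ℚ) : ℝ) := by exact_mod_cast h0
  have hs1 : ((1 / 2 + (p - r).1 : ℚ) : ℝ) < 1 := by exact_mod_cast h1
  have : Real.sign ((n : ℝ) + 1 / 2) = Real.sign (n + ((1 / 2 + (p - r).1 : ℚ) : ℝ)) := by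
    rcases le_or_gt 0 n with hn | hn
    · have : (0 : ℝ) ≤ n := by exact_mod_cast hn
      rw [Real.sign_of_pos (by linarith), Real.sign_of_pos (by linarith)]
    · have : (n : ℝ) ≤ -1 := by exact_mod_cast Int.le_sub_one_of_lt hn
      rw [Real.sign_of_neg (by linarith), Real.sign_of_neg (by linarith)]
  rw [nonHolTerm, this]

/-! ### Smoothness of the non-holomorphic series -/

/-- Coefficient sequences that are summable against every Gaussian in `n + s`. -/
def Tame (s : ℝ) (b : ℤ → ℂ) : Prop :=
  ∀ δ : ℝ, 0 < δ → Summable fun n : ℤ => ‖b n‖ * Real.exp (-π * (n + s) ^ 2 * δ)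

theorem Tame.of_norm_le_one (s : ℝ) {b : ℤ → ℂ} (hb : ∀ n, ‖b n‖ ≤ 1) : Tame s b := by
  intro δ hδ
  refine Summable.of_nonneg_of_le (fun n => by positivity) (fun n => ?_) (summable_gaussian 0 s hδ)
  refine (mul_le_of_le_one_left (Real.exp_pos _).le (hb n)).trans (le_of_eq ?_)
  congr 1
  ring

/-- Half of the Gaussian absorbs the quadratic factor, so the class is stable under the coefficient
changes caused by differentiation. -/
theorem Tame.of_norm_le {s : ℝ} {b c : ℤ → ℂ} (hb : Tame s b) {K : ℝ}
    (h : ∀ n, ‖c n‖ ≤ K * (1 + ((n : ℝ) + s) ^ 2) * ‖b n‖) : Tame s c := by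
  intro δ hδ
  have h1 := (hb (δ / 2) (half_pos hδ)).mul_left (|K| * (1 + 2 / (π * δ)))
  refine Summable.of_nonneg_of_le (fun n => by positivity) (fun n => ?_) h1
  set x := ((n : ℝ) + s) ^ 2
  have hx : 0 ≤ x := sq_nonneg _
  have hsplit : Real.exp (-π * x * δ) = Real.exp (-π * x * (δ / 2)) * Real.exp (-π * x * (δ / 2)) := by
    rw [← Real.exp_add]; congr 1; ring
  have hexp : (1 + x) * Real.exp (-π * x * (δ / 2)) ≤ 1 + 2 / (π * δ) := by
    have h2 : Real.exp (-π * x * (δ / 2)) ≤ 1 := Real.exp_le_one_iff.mpr (by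
      have : 0 ≤ π * x * (δ / 2) := by positivity
      linarith)
    have h3 : x * Real.exp (-π * x * (δ / 2)) ≤ 2 / (π * δ) := by
      have h4 : π * x * (δ / 2) * Real.exp (-(π * x * (δ / 2))) ≤ 1 := by
        rw [Real.exp_neg, ← div_eq_mul_inv, div_le_one (Real.exp_pos _)]
        linarith [Real.add_one_le_exp (π * x * (δ / 2))]
      rw [le_div_iff₀ (by positivity)]
      rw [show -(π * x * (δ / 2)) = -π * x * (δ / 2) by ring] at h4
      linarith
    linarith
  calc ‖c n‖ * Real.exp (-π * x * δ)
      ≤ (|K| * (1 + x) * ‖b n‖) * Real.exp (-π * x * δ) := by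
        refine mul_le_mul_of_nonneg_right ((h n).trans ?_) (Real.exp_pos _).le
        gcongr
        exact le_abs_self K
    _ = |K| * ((1 + x) * Real.exp (-π * x * (δ / 2))) * (‖b n‖ * Real.exp (-π * x * (δ / 2))) := by
        rw [hsplit]; ring
    _ ≤ |K| * (1 + 2 / (π * δ)) * (‖b n‖ * Real.exp (-π * x * (δ / 2))) := by gcongr

theorem norm_int_add (n : ℤ) (s : ℝ) : ‖(n : ℂ) + s‖ = |(n : ℝ) + s| := by
  rw [← Real.norm_eq_abs, ← Complex.norm_real]; push_cast; rfl

theorem Tame.mul_sq {s : ℝ} {b : ℤ → ℂ} (hb : Tame s b) (a : ℂ) :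
    Tame s fun n => a * (n + s) ^ 2 * b n := by
  refine hb.of_norm_le (K := ‖a‖) fun n => ?_
  rw [norm_mul, norm_mul, norm_pow, norm_int_add, sq_abs]
  gcongr
  linarith

theorem Tame.conj_mul {s : ℝ} {b : ℤ → ℂ} (hb : Tame s b) : Tame s fun n => conj (b n) * (n + s) := by
  refine hb.of_norm_le (K := 1) fun n => ?_
  rw [norm_mul, Complex.norm_conj, norm_int_add, mul_comm, one_mul]
  gcongr
  nlinarith [sq_abs ((n : ℝ) + s), sq_nonneg (|(n : ℝ) + s| - 1)]

/-- The theta series `∑ c(n) exp (π i (n + s)² z)`. -/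
def thetaSeries (s : ℝ) (c : ℤ → ℂ) (z : ℂ) : ℂ := ∑' n : ℤ, c n * cexp (π * 𝕚 * (n + s) ^ 2 * z)

theorem norm_exp_sq (s : ℝ) (n : ℤ) (z : ℂ) :
    ‖cexp (π * 𝕚 * (n + s) ^ 2 * z)‖ = Real.exp (-π * (n + s) ^ 2 * z.im) := by
  rw [Complex.norm_exp]
  congr 1
  have : π * 𝕚 * ((n : ℂ) + s) ^ 2 * z = ((π * ((n : ℝ) + s) ^ 2 : ℝ) : ℂ) * (𝕚 * z) := by
    push_cast; ring
  rw [this, Complex.re_ofReal_mul, Complex.I_mul_re]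
  ring

theorem gaussian_anti (x : ℝ) {δ y : ℝ} (h : δ ≤ y) :
    Real.exp (-π * x ^ 2 * y) ≤ Real.exp (-π * x ^ 2 * δ) := by
  rw [Real.exp_le_exp]
  have := mul_le_mul_of_nonneg_left h (mul_nonneg Real.pi_pos.le (sq_nonneg x))
  linarith

theorem Tame.summable_thetaSeries {s : ℝ} {c : ℤ → ℂ} (hc : Tame s c) {z : ℂ} (hz : 0 < z.im) :
    Summable fun n : ℤ => c n * cexp (π * 𝕚 * (n + s) ^ 2 * z) := by
  refine Summable.of_norm_bounded (hc z.im hz) fun n => ?_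
  rw [norm_mul, norm_exp_sq]

theorem isOpen_im_gt (δ : ℝ) : IsOpen {z : ℂ | δ < z.im} :=
  isOpen_lt continuous_const Complex.continuous_im

theorem isPreconnected_im_gt (δ : ℝ) : IsPreconnected {z : ℂ | δ < z.im} :=
  (convex_halfSpace_im_gt δ).isPreconnected

theorem Tame.hasDerivAt_thetaSeries {s : ℝ} {c : ℤ → ℂ} (hc : Tame s c) {z : ℂ} (hz : 0 < z.im) :
    HasDerivAt (thetaSeries s c) (thetaSeries s (fun n => π * 𝕚 * (n + s) ^ 2 * c n) z) z := by
  have hc' := hc.mul_sq (π * 𝕚)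
  have hmem : z ∈ {w : ℂ | z.im / 2 < w.im} := by simp only [mem_ofPred_eq]; linarith
  have h := hasDerivAt_tsum_of_isPreconnected (hc' (z.im / 2) (half_pos hz)) (isOpen_im_gt (z.im / 2))
    (isPreconnected_im_gt _) (g := fun (n : ℤ) z => c n * cexp (π * 𝕚 * (n + s) ^ 2 * z))
    (g' := fun (n : ℤ) z => π * 𝕚 * (n + s) ^ 2 * c n * cexp (π * 𝕚 * (n + s) ^ 2 * z))
    (fun n w _ => ?_) (fun n w hw => ?_) hmem (hc.summable_thetaSeries hz) hmem
  · exact h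
  · have h1 := (((hasDerivAt_id' w).const_mul (π * 𝕚 * ((n : ℂ) + s) ^ 2)).cexp).const_mul (c n)
    exact h1.congr_deriv (by ring)
  · rw [norm_mul, norm_exp_sq]
    exact mul_le_mul_of_nonneg_left (gaussian_anti _ (le_of_lt hw)) (norm_nonneg _)

theorem Tame.contDiffOn_thetaSeries {s : ℝ} {c : ℤ → ℂ} (hc : Tame s c) {k : ℕ∞} :
    ContDiffOn ℝ k (thetaSeries s c) {z : ℂ | 0 < z.im} := by
  have h : DifferentiableOn ℂ (thetaSeries s c) {z : ℂ | 0 < z.im} := fun z hz =>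
    (hc.hasDerivAt_thetaSeries hz).differentiableAt.differentiableWithinAt
  exact (h.contDiffOn (isOpen_im_gt 0)).restrict_scalars ℝ

/-- The coefficient of `d(Im z)` in the differential of the non-holomorphic series. -/
def nonHolIm (s : ℝ) (b : ℤ → ℂ) (z : ℂ) : ℂ :=
  -((√2 / √z.im : ℝ) : ℂ) * conj (thetaSeries s (fun n => conj (b n) * (n + s)) z)

theorem hasDerivAt_errE_sqrt (x : ℝ) {y : ℝ} (hy : 0 < y) :
    HasDerivAt (fun y => errE (x * √(2 * y))) (√2 / √y * x * Real.exp (-2 * π * x ^ 2 * y)) y := by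
  have h2 : HasDerivAt (fun y : ℝ => √(2 * y)) (1 / (2 * √(2 * y)) * (2 * 1)) y :=
    (Real.hasDerivAt_sqrt (by positivity)).comp y ((hasDerivAt_id' y).const_mul 2)
  have h3 := (hasDerivAt_errE (x * √(2 * y))).comp y (h2.const_mul x)
  refine h3.congr_deriv ?_
  rw [mul_pow, Real.sq_sqrt (by positivity), Real.sqrt_mul zero_le_two,
    show -π * (x ^ 2 * (2 * y)) = -2 * π * x ^ 2 * y by ring]
  have hy' : √y ≠ 0 := (Real.sqrt_pos.mpr hy).ne'
  have h2' : √2 ≠ 0 := by positivity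
  generalize Real.exp (-2 * π * x ^ 2 * y) = E
  field_simp
  rw [Real.sq_sqrt zero_le_two]
  ring

/-- The terms of `nonHolIm`. -/
def nonHolImTerm (s : ℝ) (b : ℤ → ℂ) (n : ℤ) (z : ℂ) : ℂ :=
  -((√2 / √z.im : ℝ) : ℂ) * conj (conj (b n) * (n + s) * cexp (π * 𝕚 * (n + s) ^ 2 * z))

/-- Since conj z = z - 2iy, the Gaussian from the derivative of E converts the growing exponential
into a conjugated theta term. -/
theorem gaussian_mul_exp_eq_conj (s : ℝ) (n : ℤ) (z : ℂ) :
    (Real.exp (-2 * π * (n + s) ^ 2 * z.im) : ℂ) * cexp (-π * 𝕚 * (n + s) ^ 2 * z)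
      = conj (cexp (π * 𝕚 * (n + s) ^ 2 * z)) := by
  rw [← Complex.exp_conj, Complex.ofReal_exp, ← Complex.exp_add]
  congr 1
  simp only [map_mul, map_pow, map_add, Complex.conj_I, Complex.conj_ofReal, map_intCast]
  rw [conj_eq_sub_im]
  push_cast
  linear_combination (-2 * π * ((n : ℂ) + s) ^ 2 * z.im) * Complex.I_sq

theorem hasFDerivAt_nonHolTerm (s : ℝ) (b : ℤ → ℂ) (n : ℤ) {z : ℂ} (hz : 0 < z.im) :
    HasFDerivAt (nonHolTerm s b n)
      (nonHolTerm s (fun n => -π * 𝕚 * (n + s) ^ 2 * b n) n z • ContinuousLinearMap.id ℝ ℂ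
        + nonHolImTerm s b n z • imC) z := by
  have h1 : HasFDerivAt (fun z : ℂ =>
      ((Real.sign (n + s) - errE ((n + s) * √(2 * z.im)) : ℝ) : ℂ)) _ z :=
    Complex.ofRealCLM.hasFDerivAt.comp z
      ((((hasDerivAt_errE_sqrt (n + s) hz).const_sub (Real.sign (n + s))).hasFDerivAt).comp z
        Complex.imCLM.hasFDerivAt)
  have h2 : HasDerivAt (fun z : ℂ => cexp (-π * 𝕚 * (n + s) ^ 2 * z)) _ z :=
    ((hasDerivAt_id' z).const_mul (-π * 𝕚 * ((n : ℂ) + s) ^ 2)).cexp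
  have h3 := ((h1.const_mul (b n)).mul (h2.hasFDerivAt.restrictScalars ℝ))
  refine HasFDerivAt.congr_fderiv (f := nonHolTerm s b n) h3 ?_
  ext w
  have hE := gaussian_mul_exp_eq_conj s n z
  simp only [nonHolImTerm, nonHolTerm, map_mul, map_add, Complex.conj_ofReal, map_intCast,
    Complex.conj_conj, ← hE]
  simp [imC]
  ring

theorem Tame.summable_nonHolTerm {s : ℝ} {b : ℤ → ℂ} (hb : Tame s b) {z : ℂ} (hz : 0 < z.im) :
    Summable fun n => nonHolTerm s b n z :=
  Summable.of_norm_bounded (hb z.im hz) fun n => norm_nonHolTerm_le s b n hz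

theorem Tame.hasSum_nonHolImTerm {s : ℝ} {b : ℤ → ℂ} (hb : Tame s b) {z : ℂ} (hz : 0 < z.im) :
    HasSum (fun n => nonHolImTerm s b n z) (nonHolIm s b z) := by
  have h := (Complex.hasSum_conj'.mpr
    (hb.conj_mul.summable_thetaSeries hz).hasSum).mul_left (-((√2 / √z.im : ℝ) : ℂ))
  exact h

/-- The dz coefficient is again a `nonHol` with tame coefficients, so this one formula yields both
smoothness and the second derivatives. -/
theorem Tame.hasFDerivAt_nonHol {s : ℝ} {b : ℤ → ℂ} (hb : Tame s b) {z : ℂ} (hz : 0 < z.im) :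
    HasFDerivAt (nonHol s b)
      (nonHol s (fun n => -π * 𝕚 * (n + s) ^ 2 * b n) z • ContinuousLinearMap.id ℝ ℂ
        + nonHolIm s b z • imC) z := by
  set δ := z.im / 2
  have hδ : 0 < δ := half_pos hz
  have hmem : z ∈ {w : ℂ | δ < w.im} := by simp only [mem_ofPred_eq, δ]; linarith
  have hb' := hb.mul_sq (-π * 𝕚)
  have hbound := (hb' δ hδ).add ((hb.conj_mul δ hδ).mul_left (√2 / √δ))
  have hder := hasFDerivAt_tsum_of_isPreconnected hbound (isOpen_im_gt δ) (isPreconnected_im_gt δ)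
    (fun n w hw => hasFDerivAt_nonHolTerm s b n (hδ.trans hw)) (fun n w hw => ?_) hmem
    (hb.summable_nonHolTerm hz) hmem
  · have h1 := hb'.summable_nonHolTerm hz
    have h2 := hb.hasSum_nonHolImTerm hz
    rw [Summable.tsum_add (h1.smul_const _) (h2.summable.smul_const _), h1.tsum_smul_const,
      h2.summable.tsum_smul_const, h2.tsum_eq] at hder
    exact hder
  · have hw0 : 0 < w.im := hδ.trans hw
    refine (norm_add_le _ _).trans (add_le_add ?_ ?_)
    · rw [norm_smul]
      refine (mul_le_of_le_one_right (norm_nonneg _) ContinuousLinearMap.norm_id_le).trans ?_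
      refine (norm_nonHolTerm_le _ _ _ hw0).trans ?_
      exact mul_le_mul_of_nonneg_left (gaussian_anti _ (le_of_lt hw)) (norm_nonneg _)
    · rw [norm_smul]
      refine (mul_le_of_le_one_right (norm_nonneg _) norm_imC_le).trans ?_
      rw [nonHolImTerm, norm_mul, norm_neg, Complex.norm_real, Complex.norm_conj, norm_mul,
        norm_exp_sq, Real.norm_eq_abs, abs_of_nonneg (by positivity)]
      have h1 : √2 / √w.im ≤ √2 / √δ := by
        have : √δ ≤ √w.im := Real.sqrt_le_sqrt (le_of_lt hw)
        have h0 : 0 < √δ := Real.sqrt_pos.mpr hδ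
        gcongr
      have h2 := mul_le_mul_of_nonneg_left (gaussian_anti ((n : ℝ) + s) (le_of_lt hw))
        (norm_nonneg (conj (b n) * ((n : ℂ) + s)))
      exact mul_le_mul h1 h2 (by positivity) (by positivity)

theorem Tame.contDiffOn_nonHolIm {s : ℝ} {b : ℤ → ℂ} (hb : Tame s b) {k : ℕ∞} :
    ContDiffOn ℝ k (nonHolIm s b) {z : ℂ | 0 < z.im} := by
  have h1 : ContDiffOn ℝ k (fun z : ℂ => conj (thetaSeries s (fun n => conj (b n) * (n + s)) z))
      {z : ℂ | 0 < z.im} :=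
    (Complex.conjCLE : ℂ →L[ℝ] ℂ).contDiff.comp_contDiffOn hb.conj_mul.contDiffOn_thetaSeries
  have h2 : ContDiffOn ℝ k (fun z : ℂ => √2 / √z.im) {z : ℂ | 0 < z.im} := by
    intro z hz
    have hz' : z.im ≠ 0 := (show 0 < z.im from hz).ne'
    have h3 : ContDiffAt ℝ k (fun z : ℂ => √z.im) z :=
      ContDiffAt.sqrt Complex.imCLM.contDiff.contDiffAt hz'
    exact (ContDiffAt.fun_div contDiffAt_const h3 (Real.sqrt_pos.mpr hz).ne').contDiffWithinAt
  exact ((Complex.ofRealCLM.contDiff.comp_contDiffOn h2).neg).mul h1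

/-- The induction runs over all `b` at once, because the derivative involves `nonHol` with altered
coefficients. -/
theorem Tame.contDiffOn_nonHol_nat {s : ℝ} (k : ℕ) : ∀ {b : ℤ → ℂ}, Tame s b →
    ContDiffOn ℝ k (nonHol s b) {z : ℂ | 0 < z.im} := by
  induction k with
  | zero =>
    intro b hb
    exact contDiffOn_zero.mpr fun z hz =>
      (hb.hasFDerivAt_nonHol hz).continuousAt.continuousWithinAt
  | succ k ih =>
    intro b hb
    rw [Nat.cast_add, Nat.cast_one, contDiffOn_succ_iff_fderiv_of_isOpen (isOpen_im_gt 0)]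
    refine ⟨fun z hz => (hb.hasFDerivAt_nonHol hz).differentiableAt.differentiableWithinAt,
      by simp, ?_⟩
    have h1 : ContDiffOn ℝ k (fun z => nonHol s (fun n => -π * 𝕚 * (n + s) ^ 2 * b n) z
        • ContinuousLinearMap.id ℝ ℂ + nonHolIm s b z • imC) {z : ℂ | 0 < z.im} :=
      ((ih (hb.mul_sq (-π * 𝕚))).smul contDiffOn_const).add
        ((hb.contDiffOn_nonHolIm (k := k)).smul contDiffOn_const)
    exact h1.congr fun z hz => (hb.hasFDerivAt_nonHol hz).fderiv

theorem Tame.contDiffOn_nonHol {s : ℝ} {b : ℤ → ℂ} (hb : Tame s b) :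
    ContDiffOn ℝ ∞ (nonHol s b) {z : ℂ | 0 < z.im} :=
  contDiffOn_infty.mpr fun k => hb.contDiffOn_nonHol_nat k

theorem Tame.hasDerivAt_nonHolIm {s : ℝ} {b : ℤ → ℂ} (hb : Tame s b) (x : ℝ) {y : ℝ} (hy : 0 < y) :
    HasDerivAt (fun y : ℝ => nonHolIm s b (x + y * 𝕚))
      (-nonHolIm s b (x + y * 𝕚) / (2 * y)
        - 𝕚 * nonHolIm s (fun n => -π * 𝕚 * (n + s) ^ 2 * b n) (x + y * 𝕚)) y := by
  have him : ∀ y : ℝ, ((x : ℂ) + y * 𝕚).im = y := fun y => by simp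
  have hz : 0 < ((x : ℂ) + y * 𝕚).im := by rw [him]; exact hy
  have hline : HasDerivAt (fun y : ℝ => (x : ℂ) + y * 𝕚) 𝕚 y :=
    (((hasDerivAt_id' y).ofReal_comp.mul_const 𝕚).const_add _).congr_deriv (by simp)
  have h1 := ((hb.conj_mul.hasDerivAt_thetaSeries hz).comp y hline)
  have h2 : HasDerivAt (fun y : ℝ => conj (thetaSeries s (fun n => conj (b n) * (n + s))
      (x + y * 𝕚))) _ y := (Complex.conjCLE : ℂ →L[ℝ] ℂ).hasFDerivAt.comp_hasDerivAt y h1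
  have h3 : HasDerivAt (fun y : ℝ => √2 / √y) (-(√2 / √y) / (2 * y)) y := by
    have hs : √y ≠ 0 := (Real.sqrt_pos.mpr hy).ne'
    have := ((Real.hasDerivAt_sqrt hy.ne').inv hs).const_mul √2
    refine this.congr_deriv ?_
    have hyy : y = √y ^ 2 := (Real.sq_sqrt hy.le).symm
    set t := √y
    rw [hyy]
    field_simp
  have h4 := (h3.ofReal_comp.neg).mul h2
  have h5 : HasDerivAt (fun y : ℝ => nonHolIm s b (x + y * 𝕚)) _ y :=
    h4.congr_of_eventuallyEq (Eventually.of_forall fun y => by simp only [nonHolIm, him]; rfl)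
  refine h5.congr_deriv ?_
  -- Conjugation turns -πi into πi, which matches the derivative of the holomorphic theta series.
  have h6 : thetaSeries s (fun n => conj (-π * 𝕚 * (n + s) ^ 2 * b n) * (n + s)) (x + y * 𝕚)
      = thetaSeries s (fun n => π * 𝕚 * (n + s) ^ 2 * (conj (b n) * (n + s))) (x + y * 𝕚) := by
    congr 1
    funext n
    simp only [map_mul, map_pow, map_add, map_neg, Complex.conj_I, Complex.conj_ofReal, map_intCast]
    ring
  simp only [nonHolIm, him, h6]
  simp
  ring

/-! ### The weight one half Laplacian -/

/-- A function is annihilated by the Laplacian of weight `1/2` if its antiholomorphic derivative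
is `y^(-1/2)` times an antiholomorphic function. -/
theorem laplacian_eq_zero {F : ℍ → ℂ} {f f₁ f₂ h h₁ : ℂ → ℂ}
    (hF : ∀ τ : ℍ, F τ = f τ)
    (hf : ∀ z : ℂ, 0 < z.im → HasFDerivAt f (f₁ z • ContinuousLinearMap.id ℝ ℂ + h z • imC) z)
    (hf₁ : ∀ z : ℂ, 0 < z.im → HasFDerivAt f₁ (f₂ z • ContinuousLinearMap.id ℝ ℂ + h₁ z • imC) z)
    (hh : ∀ x y : ℝ, 0 < y → HasDerivAt (fun y : ℝ => h (x + y * 𝕚))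
      (-h (x + y * 𝕚) / (2 * y) - 𝕚 * h₁ (x + y * 𝕚)) y) (τ : ℍ) :
    laplacian (1 / 2) F τ = 0 := by
  have him : ∀ x y : ℝ, ((x : ℂ) + y * 𝕚).im = y := fun x y => by simp
  have hcoord : ∀ x y : ℝ, 0 < y → coord F x y = f (x + y * 𝕚) := by
    intro x y hy
    rw [coord, ofComplex_apply_of_im_pos (by rwa [him]), hF]
  have hlx : ∀ x y : ℝ, HasDerivAt (fun x : ℝ => (x : ℂ) + y * 𝕚) 1 x := fun x y =>
    ((hasDerivAt_id' x).ofReal_comp.add_const _).congr_deriv (by simp)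
  have hly : ∀ x y : ℝ, HasDerivAt (fun y : ℝ => (x : ℂ) + y * 𝕚) 𝕚 y := fun x y =>
    (((hasDerivAt_id' y).ofReal_comp.mul_const 𝕚).const_add _).congr_deriv (by simp)
  have hx : ∀ {g g₁ k : ℂ → ℂ}, (∀ z : ℂ, 0 < z.im →
      HasFDerivAt g (g₁ z • ContinuousLinearMap.id ℝ ℂ + k z • imC) z) → ∀ x y : ℝ, 0 < y →
      HasDerivAt (fun x : ℝ => g (x + y * 𝕚)) (g₁ (x + y * 𝕚)) x := by
    intro g g₁ k hg x y hy
    exact ((hg _ (by rwa [him])).comp_hasDerivAt x (hlx x y)).congr_deriv (by simp [imC])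
  have hy : ∀ {g g₁ k : ℂ → ℂ}, (∀ z : ℂ, 0 < z.im →
      HasFDerivAt g (g₁ z • ContinuousLinearMap.id ℝ ℂ + k z • imC) z) → ∀ x y : ℝ, 0 < y →
      HasDerivAt (fun y : ℝ => g (x + y * 𝕚)) (𝕚 * g₁ (x + y * 𝕚) + k (x + y * 𝕚)) y := by
    intro g g₁ k hg x y hy
    exact ((hg _ (by rwa [him])).comp_hasDerivAt y (hly x y)).congr_deriv (by
      simp [imC]; ring)
  obtain ⟨x₀, hx₀⟩ : ∃ x : ℝ, x = τ.re := ⟨_, rfl⟩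
  obtain ⟨y₀, hy₀⟩ : ∃ y : ℝ, y = τ.im := ⟨_, rfl⟩
  have hpos : 0 < y₀ := hy₀ ▸ τ.im_pos
  rw [laplacian, ← hx₀, ← hy₀]
  have ex : ∀ x : ℝ, deriv (fun x' => coord F x' y₀) x = f₁ (x + y₀ * 𝕚) := by
    intro x
    simp only [hcoord _ _ hpos]
    exact (hx hf x y₀ hpos).deriv
  have ey : ∀ y : ℝ, 0 < y → deriv (fun y' => coord F x₀ y') y
      = 𝕚 * f₁ (x₀ + y * 𝕚) + h (x₀ + y * 𝕚) := by
    intro y hy'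
    refine (HasDerivAt.congr_of_eventuallyEq (hy hf x₀ y hy') ?_).deriv
    filter_upwards [lt_mem_nhds hy'] with t ht using hcoord _ _ ht
  have exx : deriv (fun x => deriv (fun x' => coord F x' y₀) x) x₀ = f₂ (x₀ + y₀ * 𝕚) := by
    simp only [ex]
    exact (hx hf₁ x₀ y₀ hpos).deriv
  have eyy : deriv (fun y => deriv (fun y' => coord F x₀ y') y) y₀
      = 𝕚 * (𝕚 * f₂ (x₀ + y₀ * 𝕚) + h₁ (x₀ + y₀ * 𝕚))
        + (-h (x₀ + y₀ * 𝕚) / (2 * y₀) - 𝕚 * h₁ (x₀ + y₀ * 𝕚)) := by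
    refine (HasDerivAt.congr_of_eventuallyEq
      (((hy hf₁ x₀ y₀ hpos).const_mul 𝕚).add (hh x₀ y₀ hpos)) ?_).deriv
    filter_upwards [lt_mem_nhds hpos] with t ht using ey t ht
  -- The second derivatives add up to -h/(2y), and ∂ₓ + i∂ᵧ gives ih; with k = 1/2 the two
  -- contributions are yh/2 and -yh/2.
  rw [exx, eyy, ex, ey _ hpos]
  have hne : (y₀ : ℂ) ≠ 0 := by exact_mod_cast hpos.ne'
  have hI := Complex.I_sq
  have hI3 : 𝕚 ^ 3 = -𝕚 := Complex.I_pow_three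
  push_cast
  field_simp
  ring_nf
  simp only [hI, hI3]
  ring

/-! ### The Fourier expansion of the non-holomorphic part -/

/-- The substitution w = πt² turns w^(-1/2) dw into 2√π dt. -/
theorem upperGamma_half {x : ℝ} (hx : 0 < x) :
    upperGamma (1 / 2) (π * x ^ 2) = √π * (1 - errE x) := by
  have himg : (fun t : ℝ => π * t ^ 2) '' Ioi x = Ioi (π * x ^ 2) := by
    ext u
    simp only [mem_image, mem_Ioi]
    constructor
    · rintro ⟨t, ht, rfl⟩
      have := pow_lt_pow_left₀ ht hx.le two_ne_zero
      gcongr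
    · intro hu
      have hu' : x ^ 2 < u / π := by rw [lt_div_iff₀ Real.pi_pos]; linarith
      refine ⟨√(u / π), Real.lt_sqrt_of_sq_lt hu', ?_⟩
      rw [Real.sq_sqrt ((sq_nonneg x).trans hu'.le), mul_div_cancel₀ _ Real.pi_pos.ne']
  have hinj : InjOn (fun t : ℝ => π * t ^ 2) (Ioi x) := by
    intro s hs t ht h
    have h1 : s ^ 2 = t ^ 2 := mul_left_cancel₀ Real.pi_pos.ne' h
    exact (pow_left_inj₀ (hx.trans hs).le (hx.trans ht).le two_ne_zero).mp h1
  rw [upperGamma, ← himg, MeasureTheory.integral_image_eq_integral_abs_deriv_smul measurableSet_Ioi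
    (f' := fun t => 2 * π * t) (fun t _ => ?_) hinj, one_sub_errE, ← mul_assoc,
    ← MeasureTheory.integral_const_mul]
  · refine MeasureTheory.setIntegral_congr_fun measurableSet_Ioi fun t ht => ?_
    have ht0 : 0 < t := hx.trans ht
    have h1 : (π * t ^ 2) ^ (1 / 2 - 1 : ℝ) = (√π * t)⁻¹ := by
      rw [show (1 / 2 - 1 : ℝ) = -(1 / 2) by norm_num, Real.rpow_neg (by positivity),
        ← Real.sqrt_eq_rpow, Real.sqrt_mul Real.pi_pos.le, Real.sqrt_sq ht0.le]
    simp only [smul_eq_mul]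
    rw [abs_of_pos (by positivity), h1, show -(π * t ^ 2) = -π * t ^ 2 by ring]
    have h2 : π = √π ^ 2 := (Real.sq_sqrt Real.pi_pos.le).symm
    have h3 : √π ≠ 0 := (Real.sqrt_pos.mpr Real.pi_pos).ne'
    generalize Real.exp (-π * t ^ 2) = E
    generalize √π = w at h2 h3 ⊢
    rw [h2]
    field_simp
  · exact (((hasDerivAt_pow 2 t).const_mul π).congr_deriv (by push_cast; ring)).hasDerivWithinAt

theorem sign_sub_errE_eq {x : ℝ} (hx : x ≠ 0) (y : ℝ) :
    Real.sign x - errE (x * y) = Real.sign x * (1 - errE (|x| * y)) := by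
  rcases hx.lt_or_gt with h | h
  · rw [Real.sign_of_neg h, abs_of_neg h, show -x * y = -(x * y) by ring, errE_neg]
    ring
  · rw [Real.sign_of_pos h, abs_of_pos h, one_mul]

/-- The exponent of `q^(1/N)`, `N = 64 C²`, in the `n`-th term of the non-holomorphic part. -/
def nonHolIndex (A : ℤ) (C : ℕ) (n : ℤ) : ℤ := -32 * (n * C + A) ^ 2

/-- The Fourier coefficients of the non-holomorphic part. -/
def nonHolCoeff (A : ℤ) (C : ℕ) (b : ℤ → ℂ) (k : ℤ) : ℂ :=
  ∑' n : nonHolIndex A C ⁻¹' {k}, b n * (Real.sign (n * C + A) / √π : ℝ)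

section FourierExpansion

variable {A : ℤ} {C : ℕ}

theorem mul_add_ne_zero (h0 : 0 < A) (h1 : A < C) (n : ℤ) : n * C + A ≠ 0 := by
  intro h
  rcases le_or_gt 0 n with hn | hn
  · have : 0 ≤ n * C := by positivity
    omega
  · nlinarith

/-- With λ = n + A/C and N = 64C², the exponent -λ²/2 is `nonHolIndex`/N, and π(|λ|√(2y))² = 2πλ²y
is the argument of Γ. -/
theorem nonHolTerm_eq_upperGamma (h0 : 0 < A) (h1 : A < C) (b : ℤ → ℂ) (n : ℤ) (τ : ℍ) :
    nonHolTerm ((A / C : ℚ) : ℝ) b n τ = b n * (Real.sign (n * C + A) / √π : ℝ)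
      * ((upperGamma (1 - 1 / 2) (4 * π * |(nonHolIndex A C n : ℝ)| * τ.im
          / ((16 * (2 * C) ^ 2 : ℕ) : ℝ)) : ℂ)
        * qpow ((nonHolIndex A C n : ℚ) / ((16 * (2 * C) ^ 2 : ℕ) : ℚ)) τ) := by
  have hC : 0 < C := by exact_mod_cast h0.trans h1
  have hC' : (0 : ℝ) < C := by exact_mod_cast hC
  have hCq : (C : ℚ) ≠ 0 := by exact_mod_cast hC.ne'
  have hne : (n : ℝ) * C + A ≠ 0 := by exact_mod_cast mul_add_ne_zero h0 h1 n
  have hlam : (n : ℝ) + ((A / C : ℚ) : ℝ) = (n * C + A) / C := by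
    push_cast
    field_simp
  have hlam0 : (n : ℝ) + ((A / C : ℚ) : ℝ) ≠ 0 := by
    rw [hlam]; exact div_ne_zero hne hC'.ne'
  have hsign : Real.sign (n + ((A / C : ℚ) : ℝ)) = Real.sign (n * C + A) := by
    rw [hlam]
    rcases hne.lt_or_gt with h | h
    · rw [Real.sign_of_neg h, Real.sign_of_neg (div_neg_of_neg_of_pos h hC')]
    · rw [Real.sign_of_pos h, Real.sign_of_pos (div_pos h hC')]
  have hx : 0 < |(n : ℝ) + ((A / C : ℚ) : ℝ)| * √(2 * τ.im) :=
    mul_pos (abs_pos.mpr hlam0) (Real.sqrt_pos.mpr (mul_pos two_pos τ.im_pos))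
  have harg : 4 * π * |(nonHolIndex A C n : ℝ)| * τ.im / ((16 * (2 * C) ^ 2 : ℕ) : ℝ)
      = π * (|(n : ℝ) + ((A / C : ℚ) : ℝ)| * √(2 * τ.im)) ^ 2 := by
    rw [mul_pow |_|, sq_abs, Real.sq_sqrt (mul_pos two_pos τ.im_pos).le, hlam, nonHolIndex]
    push_cast
    rw [abs_mul, abs_neg, abs_of_nonneg (show (0 : ℝ) ≤ 32 by norm_num), abs_of_nonneg (sq_nonneg _)]
    field_simp
    ring
  have hq : cexp (-π * 𝕚 * (n + ((A / C : ℚ) : ℝ)) ^ 2 * τ)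
      = qpow ((nonHolIndex A C n : ℚ) / ((16 * (2 * C) ^ 2 : ℕ) : ℚ)) τ := by
    rw [exp_neg_sq_eq_qpow, nonHolIndex]
    congr 1
    push_cast
    field_simp
    ring
  have hπ : √π ≠ 0 := (Real.sqrt_pos.mpr Real.pi_pos).ne'
  rw [nonHolTerm, coe_im, sign_sub_errE_eq hlam0, hq, harg,
    show (1 - 1 / 2 : ℝ) = 1 / 2 by norm_num, upperGamma_half hx, hsign]
  have hπc : ((√π : ℝ) : ℂ) ≠ 0 := by exact_mod_cast hπ
  generalize errE (|(n : ℝ) + ((A / C : ℚ) : ℝ)| * √(2 * τ.im)) = e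
  push_cast
  field_simp

/-- Different frequencies may have equal squares, so the series is summed along the fibres of
`nonHolIndex`. -/
theorem hasSum_nonHolCoeff (h0 : 0 < A) (h1 : A < C) {b : ℤ → ℂ} (hb : ∀ n, ‖b n‖ ≤ 1) (τ : ℍ) :
    HasSum (fun k : ℤ => nonHolCoeff A C b k
      * (upperGamma (1 - 1 / 2) (4 * π * |(k : ℝ)| * τ.im / ((16 * (2 * C) ^ 2 : ℕ) : ℝ)) : ℂ)
      * qpow ((k : ℚ) / ((16 * (2 * C) ^ 2 : ℕ) : ℚ)) τ) (nonHol ((A / C : ℚ) : ℝ) b τ) := by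
  have h := (summable_nonHolTerm ((A / C : ℚ) : ℝ) hb τ.im_pos).hasSum.tsum_fiberwise
    (nonHolIndex A C)
  refine h.congr_fun fun k => ?_
  rw [nonHolCoeff, mul_assoc, ← tsum_mul_right]
  refine tsum_congr fun ⟨n, hn⟩ => ?_
  have hn' : nonHolIndex A C n = k := hn
  subst hn'
  exact (nonHolTerm_eq_upperGamma h0 h1 b n τ).symm

theorem nonHolCoeff_eq_zero (h0 : 0 < A) (h1 : A < C) (b : ℤ → ℂ) {k : ℤ} (hk : 0 ≤ k) :
    nonHolCoeff A C b k = 0 := by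
  have : nonHolIndex A C ⁻¹' {k} = ∅ := by
    ext n
    simp only [mem_preimage, mem_singleton_iff, mem_empty_iff_false, iff_false, nonHolIndex]
    have : 0 < (n * C + A) ^ 2 := by
      have := mul_add_ne_zero h0 h1 n
      positivity
    omega
  have he : IsEmpty (nonHolIndex A C ⁻¹' {k}) := Set.isEmpty_coe_sort.mpr this
  rw [nonHolCoeff, tsum_empty]

/-- A second solution of (nC + A)² = A² has nC = -2A, so C divides 2 by coprimality; C = 1 is
impossible for 0 < A < C. -/
theorem nonHolIndex_fiber (h0 : 0 < A) (h1 : A < C) (hgcd : Int.gcd A C = 1) (hC : C ≠ 2) :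
    nonHolIndex A C ⁻¹' {nonHolIndex A C 0} = (({0} : Finset ℤ) : Set ℤ) := by
  ext n
  simp only [mem_preimage, mem_singleton_iff, nonHolIndex, Finset.coe_singleton]
  constructor
  · intro h
    have h2 : (n * C + A) ^ 2 = A ^ 2 := by linarith
    rcases sq_eq_sq_iff_eq_or_eq_neg.mp h2 with h3 | h3
    · have h4 : n * (C : ℤ) = 0 := by linarith
      rcases mul_eq_zero.mp h4 with h5 | h5
      · exact h5
      · omega
    · have h4 : (C : ℤ) ∣ A * 2 := ⟨-n, by linarith⟩
      have h5 : (C : ℤ) ∣ 2 :=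
        IsCoprime.dvd_of_dvd_mul_left (Int.isCoprime_iff_gcd_eq_one.mpr hgcd).symm h4
      have h6 := Int.le_of_dvd two_pos h5
      omega
  · rintro rfl
    ring

theorem nonHolIndex_fiber_two :
    nonHolIndex 1 2 ⁻¹' {nonHolIndex 1 2 0} = (({0, -1} : Finset ℤ) : Set ℤ) := by
  ext n
  simp only [mem_preimage, mem_singleton_iff, nonHolIndex, Finset.coe_insert, Finset.coe_singleton,
    mem_insert_iff]
  push_cast
  constructor
  · intro h
    have h2 : (n * 2 + 1) ^ 2 = (1 : ℤ) ^ 2 := by linarith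
    rcases sq_eq_sq_iff_eq_or_eq_neg.mp h2 with h3 | h3 <;> omega
  · rintro (rfl | rfl) <;> norm_num

theorem torsionCoeff_neg_one {a : ℕ} (ha : Even a) :
    torsionCoeff (a / 2 : ℚ) (-1) = -torsionCoeff (a / 2 : ℚ) 0 := by
  obtain ⟨j, rfl⟩ := ha
  have h : -(2 * π * 𝕚 * (((-1 : ℤ) : ℂ) + 1 / 2) * (((j + j : ℕ) / 2 : ℚ) : ℂ))
        + π * 𝕚 * ((-1 : ℤ) : ℂ)
      = (-(2 * π * 𝕚 * (((0 : ℤ) : ℂ) + 1 / 2) * (((j + j : ℕ) / 2 : ℚ) : ℂ))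
        + π * 𝕚 * ((0 : ℤ) : ℂ) + π * 𝕚) + ((j - 1 : ℤ) : ℂ) * (2 * π * 𝕚) := by
    push_cast
    ring
  rw [torsionCoeff, torsionCoeff, neg_exp, h, Complex.exp_add, Complex.exp_int_mul_two_pi_mul_I,
    mul_one]

/-- For C ≠ 2 the coefficient is a single nonzero term. For C = 2 the frequencies 1/2 and -1/2 share
an exponent; their signs are opposite, and so are the unimodular coefficients when a is even, so the
terms add. -/
theorem nonHolCoeff_ne_zero (h0 : 0 < A) (h1 : A < C) (hgcd : Int.gcd A C = 1) {a : ℕ}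
    (ha : C = 2 → Even a) :
    nonHolCoeff A C (torsionCoeff (a / 2 : ℚ)) (nonHolIndex A C 0) ≠ 0 := by
  have hπ : ((√π : ℝ) : ℂ) ≠ 0 := by exact_mod_cast (Real.sqrt_pos.mpr Real.pi_pos).ne'
  have hb : torsionCoeff (a / 2 : ℚ) 0 ≠ 0 := Complex.exp_ne_zero _
  have hA : (0 : ℝ) < A := by exact_mod_cast h0
  rw [nonHolCoeff]
  by_cases hC : C = 2
  · subst hC
    obtain rfl : A = 1 := by push_cast at h1; omega
    rw [nonHolIndex_fiber_two, Finset.tsum_subtype' {0, -1} fun n : ℤ =>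
      torsionCoeff (a / 2 : ℚ) n * (Real.sign (n * ((2 : ℕ) : ℝ) + ((1 : ℤ) : ℝ)) / √π : ℝ),
      Finset.sum_pair (by norm_num), torsionCoeff_neg_one (ha rfl)]
    push_cast
    rw [Real.sign_of_pos (by norm_num), Real.sign_of_neg (by norm_num)]
    have : torsionCoeff (a / 2 : ℚ) 0 * (((1 : ℝ) : ℂ) / (√π : ℂ))
        + -torsionCoeff (a / 2 : ℚ) 0 * (((-1 : ℝ) : ℂ) / (√π : ℂ))
          = 2 * torsionCoeff (a / 2 : ℚ) 0 / (√π : ℂ) := by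
      push_cast; ring
    rw [this]
    exact div_ne_zero (mul_ne_zero two_ne_zero hb) hπ
  · rw [nonHolIndex_fiber h0 h1 hgcd hC, Finset.tsum_subtype' {0} fun n : ℤ =>
      torsionCoeff (a / 2 : ℚ) n * (Real.sign (n * (C : ℝ) + (A : ℝ)) / √π : ℝ),
      Finset.sum_singleton, Int.cast_zero, zero_mul, zero_add, Real.sign_of_pos hA]
    push_cast
    exact mul_ne_zero hb (div_ne_zero one_ne_zero hπ)

theorem exists_nonHol_ne_zero (h0 : 0 < A) (h1 : A < C) (hgcd : Int.gcd A C = 1) {a : ℕ}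
    (ha : C = 2 → Even a) :
    ∃ τ : ℍ, nonHol ((A / C : ℚ) : ℝ) (torsionCoeff (a / 2 : ℚ)) τ ≠ 0 := by
  by_contra hcon
  push Not at hcon
  have hC : 0 < C := by exact_mod_cast h0.trans h1
  set b := torsionCoeff (a / 2 : ℚ)
  have hb : ∀ n, ‖b n‖ ≤ 1 := fun n => (norm_torsionCoeff _ n).le
  set N : ℕ := 16 * (2 * C) ^ 2
  have hN : 0 < N := by positivity
  have hNc : (N : ℂ) ≠ 0 := by exact_mod_cast hN.ne'
  set G : ℤ → ℂ := fun k => (upperGamma (1 - 1 / 2) (4 * π * |(k : ℝ)| * 1 / (N : ℝ)) : ℂ)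
  set c : ℤ → ℂ := fun k => nonHolCoeff A C b k * G k * cexp (-(2 * π * k / N))
  -- On the line Nx + i of height 1, q^(k/N) is exp(2πikx) times a constant, giving an ordinary
  -- Fourier series.
  have hsum : ∀ x : ℝ, HasSum (fun k => c k * cexp (2 * π * 𝕚 * k * x)) 0 := by
    intro x
    have him : 0 < (((N * x : ℝ) : ℂ) + 𝕚).im := by simp
    have h := hasSum_nonHolCoeff h0 h1 hb ⟨_, him⟩
    rw [hcon] at h
    have him' : UpperHalfPlane.im ⟨((N * x : ℝ) : ℂ) + 𝕚, him⟩ = 1 := by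
      show (((N * x : ℝ) : ℂ) + 𝕚).im = 1
      simp
    refine h.congr_fun fun k => ?_
    rw [him']
    simp only [c, G]
    rw [mul_assoc _ (cexp _) (cexp _), qpow, ← Complex.exp_add]
    congr 2
    show _ = 2 * π * 𝕚 * (((k : ℚ) / N : ℚ) : ℂ) * (((N * x : ℝ) : ℂ) + 𝕚)
    push_cast
    field_simp
    linear_combination (-(k : ℂ)) * Complex.I_sq
  have hs : Summable fun k => ‖c k‖ := by
    have := (hsum 0).summable.norm
    simpa using this
  have hz := fourier_coeff_eq_zero hs (fun x => (hsum x).tsum_eq) (nonHolIndex A C 0)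
  have hG : G (nonHolIndex A C 0) ≠ 0 := by
    have hx : 0 < |(A : ℝ) / C| * √2 := by
      have : (0 : ℝ) < A := by exact_mod_cast h0
      have : (0 : ℝ) < C := by exact_mod_cast hC
      positivity
    have harg : 4 * π * |(nonHolIndex A C 0 : ℝ)| * 1 / (N : ℝ) = π * (|(A : ℝ) / C| * √2) ^ 2 := by
      have : (0 : ℝ) < C := by exact_mod_cast hC
      rw [mul_pow |_|, sq_abs, Real.sq_sqrt zero_le_two, nonHolIndex]
      simp only [N]
      push_cast
      rw [abs_mul, abs_neg, abs_of_nonneg (show (0 : ℝ) ≤ 32 by norm_num),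
        abs_of_nonneg (sq_nonneg _)]
      field_simp
      ring
    simp only [G]
    rw [harg, show (1 - 1 / 2 : ℝ) = 1 / 2 by norm_num, upperGamma_half hx]
    exact_mod_cast (mul_pos (Real.sqrt_pos.mpr Real.pi_pos) (one_sub_errE_pos _)).ne'
  exact mul_ne_zero (mul_ne_zero (nonHolCoeff_ne_zero h0 h1 hgcd ha) hG) (Complex.exp_ne_zero _) hz

end FourierExpansion

/-! ### The groups -/

theorem vecAct_add (p q : ℚ × ℚ) (γ : SL(2, ℤ)) : vecAct (p + q) γ = vecAct p γ + vecAct q γ := by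
  ext <;> simp [vecAct] <;> ring

theorem vecAct_int (m n : ℤ) (γ : SL(2, ℤ)) : vecAct ((m : ℚ), (n : ℚ)) γ
    = (((m * γ 0 0 + n * γ 1 0 : ℤ) : ℚ), ((m * γ 0 1 + n * γ 1 1 : ℤ) : ℚ)) := by
  ext <;> simp [vecAct]

/-- The stabilizer of a rational vector modulo integral vectors. -/
def torsionStab (p : ℚ × ℚ) : Subgroup SL(2, ℤ) where
  carrier := {γ | ∃ m n : ℤ, vecAct p γ = p + ((m : ℚ), (n : ℚ))}
  mul_mem' := by
    rintro γ δ ⟨m, n, h⟩ ⟨m', n', h'⟩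
    refine ⟨m' + (m * δ 0 0 + n * δ 1 0), n' + (m * δ 0 1 + n * δ 1 1), ?_⟩
    rw [vecAct_mul, h, vecAct_add, h', vecAct_int, add_assoc, Prod.mk_add_mk]
    push_cast
    rfl
  one_mem' := ⟨0, 0, by rw [vecAct_one]; simp⟩
  inv_mem' := by
    rintro γ ⟨m, n, h⟩
    have h1 : vecAct (p + ((m : ℚ), (n : ℚ))) γ⁻¹ = p := by
      rw [← h, ← vecAct_mul, mul_inv_cancel, vecAct_one]
    rw [vecAct_add, vecAct_int] at h1
    refine ⟨-(m * γ⁻¹ 0 0 + n * γ⁻¹ 1 0), -(m * γ⁻¹ 0 1 + n * γ⁻¹ 1 1), ?_⟩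
    rw [eq_sub_of_add_eq h1, sub_eq_add_neg, Prod.neg_mk]
    push_cast
    rfl

theorem mem_torsionStab {p : ℚ × ℚ} {γ : SL(2, ℤ)} :
    γ ∈ torsionStab p ↔ ∃ m n : ℤ, vecAct p γ = p + ((m : ℚ), (n : ℚ)) := Iff.rfl

theorem mem_torsionStab_iff_dvd {C : ℕ} (hC : 0 < C) (A a : ℤ) (γ : SL(2, ℤ)) :
    γ ∈ torsionStab ((A : ℚ) / C, (a : ℚ) / 2) ↔
      (2 * C : ℤ) ∣ 2 * A * (γ 0 0 - 1) + a * C * γ 1 0 ∧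
      (2 * C : ℤ) ∣ 2 * A * γ 0 1 + a * C * (γ 1 1 - 1) := by
  have hCq : (C : ℚ) ≠ 0 := by exact_mod_cast hC.ne'
  rw [mem_torsionStab]
  simp only [vecAct, Prod.ext_iff, Prod.fst_add, Prod.snd_add]
  constructor
  · rintro ⟨m, n, h1, h2⟩
    refine ⟨⟨m, ?_⟩, ⟨n, ?_⟩⟩
    · field_simp at h1
      have h1' : A * γ 0 0 * 2 + C * a * γ 1 0 = 2 * (A + C * m) := by exact_mod_cast h1
      linarith
    · field_simp at h2
      have h2' : A * γ 0 1 * 2 + C * a * γ 1 1 = C * (a + 2 * n) := by exact_mod_cast h2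
      linarith
  · rintro ⟨⟨m, h1⟩, ⟨n, h2⟩⟩
    refine ⟨m, n, ?_, ?_⟩
    · have h1' : (2 * A * (γ 0 0 - 1) + a * C * γ 1 0 : ℚ) = 2 * C * m := by exact_mod_cast h1
      field_simp
      linarith
    · have h2' : (2 * A * γ 0 1 + a * C * (γ 1 1 - 1) : ℚ) = 2 * C * n := by exact_mod_cast h2
      field_simp
      linarith

theorem mem_torsionStab_half (γ : SL(2, ℤ)) :
    γ ∈ torsionStab ((1 : ℚ) / 2, 0) ↔ (2 : ℤ) ∣ γ 0 0 - 1 ∧ (2 : ℤ) ∣ γ 0 1 := by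
  have h := mem_torsionStab_iff_dvd (C := 2) two_pos 1 0 γ
  simp only [Int.cast_one, Nat.cast_ofNat, Int.cast_zero, zero_div, mul_one, zero_mul,
    add_zero] at h
  rw [h, mul_dvd_mul_iff_left two_ne_zero, mul_dvd_mul_iff_left two_ne_zero]

theorem natCast_lcm_dvd (m n : ℕ) (x : ℤ) : ((Nat.lcm m n : ℕ) : ℤ) ∣ x ↔ (m : ℤ) ∣ x ∧ (n : ℤ) ∣ x := by
  rw [Int.natCast_dvd, Int.natCast_dvd, Int.natCast_dvd, Nat.lcm_dvd_iff]

theorem det_eq (γ : SL(2, ℤ)) : γ 0 0 * γ 1 1 - γ 0 1 * γ 1 0 = 1 := by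
  rw [← Matrix.det_fin_two, γ.det_coe]

/-- The determinant makes the congruence for the lower right entry redundant. -/
theorem mem_GammaUpper1_iff (N : ℕ) (γ : SL(2, ℤ)) :
    γ ∈ GammaUpper1 N ↔ (N : ℤ) ∣ γ 0 0 - 1 ∧ (N : ℤ) ∣ γ 0 1 := by
  have hdet := det_eq γ
  simp only [GammaUpper1, Set.mem_ofPred_eq, Int.modEq_comm (b := (1 : ℤ)),
    Int.modEq_comm (b := (0 : ℤ)), Int.modEq_iff_dvd, sub_zero]
  refine ⟨fun h => ⟨h.1, h.2.2⟩, fun ⟨h1, h2⟩ => ⟨h1, ?_, h2⟩⟩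
  have : γ 1 1 - 1 = γ 0 1 * γ 1 0 - (γ 0 0 - 1) * γ 1 1 := by linarith
  rw [this]
  exact dvd_sub (h2.mul_right _) (h1.mul_right _)

theorem mem_GammaUpper0_iff (N : ℕ) (γ : SL(2, ℤ)) :
    γ ∈ GammaUpper0 N ↔ (N : ℤ) ∣ γ 0 1 := by
  simp only [GammaUpper0, Set.mem_ofPred_eq, Int.modEq_zero_iff_dvd]

theorem mem_Gamma0_two_iff (γ : SL(2, ℤ)) : γ ∈ (Gamma0 2 : Set SL(2, ℤ)) ↔ (2 : ℤ) ∣ γ 1 0 := by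
  rw [SetLike.mem_coe, Gamma0_mem, ZMod.intCast_zmod_eq_zero_iff_dvd]
  rfl

theorem two_dvd_sub_one_of_det {x y c d : ℤ} (hdet : x * d - y * c = 1) (hx : 2 ∣ x - 1)
    (hy : 2 ∣ y) : 2 ∣ d - 1 := by
  have : d - 1 = y * c - (x - 1) * d := by linarith
  rw [this]
  exact dvd_sub (hy.mul_right _) (hx.mul_right _)

/-- Divisibility by D forces x = Ds. After dividing by 2D the condition is that As + ac be even, and
A, a are both odd. -/
theorem dvd_iff_exists_of_coprime {A D a x c : ℤ} (hD : D ≠ 0) (hcop : IsCoprime (2 * D) A)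
    (ha : Odd a) : 2 * (2 * D) ∣ 2 * A * x + a * (2 * D) * c ↔ ∃ s, x = D * s ∧ 2 ∣ s + c := by
  obtain ⟨a', rfl⟩ := ha
  obtain ⟨A', rfl⟩ : Odd A := by
    rw [← Int.not_even_iff_odd]
    intro h
    have h2 : (2 : ℤ) ∣ 1 := by
      have := (hcop.of_mul_left_left).dvd_of_dvd_mul_left (z := 1) (by simpa using h.two_dvd)
      exact this
    norm_num at h2
  constructor
  · rintro ⟨k, hk⟩
    have h1 : D ∣ (2 * A' + 1) * x := ⟨2 * k - (2 * a' + 1) * c, by linarith⟩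
    obtain ⟨s, rfl⟩ := hcop.of_mul_left_right.dvd_of_dvd_mul_left h1
    refine ⟨s, rfl, k - A' * s - a' * c, ?_⟩
    have h2 : D * ((2 * A' + 1) * s + (2 * a' + 1) * c) = D * (2 * k) := by linarith
    have h3 := mul_left_cancel₀ hD h2
    linarith
  · rintro ⟨s, rfl, k, hk⟩
    refine ⟨k + A' * s + a' * c, ?_⟩
    linear_combination 2 * D * hk

/-- Write x, y, c for the entries γ₀₀, γ₀₁, γ₁₀. Fixing (1/2, 0) makes x odd and y even. For even a
the terms with a drop out, leaving C ∣ x - 1 and C ∣ y. For odd a and C = 2D the condition on x is x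
- 1 = Ds with s + c even. If D is odd, x odd forces s, hence c, to be even; C odd gives the same
conclusion directly. If D is even, both parities occur: s, c even is the first piece of A_α, and s,
c odd the second. -/
theorem stab_iff_mem_ASet {A : ℤ} {C a : ℕ} (hC : 0 < C) (hgcd : Int.gcd A C = 1) (γ : SL(2, ℤ)) :
    γ ∈ torsionStab ((A : ℚ) / C, (a : ℚ) / 2) ⊓ torsionStab ((1 : ℚ) / 2, 0) ↔ γ ∈ ASet C a := by
  have hcop : IsCoprime (C : ℤ) A := (Int.isCoprime_iff_gcd_eq_one.mpr hgcd).symm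
  have hC0 : (C : ℤ) ≠ 0 := by exact_mod_cast hC.ne'
  have hst := mem_torsionStab_iff_dvd hC A a γ
  rw [Int.cast_natCast] at hst
  rw [Subgroup.mem_inf, hst, mem_torsionStab_half, ASet]
  have hdet := det_eq γ
  have hU1 := fun N => mem_GammaUpper1_iff N γ
  have hU0 := fun N => mem_GammaUpper0_iff N γ
  have hG0 := mem_Gamma0_two_iff γ
  generalize hx : γ 0 0 = x at *
  generalize hy : γ 0 1 = y at *
  generalize hc : γ 1 0 = c at *
  generalize hd : γ 1 1 = d at *
  have hdvdA : ∀ z : ℤ, (C : ℤ) ∣ A * z ↔ (C : ℤ) ∣ z := fun z =>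
    ⟨hcop.dvd_of_dvd_mul_left, fun h => h.mul_left A⟩
  rcases Nat.even_or_odd a with hae | hao
  · rw [if_pos hae, hU1, natCast_lcm_dvd, natCast_lcm_dvd]
    obtain ⟨b, rfl⟩ := hae
    have e1 : 2 * A * (x - 1) + ((b + b : ℕ) : ℤ) * C * c = 2 * (A * (x - 1) + C * (b * c)) := by
      push_cast; ring
    have e2 : 2 * A * y + ((b + b : ℕ) : ℤ) * C * (d - 1) = 2 * (A * y + C * (b * (d - 1))) := by
      push_cast; ring
    rw [e1, e2, mul_dvd_mul_iff_left two_ne_zero, mul_dvd_mul_iff_left two_ne_zero,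
      dvd_add_left (dvd_mul_right _ _), dvd_add_left (dvd_mul_right _ _), hdvdA, hdvdA]
    push_cast
    tauto
  · rw [if_neg (Nat.not_even_iff_odd.mpr hao)]
    have hsecond : 2 ∣ x - 1 → 2 ∣ y →
        ((2 * C : ℤ) ∣ 2 * A * y + a * C * (d - 1) ↔ (C : ℤ) ∣ y) := by
      intro h1 h2
      obtain ⟨w, hw⟩ := two_dvd_sub_one_of_det hdet h1 h2
      rw [hw, show 2 * A * y + (a : ℤ) * C * (2 * w) = 2 * (A * y + C * (a * w)) by ring,
        mul_dvd_mul_iff_left two_ne_zero, dvd_add_left (dvd_mul_right _ _), hdvdA]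
    have h2C : 2 ∣ C → ∃ D : ℕ, C = 2 * D ∧ (D : ℤ) ≠ 0 ∧
        ((2 * C : ℤ) ∣ 2 * A * (x - 1) + a * C * c ↔ ∃ s, x - 1 = D * s ∧ 2 ∣ s + c) := by
      rintro ⟨D, rfl⟩
      have hD : (D : ℤ) ≠ 0 := by omega
      refine ⟨D, rfl, hD, ?_⟩
      push_cast at hcop ⊢
      exact dvd_iff_exists_of_coprime hD hcop (by exact_mod_cast hao)
    by_cases h4 : 4 ∣ C
    · rw [if_neg (not_not.mpr h4)]
      obtain ⟨D, rfl, hD, hfirst⟩ := h2C (dvd_trans (by norm_num) h4)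
      have hDe : (2 : ℤ) ∣ D := by omega
      have hdiv : 2 * D / 2 = D := by omega
      simp only [mem_union, mem_inter_iff, Set.mem_sdiff, hU1, hU0, hG0, hdiv, hfirst]
      push_cast at hsecond ⊢
      constructor
      · rintro ⟨⟨⟨s, hs, hsc⟩, h2⟩, h3, h5⟩
        have hy' := (hsecond h3 h5).mp h2
        by_cases h6 : 2 ∣ c
        · left
          obtain ⟨t, rfl⟩ : 2 ∣ s := by omega
          exact ⟨⟨⟨t, by rw [hs]; ring⟩, hy'⟩, h6⟩
        · right
          refine ⟨⟨⟨⟨s, hs⟩, (dvd_mul_left _ _).trans hy'⟩, hy'⟩, ?_⟩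
          rintro (h7 | ⟨⟨t, ht⟩, -⟩)
          · exact h6 h7
          · have : s = 2 * t := mul_left_cancel₀ hD (by rw [← hs, ht]; ring)
            omega
      · intro h
        obtain ⟨⟨s, hs, hsc⟩, hy'⟩ : (∃ s, x - 1 = D * s ∧ 2 ∣ s + c) ∧ (2 * D : ℤ) ∣ y := by
          rcases h with ⟨⟨⟨t, ht⟩, hy'⟩, h6⟩ | ⟨⟨⟨⟨s, hs⟩, -⟩, hy'⟩, h6⟩
          · exact ⟨⟨2 * t, by rw [ht]; ring, by omega⟩, hy'⟩
          · refine ⟨⟨s, hs, ?_⟩, hy'⟩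
            push Not at h6
            by_contra h7
            obtain ⟨t, rfl⟩ : 2 ∣ s := by omega
            exact h6.2 ⟨t, by rw [hs]; ring⟩ hy'
        have h3 : 2 ∣ x - 1 := hs ▸ hDe.mul_right s
        have h5 : 2 ∣ y := (dvd_mul_right _ _).trans hy'
        exact ⟨⟨⟨s, hs, hsc⟩, (hsecond h3 h5).mpr hy'⟩, h3, h5⟩
    · rw [if_pos h4]
      simp only [mem_inter_iff, hU1, hG0, natCast_lcm_dvd]
      have hfirst : 2 ∣ x - 1 → ((2 * C : ℤ) ∣ 2 * A * (x - 1) + a * C * c ↔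
          (C : ℤ) ∣ x - 1 ∧ 2 ∣ c) := by
        intro h3
        by_cases h2 : 2 ∣ C
        · obtain ⟨D, rfl, hD, hf⟩ := h2C h2
          rw [hf]
          push_cast
          constructor
          · rintro ⟨s, hs, hsc⟩
            obtain ⟨t, rfl⟩ : 2 ∣ s := by
              -- D is odd because 4 does not divide C = 2D.
              have hDo : IsCoprime (2 : ℤ) D := ⟨-(D / 2 : ℤ), 1, by omega⟩
              exact hDo.dvd_of_dvd_mul_left (hs ▸ h3)
            exact ⟨⟨t, by rw [hs]; ring⟩, by omega⟩
          · rintro ⟨⟨t, ht⟩, h6⟩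
            exact ⟨2 * t, by rw [ht]; ring, by omega⟩
        · obtain ⟨a', rfl⟩ := hao
          obtain ⟨k, hk⟩ : ∃ k : ℤ, (C : ℤ) = 2 * k + 1 := ⟨C / 2, by omega⟩
          constructor
          · rintro ⟨t, ht⟩
            have h6 : 2 ∣ c := by
              refine ⟨C * t - A * (x - 1) - (a' * C + k) * c, ?_⟩
              push_cast at ht
              linear_combination ht - c * hk
            obtain ⟨e, rfl⟩ := h6
            refine ⟨(hdvdA _).mp ⟨t - (2 * a' + 1) * e, ?_⟩, dvd_mul_right _ _⟩
            push_cast at ht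
            linarith
          · rintro ⟨⟨t, ht⟩, ⟨e, rfl⟩⟩
            exact ⟨A * t + (2 * a' + 1) * e, by rw [ht]; push_cast; ring⟩
      push_cast
      constructor
      · rintro ⟨⟨h1, h2⟩, h3, h5⟩
        have := (hfirst h3).mp h1
        exact ⟨⟨⟨h3, this.1⟩, h5, (hsecond h3 h5).mp h2⟩, this.2⟩
      · rintro ⟨⟨⟨h3, h1⟩, h5, h2⟩, h6⟩
        exact ⟨⟨(hfirst h3).mpr ⟨h1, h6⟩, (hsecond h3 h5).mpr h2⟩, h3, h5⟩

/-! ### The completed functions -/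

theorem torsionStab_isCongruenceSubgroup {A : ℤ} {C a : ℕ} (hC : 0 < C) :
    IsCongruenceSubgroup
      (torsionStab ((A : ℚ) / C, (a : ℚ) / 2) ⊓ torsionStab ((1 : ℚ) / 2, 0)) := by
  refine ⟨2 * C, by omega, fun γ hγ => ?_⟩
  rw [Gamma_mem] at hγ
  obtain ⟨h1, h2, h3, h4⟩ := hγ
  have e1 : ((2 * C : ℕ) : ℤ) ∣ γ 0 0 - 1 := by
    rw [← ZMod.intCast_zmod_eq_zero_iff_dvd]; push_cast; rw [h1, sub_self]
  have e2 : ((2 * C : ℕ) : ℤ) ∣ γ 0 1 := (ZMod.intCast_zmod_eq_zero_iff_dvd _ _).mp h2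
  have e3 : ((2 * C : ℕ) : ℤ) ∣ γ 1 0 := (ZMod.intCast_zmod_eq_zero_iff_dvd _ _).mp h3
  have e4 : ((2 * C : ℕ) : ℤ) ∣ γ 1 1 - 1 := by
    rw [← ZMod.intCast_zmod_eq_zero_iff_dvd]; push_cast; rw [h4, sub_self]
  push_cast at e1 e2 e3 e4
  have h := mem_torsionStab_iff_dvd hC A a γ
  rw [Int.cast_natCast] at h
  rw [Subgroup.mem_inf, h, mem_torsionStab_half]
  exact ⟨⟨dvd_add (e1.mul_left _) (e3.mul_left _), dvd_add (e2.mul_left _) (e4.mul_left _)⟩,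
    (dvd_mul_right _ _).trans e1, (dvd_mul_right _ _).trans e2⟩

/-- The transformation law on the stabilizer of the torsion points. -/
theorem torsionMu_smul_of_mem {p r : ℚ × ℚ} (hp : NonIntegral p) (hr : NonIntegral r)
    {γ : SL(2, ℤ)} (hγ : γ ∈ torsionStab p ⊓ torsionStab r) : ∃ ζ, IsUnityRoot ζ ∧ ∀ τ : ℍ,
      torsionMu p r (γ • τ) = ζ * autFactor (1 / 2) γ τ * torsionMu p r τ := by
  obtain ⟨⟨m, n, h⟩, ⟨m', n', h'⟩⟩ := hγ
  obtain ⟨ζ, hζ, ht⟩ := transformsUnder γ p r hp hr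
  obtain ⟨ξ, hξ, hu⟩ := torsionMu_add_int hp hr m n m' n'
  refine ⟨ζ * ξ, hζ.mul hξ, fun τ => ?_⟩
  rw [ht, h, h', hu]
  ring

/-- Every cusp is reduced to infinity, with pγ and rγ as the new torsion points. -/
theorem torsionMu_growth {p r : ℚ × ℚ} (hp : NonIntegral p) (hr : NonIntegral r) (γ : SL(2, ℤ)) :
    PolyGrowth fun τ => (autFactor (1 / 2) γ τ)⁻¹ * torsionMu p r (γ • τ) := by
  obtain ⟨ζ, -, ht⟩ := transformsUnder γ p r hp hr
  have : (fun τ => (autFactor (1 / 2) γ τ)⁻¹ * torsionMu p r (γ • τ))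
      = fun τ => ζ * torsionMu (vecAct p γ) (vecAct r γ) τ := by
    funext τ
    rw [ht, mul_comm ζ, mul_assoc, inv_mul_cancel_left₀ (autFactor_ne_zero γ τ)]
  rw [this]
  exact (torsionMu_polyGrowth (hp.vecAct γ) (hr.vecAct γ)).const_mul ζ

/-- The complex derivative as a real differential. -/
theorem hasFDerivAt_of_hasDerivAt {f : ℂ → ℂ} {f' z : ℂ} (h : HasDerivAt f f' z) :
    HasFDerivAt f (f' • ContinuousLinearMap.id ℝ ℂ + (0 : ℂ) • imC) z := by
  refine (h.hasFDerivAt.restrictScalars ℝ).congr_fderiv ?_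
  ext w
  simp
  ring

theorem torsionMu_contDiffOn {p r : ℚ × ℚ} (hp : NonIntegral p) (hr : NonIntegral r)
    (h0 : 0 < 1 / 2 + (p - r).1) (h1 : 1 / 2 + (p - r).1 < 1) :
    ContDiffOn ℝ ∞ (fun z : ℂ => torsionMu p r (ofComplex z)) {z : ℂ | 0 < z.im} := by
  have hhol : ContDiffOn ℝ ∞ (torsionHol p r) {z : ℂ | 0 < z.im} := by
    have : DifferentiableOn ℂ (torsionHol p r) {z : ℂ | 0 < z.im} := fun z hz =>
      (torsionHol_differentiableAt hp hr hz).differentiableWithinAt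
    exact (this.contDiffOn (isOpen_im_gt 0)).restrict_scalars ℝ
  have hb : Tame ((1 / 2 + (p - r).1 : ℚ) : ℝ) (torsionCoeff (p - r).2) :=
    .of_norm_le_one _ fun n => (norm_torsionCoeff _ n).le
  refine (hhol.add ((contDiffOn_const (c := 𝕚 / 2)).mul hb.contDiffOn_nonHol)).congr fun z hz => ?_
  rw [torsionMu_eq_of_sign h0 h1, ofComplex_apply_of_im_pos hz]

theorem torsionMu_harmonic {p r : ℚ × ℚ} (hp : NonIntegral p) (hr : NonIntegral r)
    (h0 : 0 < 1 / 2 + (p - r).1) (h1 : 1 / 2 + (p - r).1 < 1) (c : ℂ) (τ : ℍ) :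
    laplacian (1 / 2) (fun τ => c * torsionMu p r τ) τ = 0 := by
  set s : ℝ := ((1 / 2 + (p - r).1 : ℚ) : ℝ)
  set b := torsionCoeff (p - r).2
  have hb : Tame s b := .of_norm_le_one _ fun n => (norm_torsionCoeff _ n).le
  have hb' := hb.mul_sq (-π * 𝕚)
  have hd : ∀ z : ℂ, 0 < z.im → HasDerivAt (torsionHol p r) (deriv (torsionHol p r) z) z :=
    fun z hz => (torsionHol_differentiableAt hp hr hz).hasDerivAt
  have hd' : ∀ z : ℂ, 0 < z.im →
      HasDerivAt (deriv (torsionHol p r)) (deriv (deriv (torsionHol p r)) z) z := by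
    intro z hz
    have h : DifferentiableOn ℂ (torsionHol p r) {z : ℂ | 0 < z.im} := fun z hz =>
      (torsionHol_differentiableAt hp hr hz).differentiableWithinAt
    exact ((h.deriv (isOpen_im_gt 0)).differentiableAt ((isOpen_im_gt 0).mem_nhds hz)).hasDerivAt
  have hlin : ∀ {f f₁ g g₁ k : ℂ → ℂ} {z : ℂ}, HasDerivAt f (f₁ z) z →
      HasFDerivAt g (g₁ z • ContinuousLinearMap.id ℝ ℂ + k z • imC) z →
      HasFDerivAt (fun z => c * (f z + 𝕚 / 2 * g z))
        ((c * (f₁ z + 𝕚 / 2 * g₁ z)) • ContinuousLinearMap.id ℝ ℂ + (c * (𝕚 / 2) * k z) • imC) z := by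
    intro f f₁ g g₁ k z hf hg
    refine (((hasFDerivAt_of_hasDerivAt hf).add (hg.const_mul (𝕚 / 2))).const_mul c).congr_fderiv ?_
    ext w
    simp
    ring
  refine laplacian_eq_zero
    (f := fun z => c * (torsionHol p r z + 𝕚 / 2 * nonHol s b z))
    (f₁ := fun z => c * (deriv (torsionHol p r) z
      + 𝕚 / 2 * nonHol s (fun n => -π * 𝕚 * (n + s) ^ 2 * b n) z))
    (f₂ := fun z => c * (deriv (deriv (torsionHol p r)) z
      + 𝕚 / 2 * nonHol s (fun n => -π * 𝕚 * (n + s) ^ 2 * (-π * 𝕚 * (n + s) ^ 2 * b n)) z))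
    (h := fun z => c * (𝕚 / 2) * nonHolIm s b z)
    (h₁ := fun z => c * (𝕚 / 2) * nonHolIm s (fun n => -π * 𝕚 * (n + s) ^ 2 * b n) z)
    (fun τ => by rw [torsionMu_eq_of_sign h0 h1])
    (fun z hz => hlin (hd z hz) (hb.hasFDerivAt_nonHol hz))
    (fun z hz => hlin (hd' z hz) (hb'.hasFDerivAt_nonHol hz)) (fun x y hy => ?_) τ
  exact ((hb.hasDerivAt_nonHolIm x hy).const_mul (c * (𝕚 / 2))).congr_deriv (by ring)

/-! ### Return to V_α and V̂_α. -/

section Main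

variable {A : ℤ} {C a : ℕ}

/-- The q-power in V_α is exactly the normalization of `torsionMu`, as (2A - C)²/(8C²) = (A/C -
1/2)²/2. -/
theorem qpow_mul_torsion (hC : 0 < C) (τ : ℍ) :
    qpow (-((2 * (A : ℚ) - C) ^ 2 / (8 * (C : ℚ) ^ 2))) τ
      = cexp (-(π * 𝕚 * (((A : ℚ) / C - 1 / 2 : ℚ) : ℂ) ^ 2 * τ)) := by
  have hC' : (C : ℂ) ≠ 0 := by exact_mod_cast hC.ne'
  rw [qpow]
  congr 1
  push_cast
  field_simp
  ring

theorem two_mul_alpha (A : ℤ) (C a : ℕ) (τ : ℍ) :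
    2 * alpha A C a τ = torsionPt ((A : ℚ) / C, (a : ℚ) / 2) τ := by
  rw [alpha, torsionPt]
  push_cast
  ring

theorem half_eq_torsionPt (τ : ℍ) : (τ : ℂ) / 2 = torsionPt ((1 : ℚ) / 2, 0) τ := by
  rw [torsionPt]
  push_cast
  ring

theorem V_eq (hC : 0 < C) (τ : ℍ) : V A C a τ
    = 𝕚 ^ (a + 1) * torsionHol ((A : ℚ) / C, (a : ℚ) / 2) ((1 : ℚ) / 2, 0) τ := by
  rw [V, qpow_mul_torsion hC, two_mul_alpha, half_eq_torsionPt, mu_eq_appell, torsionHol, mul_assoc]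

theorem VHat_eq (hC : 0 < C) (τ : ℍ) : VHat A C a τ
    = 𝕚 ^ (a + 1) * torsionMu ((A : ℚ) / C, (a : ℚ) / 2) ((1 : ℚ) / 2, 0) τ := by
  rw [VHat, qpow_mul_torsion hC, two_mul_alpha, half_eq_torsionPt, muHat_eq_muC, torsionMu,
    mul_assoc]
  push_cast
  rfl

theorem nonIntegral_half : NonIntegral ((1 : ℚ) / 2, 0) := by
  rintro ⟨m, n, h⟩
  have h1 : (1 : ℚ) / 2 = m := congrArg Prod.fst h
  have h2 : (1 : ℚ) = 2 * m := by linarith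
  have h3 : (1 : ℤ) = 2 * m := by exact_mod_cast h2
  omega

theorem nonIntegral_of_mem_Ioo {x : ℚ} (h0 : 0 < x) (h1 : x < 1) (y : ℚ) : NonIntegral (x, y) := by
  rintro ⟨m, n, h⟩
  obtain rfl : x = m := congrArg Prod.fst h
  have h2 : 0 < m := by exact_mod_cast h0
  have h3 : m < 1 := by exact_mod_cast h1
  omega

theorem exists_isHarmonicMaassForm (hC : 0 < C) (hpos : 0 < (A : ℚ) / (C : ℚ))
    (hlt : (A : ℚ) / (C : ℚ) < 1) {Γ : Subgroup SL(2, ℤ)}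
    (hΓ : Γ = torsionStab ((A : ℚ) / C, (a : ℚ) / 2) ⊓ torsionStab ((1 : ℚ) / 2, 0)) :
    ∃ ψ : Γ → ℂ, (∀ γ : Γ, IsUnityRoot (ψ γ)) ∧ IsHarmonicMaassForm (1 / 2) Γ ψ (VHat A C a) := by
  subst hΓ
  have hp := nonIntegral_of_mem_Ioo hpos hlt ((a : ℚ) / 2)
  have hr := nonIntegral_half
  have hs : (1 : ℚ) / 2 + (((A : ℚ) / C, (a : ℚ) / 2) - ((1 : ℚ) / 2, (0 : ℚ))).1 = (A : ℚ) / C := by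
    simp
  have h0 := hs.symm ▸ hpos
  have h1 := hs.symm ▸ hlt
  have hF : VHat A C a = fun τ => 𝕚 ^ (a + 1)
      * torsionMu ((A : ℚ) / C, (a : ℚ) / 2) ((1 : ℚ) / 2, 0) τ := funext (VHat_eq hC)
  have htr := fun γ : (torsionStab ((A : ℚ) / C, (a : ℚ) / 2) ⊓ torsionStab ((1 : ℚ) / 2, 0) :
    Subgroup SL(2, ℤ)) => torsionMu_smul_of_mem hp hr γ.2
  choose ψ hψ ht using htr
  refine ⟨ψ, hψ, ?_⟩
  rw [hF]
  exact
    { half_integral := ⟨1, by norm_num⟩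
      finiteIndex := (torsionStab_isCongruenceSubgroup hC).finiteIndex
      norm_multiplier := fun γ => (hψ γ).norm_eq_one
      smooth := contDiffOn_const.mul (torsionMu_contDiffOn hp hr h0 h1)
      transform := fun γ τ => by rw [ht]; ring
      harmonic := torsionMu_harmonic hp hr h0 h1 _
      growth := fun γ => by
        have h := (torsionMu_growth hp hr γ).const_mul (𝕚 ^ (a + 1))
        simpa only [PolyGrowth, mul_left_comm] using h }

theorem exists_hasParts (hC : 0 < C) (hgcd : Int.gcd A (C : ℤ) = 1) (hpos : 0 < (A : ℚ) / (C : ℚ))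
    (hlt : (A : ℚ) / (C : ℚ) < 1) (hodd : Odd a → (A : ℚ) / (C : ℚ) ≠ 1 / 2) :
    ∃ g : ℍ → ℂ, HasParts (1 / 2) (VHat A C a) (V A C a) g ∧ g ≠ 0 := by
  have hp := nonIntegral_of_mem_Ioo hpos hlt ((a : ℚ) / 2)
  have hr := nonIntegral_half
  have hCq : (0 : ℚ) < C := by exact_mod_cast hC
  have hA0 : 0 < A := by
    have := (div_pos_iff_of_pos_right hCq).mp hpos
    exact_mod_cast this
  have hA1 : A < C := by
    have := (div_lt_one hCq).mp hlt
    exact_mod_cast this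
  have heven : C = 2 → Even a := by
    rintro rfl
    rw [← Nat.not_odd_iff_even]
    intro h
    obtain rfl : A = 1 := by push_cast at hA1; omega
    exact hodd h (by norm_num)
  have hs : (1 : ℚ) / 2 + (((A : ℚ) / C, (a : ℚ) / 2) - ((1 : ℚ) / 2, (0 : ℚ))).1 = (A : ℚ) / C := by
    simp
  have hs2 : (((A : ℚ) / C, (a : ℚ) / 2) - ((1 : ℚ) / 2, (0 : ℚ))).2 = (a : ℚ) / 2 := by simp
  set b := torsionCoeff ((a : ℚ) / 2)
  have hb : ∀ n, ‖b n‖ ≤ 1 := fun n => (norm_torsionCoeff _ n).le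
  -- D = 2C clears the denominators of A/C and 1/2 and gives 16D² = 64C², the same N as in the
  -- non-holomorphic expansion.
  obtain ⟨m, c, hc⟩ := torsionHol_hasQExp hp hr (D := 2 * C) (by positivity) (k := 2 * A) (l := C)
    (by push_cast; field_simp) (by push_cast; ring)
  set g : ℍ → ℂ := fun τ => 𝕚 ^ (a + 1) * (𝕚 / 2) * nonHol ((A / C : ℚ) : ℝ) b τ
  have hI : 𝕚 ^ (a + 1) * (𝕚 / 2) ≠ 0 :=
    mul_ne_zero (pow_ne_zero _ Complex.I_ne_zero) (div_ne_zero Complex.I_ne_zero two_ne_zero)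
  refine ⟨g, ⟨fun τ => ?_, 16 * (2 * C) ^ 2, fun n => 𝕚 ^ (a + 1) * c n,
    fun n => 𝕚 ^ (a + 1) * (𝕚 / 2) * nonHolCoeff A C b n, by positivity,
    ⟨m, fun n hn => by simp only [hc.1 n hn, mul_zero]⟩,
    fun n hn => by simp only [nonHolCoeff_eq_zero hA0 hA1 b hn, mul_zero], fun τ => ?_, fun τ => ?_⟩, ?_⟩
  · rw [VHat_eq hC, V_eq hC, torsionMu_eq_of_sign (hs.symm ▸ hpos) (hs.symm ▸ hlt), hs, hs2]
    simp only [g]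
    ring
  · rw [V_eq hC]
    refine ((hc.2 τ).mul_left _).congr_fun fun n => ?_
    rw [mul_assoc]
  · refine ((hasSum_nonHolCoeff hA0 hA1 hb τ).mul_left _).congr_fun fun n => ?_
    simp only [mul_assoc]
  · obtain ⟨τ, hτ⟩ := exists_nonHol_ne_zero hA0 hA1 hgcd heven
    intro hg
    exact mul_ne_zero hI hτ (congrFun hg τ)

end Main

end MockV

end

theorem theorem1p1 (A : ℤ) (C a : ℕ) (hC : 0 < C) (ha : a ≤ 3) (hgcd : Int.gcd A (C : ℤ) = 1)
    (hpos : 0 < (A : ℚ) / (C : ℚ)) (hlt : (A : ℚ) / (C : ℚ) < 1)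
    (hodd : Odd a → (A : ℚ) / (C : ℚ) ≠ 1 / 2) :
    ∃ Γ : Subgroup SL(2, ℤ), (Γ : Set SL(2, ℤ)) = MockV.ASet C a ∧
      CongruenceSubgroup.IsCongruenceSubgroup Γ ∧
      MockV.IsMockModularForm (1 / 2) Γ (MockV.V A C a) ∧
      ∃ ψ : Γ → ℂ, (∀ γ : Γ, ∃ m : ℕ, 0 < m ∧ ψ γ ^ m = 1) ∧
        MockV.IsMockCompletion (1 / 2) Γ ψ (MockV.V A C a) (MockV.VHat A C a) := by
  refine ⟨MockV.torsionStab ((A : ℚ) / C, (a : ℚ) / 2) ⊓ MockV.torsionStab ((1 : ℚ) / 2, 0),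
    Set.ext fun γ => MockV.stab_iff_mem_ASet hC hgcd γ,
    MockV.torsionStab_isCongruenceSubgroup hC, ?_⟩
  obtain ⟨ψ, hψ, hF⟩ := MockV.exists_isHarmonicMaassForm (a := a) hC hpos hlt rfl
  have hparts := MockV.exists_hasParts (a := a) hC hgcd hpos hlt hodd
  exact ⟨⟨ψ, _, hF, hparts⟩, ψ, hψ, hF, hparts⟩
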